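/- **Proposition.** *Model.* A limit order book has price levels $1,\dots,N$; its state is $x\in\mathbb Z^N$, where $x_l>0$ (resp. $x_l<0$) means $|x_l|$ outstanding ask (resp. bid) orders at level $l$. Let $p_A(x)=\min(\{l:x_l>0\}\cup\{N+1\})$, $p_B(x)=\max(\{l:x_l<0\}\cup\{0\})$, $p_M=(p_A+p_B)/2$ and $S=p_A-p_B$. To each level $l$ belongs a factor $X_l=X_l(x)$. The book $Q=(Q(t))_{t\ge0}$ is a non-exploding continuous-time Markov chain on $\mathbb Z^N$ in which unit orders arrive, at rates that depend on the queue size $k=|x_l|$ and the factor at level $l$: limit sells at levels $l>p_B$ at rate $\lambda^A_k(X_l)$ and limit buys at levels $l<p_A$ at rate $\lambda^B_k(X_l)$; market buys at $p_A$ at rate $\mu^A_k(X_{p_A})$ and market sells at $p_B$ at rate $\mu^B_k(X_{p_B})$; cancellations at non-empty levels $l\ge p_A$ at rate $\phi^A_k(X_l)$ and at non-empty levels $l\le p_B$ at rate $\phi^B_k(X_l)$. Fix queue sizes $q_0^A,q_0^B\ge1$ and a spread $s_0\ge1$ such that the event $E=\{|Q_{p_A}(0)|=q_0^A,\ |Q_{p_B}(0)|=q_0^B,\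 S(0)=s_0\}$ has positive probability. Assume that in books with non-empty sides and spread $s_0$ the factors $X_{p_B+m}$, $0\le m\le s_0$, depend on $m$ only. With these values of the factors assume, for $i\in\{A,B\}$, that $\lambda_k^i(X_{p_i})>0$ for $k\ge0$ and $d^i_k:=\mu_k^i(X_{p_i})+\phi_k^i(X_{p_i})>0$ for $k\ge1$, and that the total rates of in-spread arrivals on the two sides agree: $$\Lambda:=\Lambda_{s_0}:=\sum_{m=1}^{s_0-1}\lambda^A_0(X_{p_A-m})=\sum_{m=1}^{s_0-1}\lambda^B_0(X_{p_B+m}).$$ Write $\lambda^i_k$ for $\lambda^i_k(X_{p_i})$, and let $\sigma_i$ be the first-passage time to $0$ of the best queue of side $i$ at these rates, i.e. of a (non-exploding) birth–death process with birth rates $\lambda_k^i$ and death rates $d_k^i$ started at $q_0^i$. *(1) Depletion times.* $\sigma_i$ has a density $f_{\sigma_i}$ on $(0,\infty)$ (of mass $\mathbb P(\sigma_i<\infty)$), and for every $s\in\mathbb C$ for which the integral converges absolutely, in particular whenever $\operatorname{Re}s\ge0$, the continued fractions below converge (as limits of their approximants) and $$\hat f_{\sigma_i}(s):=\int_0^\infty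 e^{-st}f_{\sigma_i}(t)\,dt=\prod_{j=1}^{q_0^i}\left(-\frac1{\lambda^i_{j-1}}\ \mathop{\mathrm K}_{k=j}^{\infty}\frac{-\lambda^i_{k-1}\,d^i_k}{\lambda^i_k+d^i_k+s}\right).$$ *(2) Price moves.* For $\{i,j\}=\{A,B\}$ put $$\hat F_{i,j}(s)=\frac1s\left(\hat f_{\sigma_i}(\Lambda+s)+\frac{\Lambda}{\Lambda+s}\bigl(1-\hat f_{\sigma_i}(\Lambda+s)\bigr)\right)\left(\hat f_{\sigma_j}(\Lambda-s)+\frac{\Lambda}{\Lambda-s}\bigl(1-\hat f_{\sigma_j}(\Lambda-s)\bigr)\right),$$ and let $\tau=\inf\{t\ge0:p_M(t)\ne p_M(0)\}$. Let $\gamma>0$ be such that $\gamma<\Lambda$, or $\sigma_j<\infty$ almost surely and $\mathbb E[e^{\gamma\sigma_j}]<\infty$. Then the inverse Laplace transform of $\hat F_{i,j}$ at $0$ along $\operatorname{Re}s=\gamma$, $$\lim_{T\to\infty}\frac1{2\pi \mathrm i}\int_{\gamma-\mathrm iT}^{\gamma+\mathrm iT}\hat F_{i,j}(s)\,ds,$$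 exists; for $(i,j)=(A,B)$ it equals $\mathbb P[p_M(\tau)>p_M(0)\mid E]$ and for $(i,j)=(B,A)$ it equals $\mathbb P[p_M(\tau)<p_M(0)\mid E]$. *(3) Spread one.* If $s_0=1$, then $\hat F_{i,j}(s)=\frac1s\hat f_{\sigma_i}(s)\hat f_{\sigma_j}(-s)$. -/

import Mathlib

open MeasureTheory ProbabilityTheory Filter Topology
open scoped NNReal ENNReal

noncomputable section

namespace LOB

/-! ### Continuous-time Markov jump processes -/

section Jump

variable {S : Type*}

/-- Total jump rate out of `x`, for off-diagonal jump rates `r`. -/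
def totalRate (r : S → S → ℝ≥0) (x : S) : ℝ≥0 := ∑' y, r x y

open Classical in
/-- Transition probabilities of the embedded jump chain (a state without exits is absorbing). -/
def jumpProb (r : S → S → ℝ≥0) (x y : S) : ℝ≥0 :=
  if totalRate r x = 0 then (if y = x then 1 else 0) else r x y / totalRate r x

/-- `Z` is a (non-exploding, right-continuous) continuous-time Markov chain with jump rates `r`:
it has a jump chain `Y` with transition probabilities `jumpProb r`, and, given the jump chain, its
holding times `H k` are independent and exponential with parameters `totalRate r (Y k)`
(parameter `0` meaning an infinite holding time).  The initial law is arbitrary. -/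
def IsMarkovJumpProcess [MeasurableSpace S] {Ω : Type*} [MeasurableSpace Ω] (P : Measure Ω)
    (r : S → S → ℝ≥0) (Z : ℝ≥0 → Ω → S) : Prop :=
  (∀ t, Measurable (Z t)) ∧
  ∃ (Y : ℕ → Ω → S) (H : ℕ → Ω → ℝ≥0∞),
    (∀ k, Measurable (Y k)) ∧ (∀ k, Measurable (H k)) ∧
    (∀ (n : ℕ) (y : ℕ → S) (t : ℕ → ℝ≥0),
      P {ω | ∀ k ≤ n, Y k ω = y k ∧ (t k : ℝ≥0∞) < H k ω} =
        P {ω | Y 0 ω = y 0} *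
          (∏ k ∈ Finset.range n, (jumpProb r (y k) (y (k + 1)) : ℝ≥0∞)) *
          ∏ k ∈ Finset.range (n + 1),
            ENNReal.ofReal (Real.exp (-((totalRate r (y k) : ℝ) * (t k : ℝ))))) ∧
    (∀ᵐ ω ∂P,
      (∀ (n : ℕ) (t : ℝ≥0), ∑ k ∈ Finset.range n, H k ω ≤ t →
        (t : ℝ≥0∞) < ∑ k ∈ Finset.range (n + 1), H k ω → Z t ω = Y n ω) ∧
      ∑' k, H k ω = ∞)

/-- First-passage time to the state `y` (`∞` if `y` is never reached). -/
def firstPassage {Ω : Type*} (Z : ℝ≥0 → Ω → S) (y : S) (ω : Ω) : ℝ≥0∞ :=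
  ⨅ (t : ℝ≥0) (_ : Z t ω = y), (t : ℝ≥0∞)

end Jump

/-- Jump rates of the birth-death chain on `ℕ` with birth rates `b` and death rates `d`
(no death in state `0`). -/
def birthDeathRate (b d : ℕ → ℝ≥0) (k l : ℕ) : ℝ≥0 :=
  if l = k + 1 then b k else if l + 1 = k then d k else 0

/-- `f` is a probability density on `(0, ∞)` of the (possibly infinite) random time `σ`;
the mass of `f` is `P (σ < ∞)`. -/
def IsDensity {Ω : Type*} [MeasurableSpace Ω] (P : Measure Ω) (σ : Ω → ℝ≥0∞) (f : ℝ → ℝ) : Prop :=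
  Measurable f ∧ (∀ t, 0 ≤ f t) ∧
    ∀ t : ℝ, 0 ≤ t → P {ω | σ ω ≤ ENNReal.ofReal t} = ∫⁻ u in Set.Ioc 0 t, ENNReal.ofReal (f u)

/-! ### Continued fractions and Laplace inversion -/

/-- `cfApprox a b n j` is the `n`-th approximant
`a_j / (b_j + a_{j+1} / (b_{j+1} + ⋯ + a_{j+n-1} / b_{j+n-1}))`. -/
def cfApprox (a b : ℕ → ℂ) : ℕ → ℕ → ℂ
  | 0, _ => 0
  | n + 1, j => a j / (b j + cfApprox a b n (j + 1))

/-- The continued fraction `K_{k=j}^∞ a_k / b_k` converges and has the value `v`. -/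
def HasContFrac (a b : ℕ → ℂ) (j : ℕ) (v : ℂ) : Prop :=
  Tendsto (fun n => cfApprox a b n j) atTop (𝓝 v)

/-- The value of the continued fraction `K_{k=j}^∞ a_k / b_k`. -/
def contFrac (a b : ℕ → ℂ) (j : ℕ) : ℂ :=
  limUnder atTop (fun n => cfApprox a b n j)

/-- Partial numerators `-λ_{k-1} d_k` (used for `k ≥ 1`). -/
def numer (b d : ℕ → ℝ≥0) (k : ℕ) : ℂ := -((b (k - 1) : ℝ) : ℂ) * ((d k : ℝ) : ℂ)

/-- Partial denominators `λ_k + d_k + s`. -/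
def denom (b d : ℕ → ℝ≥0) (s : ℂ) (k : ℕ) : ℂ := ((b k : ℝ) : ℂ) + ((d k : ℝ) : ℂ) + s

/-- `∏_{j=1}^q ( -1/λ_{j-1} K_{k=j}^∞ (-λ_{k-1} d_k) / (λ_k + d_k + s) )`. -/
def cfTransform (b d : ℕ → ℝ≥0) (q : ℕ) (s : ℂ) : ℂ :=
  ∏ j ∈ Finset.Icc 1 q,
    (-(1 / ((b (j - 1) : ℝ) : ℂ)) * contFrac (numer b d) (denom b d s) j)

/-- Transform of the minimum of a time with transform `f` and an independent exponential time
of rate `Λ`. -/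
def clockTransform (f : ℂ → ℂ) (Λ : ℝ) (s : ℂ) : ℂ :=
  f (Λ + s) + Λ / (Λ + s) * (1 - f (Λ + s))

/-- `(1/s) (f_i(Λ+s) + Λ/(Λ+s) (1 - f_i(Λ+s))) (f_j(Λ-s) + Λ/(Λ-s) (1 - f_j(Λ-s)))`. -/
def moveTransform (fi fj : ℂ → ℂ) (Λ : ℝ) (s : ℂ) : ℂ :=
  1 / s * clockTransform fi Λ s * clockTransform fj Λ (-s)

/-- The inverse Laplace transform of `F`, computed by the Bromwich integral
`(1 / 2πi) ∫_{γ - i∞}^{γ + i∞} e^{st} F(s) ds` (as a principal value at infinity) on the vertical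
line of abscissa `γ`, exists at `t` and equals `v`. -/
def HasInverseLaplaceAt (F : ℂ → ℂ) (γ t : ℝ) (v : ℂ) : Prop :=
  (∀ T : ℝ, IntervalIntegrable
    (fun u : ℝ => Complex.exp ((γ + u * Complex.I) * t) * F (γ + u * Complex.I)) volume (-T) T) ∧
  Tendsto (fun T : ℝ => 1 / (2 * Real.pi : ℂ) *
    ∫ u in (-T)..T, Complex.exp ((γ + u * Complex.I) * t) * F (γ + u * Complex.I)) atTop (𝓝 v)

/-! ### The limit order book -/

/-- State of a book with price levels `1, …, N`; the entry `i : Fin N` belongs to level `i + 1`.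
Positive entries are ask orders, negative entries are bid orders. -/
abbrev Book (N : ℕ) := Fin N → ℤ

/-- The two sides of the book. -/
inductive Side
  | ask
  | bid

section Book

variable {N : ℕ}

/-- Price level of an index. -/
def level (i : Fin N) : ℕ := (i : ℕ) + 1

/-- Best ask: lowest level with outstanding ask orders, `N + 1` if there is none. -/
def bestAsk (x : Book N) : ℕ := sInf (insert (N + 1) {l | ∃ i, level i = l ∧ 0 < x i})

/-- Best bid: highest level with outstanding bid orders, `0` if there is none. -/
def bestBid (x : Book N) : ℕ := sSup (insert 0 {l | ∃ i, level i = l ∧ x i < 0})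

/-- Mid-price. -/
def midPrice (x : Book N) : ℝ := ((bestBid x : ℝ) + (bestAsk x : ℝ)) / 2

/-- Bid-ask spread. -/
def spread (x : Book N) : ℤ := (bestAsk x : ℤ) - (bestBid x : ℤ)

/-- Number of outstanding orders at level `l` (`0` if `l` is not one of the levels `1, …, N`). -/
def queueSize (x : Book N) (l : ℕ) : ℕ := ∑ i, if level i = l then (x i).natAbs else 0

/-- Order-flow specification: a state factor `X_i` for every price level and the rates of limit
orders, market orders and cancellations as functions of the current size of the queue and of the
factor at that level.  Rates carry the side of the book on which the order rests
(for `lam` and `phi`) or against which it is executed (for `mu`). -/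
structure OrderFlow (N : ℕ) (𝒳 : Type*) where
  /-- state factor of a price level -/
  factor : Book N → Fin N → 𝒳
  /-- limit order arrivals -/
  lam : Side → ℕ → 𝒳 → ℝ≥0
  /-- market orders -/
  mu : Side → ℕ → 𝒳 → ℝ≥0
  /-- cancellations -/
  phi : Side → ℕ → 𝒳 → ℝ≥0

variable {𝒳 : Type*}

/-- Rate of the transition `Q_i → Q_i + 1`: limit sell above the best bid, market sell at the best
bid, or cancellation of an outstanding bid. -/
def upRate (R : OrderFlow N 𝒳) (x : Book N) (i : Fin N) : ℝ≥0 :=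
  (if bestBid x < level i then R.lam .ask (x i).natAbs (R.factor x i) else 0) +
  (if level i = bestBid x then R.mu .bid (x i).natAbs (R.factor x i) else 0) +
  (if level i ≤ bestBid x ∧ x i ≠ 0 then R.phi .bid (x i).natAbs (R.factor x i) else 0)

/-- Rate of the transition `Q_i → Q_i - 1`: limit buy below the best ask, market buy at the best
ask, or cancellation of an outstanding ask. -/
def downRate (R : OrderFlow N 𝒳) (x : Book N) (i : Fin N) : ℝ≥0 :=
  (if level i < bestAsk x then R.lam .bid (x i).natAbs (R.factor x i) else 0) +
  (if level i = bestAsk x then R.mu .ask (x i).natAbs (R.factor x i) else 0) +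
  (if bestAsk x ≤ level i ∧ x i ≠ 0 then R.phi .ask (x i).natAbs (R.factor x i) else 0)

/-- Jump rates of the order book on `ℤ^N`. -/
def bookRate (R : OrderFlow N 𝒳) (x y : Book N) : ℝ≥0 :=
  ∑ i, ((if y = x + Pi.single i 1 then upRate R x i else 0) +
        (if y = x - Pi.single i 1 then downRate R x i else 0))

/-- Time of the first change of the mid-price.  (If the mid-price never changes, this is `0`, and
neither of the two events below occurs.) -/
def moveTime {Ω : Type*} (Q : ℝ≥0 → Ω → Book N) (ω : Ω) : ℝ≥0 :=
  sInf {t | midPrice (Q t ω) ≠ midPrice (Q 0 ω)}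

/-- The first mid-price move is an increase. -/
def moveUp {Ω : Type*} (Q : ℝ≥0 → Ω → Book N) : Set Ω :=
  {ω | midPrice (Q 0 ω) < midPrice (Q (moveTime Q ω) ω)}

/-- The first mid-price move is a decrease. -/
def moveDown {Ω : Type*} (Q : ℝ≥0 → Ω → Book N) : Set Ω :=
  {ω | midPrice (Q (moveTime Q ω) ω) < midPrice (Q 0 ω)}

/-- The initial best queues have sizes `q .ask`, `q .bid` and the initial spread is `s₀`. -/
def initialEvent {Ω : Type*} (Q : ℝ≥0 → Ω → Book N) (q : Side → ℕ) (s₀ : ℕ) : Set Ω :=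
  {ω | queueSize (Q 0 ω) (bestAsk (Q 0 ω)) = q .ask ∧
       queueSize (Q 0 ω) (bestBid (Q 0 ω)) = q .bid ∧
       spread (Q 0 ω) = s₀}

/-- In two-sided books with spread `s₀`, the factors at the levels from the best bid to the best ask
do not change as long as the best quotes do not: the factor `m` ticks above the best bid is
`ξ m`.  In particular `X_{p_B} = ξ 0` and `X_{p_A} = ξ s₀`.  Factors at other levels, or at other
spreads, are arbitrary functions of the whole book. -/
def FactorsAtSpread (R : OrderFlow N 𝒳) (s₀ : ℕ) (ξ : ℕ → 𝒳) : Prop :=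
  ∀ (x : Book N) (i : Fin N), 1 ≤ bestBid x → bestAsk x ≤ N → spread x = s₀ →
    bestBid x ≤ level i → level i ≤ bestAsk x → R.factor x i = ξ (level i - bestBid x)

/-- Position of the best quote of a side, in ticks above the best bid, at spread `s₀`. -/
def quotePos (s₀ : ℕ) : Side → ℕ
  | .ask => s₀
  | .bid => 0

/-- Birth rates `λ_k(X_{p_i})` of the best queue of side `i` at spread `s₀`. -/
def birth (R : OrderFlow N 𝒳) (s₀ : ℕ) (ξ : ℕ → 𝒳) (i : Side) (k : ℕ) : ℝ≥0 :=
  R.lam i k (ξ (quotePos s₀ i))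

/-- Death rates `μ_k(X_{p_i}) + φ_k(X_{p_i})` of the best queue of side `i` at spread `s₀`. -/
def death (R : OrderFlow N 𝒳) (s₀ : ℕ) (ξ : ℕ → 𝒳) (i : Side) (k : ℕ) : ℝ≥0 :=
  R.mu i k (ξ (quotePos s₀ i)) + R.phi i k (ξ (quotePos s₀ i))

/-- Total rate `∑_{m=1}^{s₀-1} λ_0(X_{p_A - m})` of limit sells inside the spread. -/
def insideAskRate (R : OrderFlow N 𝒳) (s₀ : ℕ) (ξ : ℕ → 𝒳) : ℝ≥0 :=
  ∑ m ∈ Finset.Icc 1 (s₀ - 1), R.lam .ask 0 (ξ (s₀ - m))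

/-- Total rate `∑_{m=1}^{s₀-1} λ_0(X_{p_B + m})` of limit buys inside the spread. -/
def insideBidRate (R : OrderFlow N 𝒳) (s₀ : ℕ) (ξ : ℕ → 𝒳) : ℝ≥0 :=
  ∑ m ∈ Finset.Icc 1 (s₀ - 1), R.lam .bid 0 (ξ m)

end Book

/-- Abscissae `γ > 0` at which the two-sided Laplace transform of the law of
`(σ_i ∧ τ_j) - (σ_j ∧ τ_i)` converges, the `τ`s being exponential of rate `Λ`:
either `γ < Λ`, or `σ_j` is almost surely finite with `E[exp(γ σ_j)] < ∞`. -/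
def Admissible {Ω : Type*} [MeasurableSpace Ω] (P : Measure Ω) (σj : Ω → ℝ≥0∞) (Λ γ : ℝ) : Prop :=
  0 < γ ∧ (γ < Λ ∨
    ((∀ᵐ ω ∂P, σj ω < ∞) ∧ Integrable (fun ω => Real.exp (γ * (σj ω).toReal)) P))

end LOB

end

noncomputable section

namespace LOB

set_option linter.unusedSectionVars false

/-! ### Discounting -/

/-! Everything rests on one fact about non-exploding jump chains. Discounting exponential holding
times at a rate s > 0 gives a path the weight ∏ r(y_k, y_{k+1}) / (q(y_k) + s). Hence a bounded g
with (q + s) g = Σ r g on a set C is, at a point of C, the mean of e^{-sT} g(exit state), where T is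
the exit time: the remainder after n jumps is at most E e^{-s T_n}, which tends to 0 because T_n → ∞
(`tsum_setLIntegral_exitEvent`). Letting s → 0 turns this into exit probabilities
(`measure_exitInto`).

Depletion times. Decomposing at the first jump produces the passage density as the increasing limit
of densities for at most n jumps. Its Laplace transform `lap`, with values in [0, ∞] and defined at
every real abscissa, is the minimal non-negative solution of the resolvent equation. By the fact
above it is the transform of σ for s > 0, and uniqueness of Laplace transforms identifies the law of
σ on {σ < ∞}. For the continued fractions, the approximants at level j are, up to the factor
-λ_{j-1}, transforms of the passage from j to j-1 before reaching j+n. At a real abscissa with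
finite `lap` they increase and stay below `lap j / lap (j-1)`; at complex s their increments are
dominated by the real ones, so they converge (`exists_tendsto_stepApprox`). The product of the
limits and the complex Laplace integral both solve the resolvent equation with value 1 at 0 and are
dominated by `lap`, so they coincide (`eq_of_dominated`).

Price moves. While the best quotes stand still, the two best queues behave as independent
birth-death chains, and in-spread orders on either side arrive at rate Λ. The mid-price goes up if
the ask queue empties or a limit buy arrives inside the spread, that is, at the minimum of σ_A and
an exponential time; the downward move is symmetric. With f and S the density and survival function
of these minima, the integral of e^{-st} f_a(t) S_c(t) solves the resolvent equation of the book
(`raceProb_succ`, `totalRate_add_mul_quoteValue`). Letting s → 0, the probability of an upward move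
is ∫ f_A S_B (`cond_moveUp`).

Inversion. `clockTransform` is the Laplace transform of such a density, so F(s) = s⁻¹ α̂(s) β̂(-s)
with α, β the densities of the two minima. The factor s⁻¹ α̂(s) transforms the distribution function
1 - A. It is O(|s|⁻²) on the line, because α has an integrable derivative, so Fourier inversion and
Fubini apply and give ∫ (1 - A) β (`hasInverseLaplaceAt_zero`). Integration by parts identifies this
with the race integral. -/

/-- The discount factor `exp (-s h)` of a possibly infinite time `h`. -/
def discount (s : ℝ) (h : ℝ≥0∞) : ℝ≥0∞ :=
  if h = ∞ then 0 else ENNReal.ofReal (Real.exp (-(s * h.toReal)))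

lemma discount_top (s : ℝ) : discount s ∞ = 0 := by simp [discount]

lemma discount_zero (s : ℝ) : discount s 0 = 1 := by simp [discount]

lemma discount_of_ne_top (s : ℝ) {h : ℝ≥0∞} (hh : h ≠ ∞) :
    discount s h = ENNReal.ofReal (Real.exp (-(s * h.toReal))) := by simp [discount, hh]

lemma discount_add (s : ℝ) (h k : ℝ≥0∞) : discount s (h + k) = discount s h * discount s k := by
  by_cases hh : h = ∞
  · simp [hh, discount_top]
  by_cases hk : k = ∞
  · simp [hk, discount_top]
  rw [discount_of_ne_top s hh, discount_of_ne_top s hk,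
    discount_of_ne_top s (ENNReal.add_ne_top.2 ⟨hh, hk⟩), ← ENNReal.ofReal_mul (Real.exp_nonneg _),
    ← Real.exp_add, ENNReal.toReal_add hh hk]
  congr 2; ring

lemma discount_sum (s : ℝ) (h : ℕ → ℝ≥0∞) (n : ℕ) :
    discount s (∑ k ∈ Finset.range n, h k) = ∏ k ∈ Finset.range n, discount s (h k) := by
  induction n with
  | zero => simp [discount_zero]
  | succ n ih => rw [Finset.sum_range_succ, Finset.prod_range_succ, discount_add, ih]

lemma discount_le_one {s : ℝ} (hs : 0 ≤ s) (h : ℝ≥0∞) : discount s h ≤ 1 := by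
  unfold discount
  split_ifs
  · simp
  · rw [ENNReal.ofReal_le_one, Real.exp_le_one_iff]
    have := mul_nonneg hs (ENNReal.toReal_nonneg (a := h))
    linarith

@[fun_prop]
lemma measurable_discount (s : ℝ) : Measurable (discount s) := by
  unfold discount
  refine Measurable.ite (measurableSet_singleton _) measurable_const ?_
  fun_prop

lemma discount_tendsto_zero {s : ℝ} (hs : 0 < s) {u : ℕ → ℝ≥0∞} (hu : Tendsto u atTop (𝓝 ∞)) :
    Tendsto (fun n => discount s (u n)) atTop (𝓝 0) := by
  rw [ENNReal.tendsto_nhds_zero]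
  intro ε hε
  obtain ⟨δ, hδ0, hδ⟩ := ENNReal.lt_iff_exists_nnreal_btwn.1 hε
  have hδ0' : (0 : ℝ) < δ := by exact_mod_cast hδ0
  -- The threshold is the time beyond which e^{-su} is below δ.
  have hev := hu.eventually (lt_mem_nhds (ENNReal.ofReal_lt_top (r := -Real.log δ / s)))
  filter_upwards [hev] with n hn
  unfold discount
  split_ifs with h
  · simp
  · refine le_trans ?_ hδ.le
    rw [← ENNReal.ofReal_coe_nnreal]
    apply ENNReal.ofReal_le_ofReal
    rw [← Real.le_log_iff_exp_le hδ0']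
    have h1 : -Real.log δ / s < (u n).toReal := by
      by_contra hcon
      exact absurd hn (not_lt.2 (ENNReal.le_ofReal_iff_toReal_le h (le_trans
        ENNReal.toReal_nonneg (not_lt.1 hcon)) |>.2 (not_lt.1 hcon)))
    rw [div_lt_iff₀ hs] at h1
    linarith

/-- As the rate decreases to zero, the discount factor increases to the indicator of finiteness. -/
lemma tendsto_discount_inv_nat (h : ℝ≥0∞) :
    Tendsto (fun n : ℕ => discount (1 / ((n : ℝ) + 1)) h) atTop (𝓝 (if h = ∞ then 0 else 1)) := by
  by_cases hh : h = ∞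
  · simp [hh, discount_top]
  · simp only [hh, if_false]
    simp only [discount_of_ne_top _ hh]
    rw [← ENNReal.ofReal_one]
    apply ENNReal.tendsto_ofReal
    have h1 : Tendsto (fun n : ℕ => Real.exp (-(1 / ((n : ℝ) + 1) * h.toReal))) atTop
        (𝓝 (Real.exp (-(0 * h.toReal)))) := by
      refine (Real.continuous_exp.tendsto _).comp ?_
      exact (tendsto_one_div_add_atTop_nhds_zero_nat.mul_const _).neg
    simpa using h1

lemma lintegral_exp_neg_mul_Ioi {s : ℝ} (hs : 0 < s) (a : ℝ) :
    ∫⁻ t in Set.Ioi a, ENNReal.ofReal (Real.exp (-(s * t))) =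
      ENNReal.ofReal (Real.exp (-(s * a)) / s) := by
  have h1 := integrableOn_exp_mul_Ioi (a := -s) (by linarith) a
  have h2 := integral_exp_mul_Ioi (a := -s) (by linarith) a
  simp only [neg_mul] at h1 h2
  rw [← ofReal_integral_eq_lintegral_ofReal h1 (ae_of_all _ fun _ => Real.exp_nonneg _), h2]
  rw [neg_div_neg_eq]

lemma lintegral_mul_exp_neg_mul_Ioi {s : ℝ} (hs : 0 < s) (a : ℝ) :
    ∫⁻ t in Set.Ioi a, ENNReal.ofReal (s * Real.exp (-(s * t))) =
      ENNReal.ofReal (Real.exp (-(s * a))) := by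
  simp_rw [ENNReal.ofReal_mul hs.le]
  rw [lintegral_const_mul' _ _ ENNReal.ofReal_ne_top, lintegral_exp_neg_mul_Ioi hs,
    ← ENNReal.ofReal_mul hs.le, mul_div_cancel₀ _ hs.ne']

/-- An independent exponential clock of rate s rings after x with probability `discount s x`; the
integral is the probability that it rings before x. This rewrites the discount through the tails of
x, which is all that the definition of the process provides. -/
lemma discount_add_lintegral_eq_one {s : ℝ} (hs : 0 < s) (x : ℝ≥0∞) :
    discount s x + ∫⁻ t in Set.Ioi (0 : ℝ),
      ENNReal.ofReal (s * Real.exp (-(s * t))) * (if ENNReal.ofReal t < x then 1 else 0) = 1 := by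
  have htot := lintegral_mul_exp_neg_mul_Ioi hs 0
  simp only [mul_zero, neg_zero, Real.exp_zero, ENNReal.ofReal_one] at htot
  by_cases hx : x = ∞
  · simp [hx, discount_top, htot]
  have hx0 := ENNReal.toReal_nonneg (a := x)
  have h1 : ∫⁻ t in Set.Ioi (0 : ℝ),
      ENNReal.ofReal (s * Real.exp (-(s * t))) * (if ENNReal.ofReal t < x then 1 else 0) =
      ∫⁻ t in Set.Ioc 0 x.toReal, ENNReal.ofReal (s * Real.exp (-(s * t))) := by
    rw [setLIntegral_congr (Ioo_ae_eq_Ioc (a := (0:ℝ)) (b := x.toReal)).symm,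
      ← Set.Ioi_inter_Iio, Set.inter_comm, ← setLIntegral_indicator measurableSet_Iio]
    refine setLIntegral_congr_fun measurableSet_Ioi fun t ht => ?_
    have : ENNReal.ofReal t < x ↔ t < x.toReal := by
      rw [ENNReal.ofReal_lt_iff_lt_toReal (le_of_lt ht) hx]
    by_cases h : t < x.toReal <;> simp [Set.indicator, this, h]
  rw [h1, discount_of_ne_top s hx, ← lintegral_mul_exp_neg_mul_Ioi hs, add_comm,
    ← lintegral_union measurableSet_Ioi (Set.Ioc_disjoint_Ioi le_rfl),
    Set.Ioc_union_Ioi_eq_Ioi hx0, htot]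

/-- Mean discount factor of an exponential time. -/
lemma lintegral_discount_of_exponential_tail {Ω : Type*} [MeasurableSpace Ω] (ν : Measure Ω)
    [IsFiniteMeasure ν] {h : Ω → ℝ≥0∞} (hh : Measurable h) (hpos : ∀ᵐ ω ∂ν, 0 < h ω)
    {c : ℝ≥0∞} (q s : ℝ≥0) (hs : 0 < s)
    (htail : ∀ t : ℝ≥0, ν {ω | (t : ℝ≥0∞) < h ω} =
      c * ENNReal.ofReal (Real.exp (-((q : ℝ) * t)))) :
    ∫⁻ ω, discount s (h ω) ∂ν = c * (q / (q + s) : ℝ≥0) := by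
  have hc : ν Set.univ = c := by
    have h0 := htail 0
    simp only [ENNReal.coe_zero, NNReal.coe_zero, mul_zero, neg_zero, Real.exp_zero,
      ENNReal.ofReal_one, mul_one] at h0
    rw [← h0]
    exact (measure_congr (eventuallyEq_univ.2 hpos)).symm
  have hcfin : c ≠ ∞ := hc ▸ measure_ne_top ν _
  have hF : ∫⁻ ω, (∫⁻ t in Set.Ioi (0 : ℝ),
      ENNReal.ofReal (s * Real.exp (-(s * t))) * (if ENNReal.ofReal t < h ω then 1 else 0)) ∂ν
      = c * (s / (q + s) : ℝ≥0) := by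
    rw [lintegral_lintegral_swap]
    · have : ∀ t ∈ Set.Ioi (0:ℝ), ∫⁻ ω, ENNReal.ofReal (s * Real.exp (-(s * t))) *
          (if ENNReal.ofReal t < h ω then 1 else 0) ∂ν =
          c * (ENNReal.ofReal s * ENNReal.ofReal (Real.exp (-((q + s) * t)))) := by
        intro t ht
        rw [lintegral_const_mul' _ _ ENNReal.ofReal_ne_top]
        have h1 : ∫⁻ ω, (if ENNReal.ofReal t < h ω then 1 else 0) ∂ν =
            ν {ω | ENNReal.ofReal t < h ω} := by
          rw [← lintegral_indicator_one (measurableSet_lt measurable_const hh)]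
          simp [Set.indicator]
        have h2 := htail t.toNNReal
        rw [Real.coe_toNNReal t (le_of_lt ht)] at h2
        rw [h1]
        change ENNReal.ofReal _ * ν {ω | ((t.toNNReal : ℝ≥0) : ℝ≥0∞) < h ω} = _
        rw [h2, mul_left_comm, ← ENNReal.ofReal_mul (by positivity),
          ← ENNReal.ofReal_mul (by positivity), mul_assoc, ← Real.exp_add]
        congr 4; ring
      rw [setLIntegral_congr_fun measurableSet_Ioi this, lintegral_const_mul' _ _ hcfin,
        lintegral_const_mul' _ _ ENNReal.ofReal_ne_top, lintegral_exp_neg_mul_Ioi (by positivity),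
        ← ENNReal.ofReal_mul (by positivity), ← ENNReal.ofReal_coe_nnreal]
      congr 2
      simp [div_eq_mul_inv]
    · apply Measurable.aemeasurable
      refine Measurable.mul (by fun_prop) (Measurable.ite ?_ measurable_const measurable_const)
      exact measurableSet_lt (by fun_prop) (by fun_prop)
  -- The discount is complementary to the clock probability found in `hF`; cancelling the finite
  -- mass c s/(q+s) from c leaves c q/(q+s).
  have hsum : ∫⁻ ω, discount s (h ω) ∂ν + c * (s / (q + s) : ℝ≥0) = c := by
    rw [← hF, ← lintegral_add_left (by fun_prop), ← hc]
    rw [lintegral_congr fun ω => discount_add_lintegral_eq_one (by exact_mod_cast hs) (h ω),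
      lintegral_one]
  have hqs : (q / (q + s) : ℝ≥0) + (s / (q + s) : ℝ≥0) = 1 := by
    rw [← add_div, div_self]; positivity
  have h2 : c * (q / (q + s) : ℝ≥0) + c * (s / (q + s) : ℝ≥0) = c := by
    rw [← mul_add, ← ENNReal.coe_add, hqs]; simp
  exact (ENNReal.add_left_inj (ENNReal.mul_ne_top hcfin ENNReal.coe_ne_top)).1
    (hsum.trans h2.symm)

/-! ### Jump chains with exponential holding times -/

section JumpChain

variable {S : Type*}

lemma tsum_jumpProb {r : S → S → ℝ≥0} {x : S} (hr : Summable (r x)) :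
    ∑' y, (jumpProb r x y : ℝ≥0∞) = 1 := by
  classical
  by_cases h : totalRate r x = 0
  · have : ∀ y, (jumpProb r x y : ℝ≥0∞) = if y = x then 1 else 0 := by
      intro y; unfold jumpProb; simp only [h, if_true]; split_ifs <;> simp
    simp [this]
  · have h1 : ∀ y, (jumpProb r x y : ℝ≥0∞) = r x y * (totalRate r x : ℝ≥0∞)⁻¹ := by
      intro y
      unfold jumpProb
      rw [if_neg h, ENNReal.coe_div h, div_eq_mul_inv]
    simp_rw [h1]
    rw [ENNReal.tsum_mul_right, ← ENNReal.coe_tsum hr]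
    exact ENNReal.mul_inv_cancel (by simpa [totalRate] using h) ENNReal.coe_ne_top

/-- A jump probability times the mean discount of the holding time is the discounted jump kernel.
The total rate cancels, and in an absorbing state both sides vanish. -/
lemma jumpProb_mul_div {r : S → S → ℝ≥0} {x : S} (hr : Summable (r x)) (y : S) (s : ℝ≥0) :
    jumpProb r x y * (totalRate r x / (totalRate r x + s)) = r x y / (totalRate r x + s) := by
  unfold jumpProb
  split_ifs with h h' <;> try
    have h0 : r x y ≤ 0 := h ▸ hr.le_tsum' y
    simp [h, nonpos_iff_eq_zero.1 h0]
  field_simp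

lemma rate_ne_zero_of_jumpProb_ne_zero {r : S → S → ℝ≥0} {x y : S} (hxy : jumpProb r x y ≠ 0)
    (hne : y ≠ x) : r x y ≠ 0 := by
  unfold jumpProb at hxy
  split_ifs at hxy with h
  · simp at hxy
  · exact fun h0 => hxy (by simp [h0])

variable [MeasurableSpace S] {Ω : Type*} [MeasurableSpace Ω]

/-- `Y` is a jump chain with rates `r`, and given `Y` the holding times `H` are independent and
exponential. -/
structure IsJumpChain (P : Measure Ω) (r : S → S → ℝ≥0) (Y : ℕ → Ω → S) (H : ℕ → Ω → ℝ≥0∞) :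
    Prop where
  measurable_state : ∀ k, Measurable (Y k)
  measurable_holding : ∀ k, Measurable (H k)
  cylinder : ∀ (n : ℕ) (y : ℕ → S) (t : ℕ → ℝ≥0),
      P {ω | ∀ k ≤ n, Y k ω = y k ∧ (t k : ℝ≥0∞) < H k ω} =
        P {ω | Y 0 ω = y 0} *
          (∏ k ∈ Finset.range n, (jumpProb r (y k) (y (k + 1)) : ℝ≥0∞)) *
          ∏ k ∈ Finset.range (n + 1),
            ENNReal.ofReal (Real.exp (-((totalRate r (y k) : ℝ) * (t k : ℝ))))

/-- Extension of a finite path to all times. -/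
def extendPath {n : ℕ} (p : Fin (n + 1) → S) (k : ℕ) : S := p (Fin.ofNat (n + 1) k)

lemma extendPath_apply {n : ℕ} (p : Fin (n + 1) → S) {k : ℕ} (hk : k < n + 1) :
    extendPath p k = p ⟨k, hk⟩ := by
  unfold extendPath; congr; simp [Fin.ofNat, Nat.mod_eq_of_lt hk]

/-- The event that the chain follows `y` up to time `n`. -/
def followEvent (Y : ℕ → Ω → S) (n : ℕ) (y : ℕ → S) : Set Ω := {ω | ∀ k ≤ n, Y k ω = y k}

lemma mem_followEvent_extendPath (Y : ℕ → Ω → S) (n : ℕ) (ω : Ω) :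
    ω ∈ followEvent Y n (extendPath fun k : Fin (n + 1) => Y k ω) := by
  intro k hk
  rw [extendPath_apply _ (Nat.lt_succ_of_le hk)]

variable [Countable S] [MeasurableSingletonClass S] {P : Measure Ω} {r : S → S → ℝ≥0}
  {Y : ℕ → Ω → S} {H : ℕ → Ω → ℝ≥0∞}

lemma measurableSet_followEvent (hY : ∀ k, Measurable (Y k)) (n : ℕ) (y : ℕ → S) :
    MeasurableSet (followEvent Y n y) := by
  have : followEvent Y n y = ⋂ k, ⋂ (_ : k ≤ n), (Y k) ⁻¹' {y k} := by
    ext ω; simp [followEvent]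
  rw [this]
  exact MeasurableSet.iInter fun k => MeasurableSet.iInter fun _ => hY k (measurableSet_singleton _)

/-- Two functions with equal integrals over all path events have equal integrals over every event
that is determined by the path. -/
lemma setLIntegral_eq_of_followEvent (hY : ∀ k, Measurable (Y k)) (n : ℕ)
    (A : (ℕ → S) → Prop) (hA : ∀ y z : ℕ → S, (∀ k ≤ n, y k = z k) → A y → A z)
    {f g : Ω → ℝ≥0∞}
    (h : ∀ y, A y → ∫⁻ ω in followEvent Y n y, f ω ∂P = ∫⁻ ω in followEvent Y n y, g ω ∂P) :
    ∫⁻ ω in {ω | A fun k => Y k ω}, f ω ∂P = ∫⁻ ω in {ω | A fun k => Y k ω}, g ω ∂P := by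
  have hU : {ω | A fun k => Y k ω} =
      ⋃ p : {p : Fin (n + 1) → S // A (extendPath p)}, followEvent Y n (extendPath p.1) := by
    ext ω
    simp only [Set.mem_ofPred_eq, Set.mem_iUnion]
    constructor
    · intro hω
      exact ⟨⟨fun k => Y k ω, hA _ _ (mem_followEvent_extendPath Y n ω) hω⟩,
        mem_followEvent_extendPath Y n ω⟩
    · rintro ⟨p, hp⟩
      exact hA _ _ (fun k hk => (hp k hk).symm) p.2
  have hd : Pairwise (Function.onFun Disjoint
      fun p : {p : Fin (n + 1) → S // A (extendPath p)} => followEvent Y n (extendPath p.1)) := by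
    intro p p' hne
    refine Set.disjoint_left.2 fun ω h1 h2 => hne ?_
    ext k
    have := (h1 k (Nat.le_of_lt_succ k.2)).symm.trans (h2 k (Nat.le_of_lt_succ k.2))
    rwa [extendPath_apply _ k.2, extendPath_apply _ k.2] at this
  rw [hU, lintegral_iUnion (fun p => measurableSet_followEvent hY n _) hd,
    lintegral_iUnion (fun p => measurableSet_followEvent hY n _) hd]
  exact tsum_congr fun p => h _ p.2

namespace IsJumpChain

variable [IsProbabilityMeasure P]

lemma measure_inter_pos (hJ : IsJumpChain P r Y H) (n : ℕ) (y : ℕ → S) :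
    P {ω | ∀ k ≤ n, Y k ω = y k ∧ 0 < H k ω} =
      P {ω | Y 0 ω = y 0} * ∏ k ∈ Finset.range n, (jumpProb r (y k) (y (k + 1)) : ℝ≥0∞) := by
  simpa using hJ.cylinder n y 0

/-- The cylinder formula only speaks of events with `H k > t`, so positivity has to be extracted
from masses. At t = 0, the cylinders of length n+1 that extend a given path sum, over the last
state, to the mass of the path of length n, because jump probabilities sum to one. So `H (n+1) = 0`
carries no mass, by induction on n. -/
lemma ae_holding_pos (hJ : IsJumpChain P r Y H) (hr : ∀ x, Summable (r x)) :
    ∀ᵐ ω ∂P, ∀ k, 0 < H k ω := by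
  suffices h : ∀ n, ∀ᵐ ω ∂P, ∀ k ≤ n, 0 < H k ω by
    filter_upwards [ae_all_iff.2 h] with ω hω k using hω k k le_rfl
  have hmeas : ∀ n (y : ℕ → S), MeasurableSet {ω | ∀ k ≤ n, Y k ω = y k ∧ 0 < H k ω} := by
    intro n y
    have : {ω | ∀ k ≤ n, Y k ω = y k ∧ 0 < H k ω} =
        followEvent Y n y ∩ ⋂ k, ⋂ (_ : k ≤ n), {ω | 0 < H k ω} := by
      ext ω
      simp only [followEvent, Set.mem_ofPred_eq, Set.mem_inter_iff, Set.mem_iInter]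
      exact ⟨fun h => ⟨fun k hk => (h k hk).1, fun k hk => (h k hk).2⟩,
        fun h k hk => ⟨h.1 k hk, h.2 k hk⟩⟩
    rw [this]
    exact (measurableSet_followEvent hJ.measurable_state n y).inter
      (MeasurableSet.iInter fun k => MeasurableSet.iInter fun _ =>
        measurableSet_lt measurable_const (hJ.measurable_holding k))
  intro n
  induction n with
  | zero =>
    have hx : ∀ x : S, ∀ᵐ ω ∂P, Y 0 ω = x → 0 < H 0 ω := by
      intro x
      have h1 := hJ.measure_inter_pos 0 (fun _ => x)
      simp only [Nat.le_zero, forall_eq, Finset.range_zero, Finset.prod_empty, mul_one] at h1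
      have hm := hmeas 0 (fun _ => x)
      simp only [Nat.le_zero, forall_eq] at hm
      have h2 := ae_eq_of_subset_of_measure_ge (μ := P)
        (s := {ω | Y 0 ω = x ∧ 0 < H 0 ω}) (t := {ω | Y 0 ω = x}) (fun ω h => h.1) h1.ge
        hm.nullMeasurableSet (measure_ne_top _ _)
      filter_upwards [h2.mem_iff] with ω hω h
      exact (hω.2 h).2
    filter_upwards [ae_all_iff.2 hx] with ω hω k hk
    obtain rfl := Nat.le_zero.1 hk
    exact hω _ rfl
  | succ n ih =>
    have hx : ∀ p : Fin (n + 1) → S, ∀ᵐ ω ∂P,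
        (∀ k ≤ n, Y k ω = extendPath p k ∧ 0 < H k ω) → 0 < H (n + 1) ω := by
      intro p
      set y : S → ℕ → S := fun z => Function.update (extendPath p) (n + 1) z with hy
      have hyk : ∀ z k, k ≤ n → y z k = extendPath p k := fun z k hk => by
        simp [hy, Function.update_of_ne (show k ≠ n + 1 by omega)]
      have hyn : ∀ z, y z (n + 1) = z := fun z => by simp [hy]
      have hU : {ω | (∀ k ≤ n, Y k ω = extendPath p k ∧ 0 < H k ω) ∧ 0 < H (n + 1) ω} =
          ⋃ z, {ω | ∀ k ≤ n + 1, Y k ω = y z k ∧ 0 < H k ω} := by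
        ext ω
        simp only [Set.mem_ofPred_eq, Set.mem_iUnion, Nat.le_succ_iff]
        constructor
        · rintro ⟨h1, h2⟩
          refine ⟨Y (n + 1) ω, fun k hk => ?_⟩
          rcases hk with hk | rfl
          · rw [hyk _ _ hk]; exact h1 k hk
          · rw [hyn]; exact ⟨rfl, h2⟩
        · rintro ⟨z, hz⟩
          exact ⟨fun k hk => hyk z k hk ▸ hz k (Or.inl hk), (hz _ (Or.inr rfl)).2⟩
      have hmU : MeasurableSet
          {ω | (∀ k ≤ n, Y k ω = extendPath p k ∧ 0 < H k ω) ∧ 0 < H (n + 1) ω} := by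
        rw [hU]; exact MeasurableSet.iUnion fun z => hmeas _ _
      have hval : P {ω | (∀ k ≤ n, Y k ω = extendPath p k ∧ 0 < H k ω) ∧ 0 < H (n + 1) ω} =
          P {ω | ∀ k ≤ n, Y k ω = extendPath p k ∧ 0 < H k ω} := by
        rw [hU, measure_iUnion]
        · simp_rw [hJ.measure_inter_pos, Finset.prod_range_succ]
          have : ∀ z, P {ω | Y 0 ω = y z 0} *
              ((∏ k ∈ Finset.range n, (jumpProb r (y z k) (y z (k + 1)) : ℝ≥0∞)) *
                (jumpProb r (y z n) (y z (n + 1)) : ℝ≥0∞)) =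
              (P {ω | Y 0 ω = extendPath p 0} * ∏ k ∈ Finset.range n,
                (jumpProb r (extendPath p k) (extendPath p (k + 1)) : ℝ≥0∞)) *
                jumpProb r (extendPath p n) z := by
            intro z
            rw [hyk z 0 (Nat.zero_le _), hyk z n le_rfl, hyn, mul_assoc]
            congr 2
            refine Finset.prod_congr rfl fun k hk => ?_
            have := Finset.mem_range.1 hk
            rw [hyk z k (by omega), hyk z (k + 1) (by omega)]
          simp_rw [this]
          rw [ENNReal.tsum_mul_left, tsum_jumpProb (hr _), mul_one]
        · intro z z' hne
          refine Set.disjoint_left.2 fun ω h1 h2 => hne ?_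
          have := (h1 (n + 1) le_rfl).1.symm.trans (h2 (n + 1) le_rfl).1
          rwa [hyn, hyn] at this
        · exact fun z => hmeas _ _
      have h2 := ae_eq_of_subset_of_measure_ge (μ := P) (fun ω h => h.1) hval.ge
        hmU.nullMeasurableSet (measure_ne_top _ _)
      filter_upwards [h2.mem_iff] with ω hω h
      exact (hω.2 h).2
    filter_upwards [ih, ae_all_iff.2 hx] with ω h1 h2 k hk
    rcases Nat.le_succ_iff.1 hk with hk | rfl
    · exact h1 k hk
    · exact h2 (fun k : Fin (n + 1) => Y k ω)
        fun k hk => ⟨mem_followEvent_extendPath Y n ω k hk, h1 k hk⟩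

lemma measure_followEvent (hJ : IsJumpChain P r Y H) (hr : ∀ x, Summable (r x)) (n : ℕ)
    (y : ℕ → S) : P (followEvent Y n y) =
      P {ω | Y 0 ω = y 0} * ∏ k ∈ Finset.range n, (jumpProb r (y k) (y (k + 1)) : ℝ≥0∞) := by
  rw [← hJ.measure_inter_pos]
  apply measure_congr
  filter_upwards [hJ.ae_holding_pos hr] with ω hω
  simp only [followEvent, eq_iff_iff]
  exact ⟨fun h k hk => ⟨h k hk, hω k⟩, fun h k hk => (h k hk).1⟩

/-- Almost surely, all the transitions of the jump chain have positive probability. -/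
lemma ae_jumpProb_ne_zero (hJ : IsJumpChain P r Y H) (hr : ∀ x, Summable (r x)) :
    ∀ᵐ ω ∂P, ∀ k, jumpProb r (Y k ω) (Y (k + 1) ω) ≠ 0 := by
  rw [ae_all_iff]
  intro n
  have h : ∀ p : Fin (n + 1 + 1) → S, ∀ᵐ ω ∂P,
      ω ∈ followEvent Y (n + 1) (extendPath p) → jumpProb r (Y n ω) (Y (n + 1) ω) ≠ 0 := by
    intro p
    by_cases h0 : jumpProb r (extendPath p n) (extendPath p (n + 1)) = 0
    · have : P (followEvent Y (n + 1) (extendPath p)) = 0 := by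
        rw [hJ.measure_followEvent hr, Finset.prod_range_succ, h0]; simp
      filter_upwards [measure_eq_zero_iff_ae_notMem.1 this] with ω hω h using absurd h hω
    · refine ae_of_all _ fun ω hω => ?_
      rw [hω n (by omega), hω (n + 1) le_rfl]
      exact h0
  filter_upwards [ae_all_iff.2 h] with ω hω
  exact hω _ (mem_followEvent_extendPath Y (n + 1) ω)

end IsJumpChain
end JumpChain

/-! ### Discounted paths and harmonic functions -/

section Discounted

variable {S : Type*} [MeasurableSpace S] {Ω : Type*} [MeasurableSpace Ω]
  [Countable S] [MeasurableSingletonClass S] {P : Measure Ω} {r : S → S → ℝ≥0}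
  {Y : ℕ → Ω → S} {H : ℕ → Ω → ℝ≥0∞}

/-- The event that the chain starts at `x₀` and stays in `C` up to time `n`. -/
def stayEvent (Y : ℕ → Ω → S) (C : Set S) (x₀ : S) (n : ℕ) : Set Ω :=
  {ω | Y 0 ω = x₀ ∧ ∀ j ≤ n, Y j ω ∈ C}

/-- The event that the chain starts at `x₀` and its `n + 1`-st jump is the first one out of `C`. -/
def exitEvent (Y : ℕ → Ω → S) (C : Set S) (x₀ : S) (n : ℕ) : Set Ω :=
  {ω | Y 0 ω = x₀ ∧ (∀ j ≤ n, Y j ω ∈ C) ∧ Y (n + 1) ω ∉ C}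

lemma measurableSet_stayEvent (hY : ∀ k, Measurable (Y k)) (C : Set S) (x₀ : S) (n : ℕ) :
    MeasurableSet (stayEvent Y C x₀ n) := by
  have : stayEvent Y C x₀ n = Y 0 ⁻¹' {x₀} ∩ ⋂ j, ⋂ (_ : j ≤ n), Y j ⁻¹' C := by
    ext ω; simp [stayEvent]
  rw [this]
  exact (hY 0 (measurableSet_singleton _)).inter (MeasurableSet.iInter fun j =>
    MeasurableSet.iInter fun _ => hY j C.to_countable.measurableSet)

lemma exitEvent_eq_diff (C : Set S) (x₀ : S) (n : ℕ) :
    exitEvent Y C x₀ n = stayEvent Y C x₀ n \ stayEvent Y C x₀ (n + 1) := by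
  ext ω
  simp only [exitEvent, stayEvent, Set.mem_ofPred_eq, Set.mem_sdiff, Nat.le_succ_iff]
  constructor
  · rintro ⟨h0, h1, h2⟩
    exact ⟨⟨h0, h1⟩, fun h => h2 (h.2 _ (Or.inr rfl))⟩
  · rintro ⟨⟨h0, h1⟩, h2⟩
    refine ⟨h0, h1, fun h => h2 ⟨h0, fun j hj => ?_⟩⟩
    rcases hj with hj | rfl
    · exact h1 j hj
    · exact h

lemma measurableSet_exitEvent (hY : ∀ k, Measurable (Y k)) (C : Set S) (x₀ : S) (n : ℕ) :
    MeasurableSet (exitEvent Y C x₀ n) := by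
  rw [exitEvent_eq_diff]
  exact (measurableSet_stayEvent hY C x₀ n).diff (measurableSet_stayEvent hY C x₀ (n + 1))

lemma stayEvent_succ_subset (C : Set S) (x₀ : S) (n : ℕ) :
    stayEvent Y C x₀ (n + 1) ⊆ stayEvent Y C x₀ n :=
  fun _ h => ⟨h.1, fun j hj => h.2 j (by omega)⟩

namespace IsJumpChain

variable [IsProbabilityMeasure P]

/-- Joint law of the path and the holding times, discounted in the first `m` holding times. -/
lemma setLIntegral_prod_discount (hJ : IsJumpChain P r Y H) (hr : ∀ x, Summable (r x))
    {s : ℝ≥0} (hs : 0 < s) (n : ℕ) (y : ℕ → S) (m : ℕ) (hm : m ≤ n) (t : ℕ → ℝ≥0) :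
    ∫⁻ ω in {ω | ∀ k ≤ n, Y k ω = y k ∧ (m ≤ k → (t k : ℝ≥0∞) < H k ω)},
        ∏ k ∈ Finset.range m, discount s (H k ω) ∂P =
      P {ω | Y 0 ω = y 0} * (∏ k ∈ Finset.range n, (jumpProb r (y k) (y (k + 1)) : ℝ≥0∞)) *
      (∏ k ∈ Finset.range m,
        ((totalRate r (y k) / (totalRate r (y k) + s) : ℝ≥0) : ℝ≥0∞)) *
      ∏ k ∈ Finset.Ico m (n + 1),
        ENNReal.ofReal (Real.exp (-((totalRate r (y k) : ℝ) * (t k : ℝ)))) := by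
  have hmeas : ∀ m (t : ℕ → ℝ≥0), MeasurableSet
      {ω | ∀ k ≤ n, Y k ω = y k ∧ (m ≤ k → (t k : ℝ≥0∞) < H k ω)} := by
    intro m t
    have : {ω | ∀ k ≤ n, Y k ω = y k ∧ (m ≤ k → (t k : ℝ≥0∞) < H k ω)} =
        followEvent Y n y ∩ ⋂ k, ⋂ (_ : k ≤ n), ⋂ (_ : m ≤ k), {ω | (t k : ℝ≥0∞) < H k ω} := by
      ext ω
      simp only [followEvent, Set.mem_ofPred_eq, Set.mem_inter_iff, Set.mem_iInter]
      exact ⟨fun h => ⟨fun k hk => (h k hk).1, fun k hk => (h k hk).2⟩,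
        fun h k hk => ⟨h.1 k hk, h.2 k hk⟩⟩
    rw [this]
    exact (measurableSet_followEvent hJ.measurable_state n y).inter
      (MeasurableSet.iInter fun k => MeasurableSet.iInter fun _ => MeasurableSet.iInter fun _ =>
        measurableSet_lt measurable_const (hJ.measurable_holding k))
  have hmd : ∀ m, Measurable fun ω => ∏ k ∈ Finset.range m, discount s (H k ω) := fun m =>
    Finset.measurable_prod _ fun k _ => (measurable_discount _).comp (hJ.measurable_holding k)
  induction m generalizing t with
  | zero =>
    have h := hJ.cylinder n y t
    simp only [Nat.zero_le, forall_const, Finset.range_zero, Finset.prod_empty, mul_one,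
      setLIntegral_one, ← Finset.range_eq_Ico]
    exact h
  | succ m ih =>
    set B : Set Ω := {ω | ∀ k ≤ n, Y k ω = y k ∧ (m + 1 ≤ k → (t k : ℝ≥0∞) < H k ω)} with hB
    -- The measure is weighted by the discounts already taken. Under it `H m` still has an
    -- exponential tail, by the induction hypothesis with `t m` replaced by a free u, so one more
    -- holding time can be discounted.
    set ν : Measure Ω := (P.restrict B).withDensity
      fun ω => ∏ k ∈ Finset.range m, discount s (H k ω) with hν
    have hfin : IsFiniteMeasure ν := by
      refine isFiniteMeasure_withDensity (ne_top_of_le_ne_top ENNReal.one_ne_top ?_)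
      calc _ ≤ ∫⁻ ω in B, 1 ∂P := lintegral_mono fun ω =>
            Finset.prod_le_one' fun k _ => discount_le_one s.2 _
        _ ≤ 1 := by rw [lintegral_one, Measure.restrict_apply_univ]; exact prob_le_one
    have hpos : ∀ᵐ ω ∂ν, 0 < H m ω := by
      refine (withDensity_absolutelyContinuous _ _).ae_le ?_
      refine Measure.restrict_le_self.absolutelyContinuous.ae_le ?_
      filter_upwards [hJ.ae_holding_pos hr] with ω hω using hω m
    have htail : ∀ u : ℝ≥0, ν {ω | (u : ℝ≥0∞) < H m ω} =
        (P {ω | Y 0 ω = y 0} * (∏ k ∈ Finset.range n, (jumpProb r (y k) (y (k + 1)) : ℝ≥0∞)) *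
        (∏ k ∈ Finset.range m,
          ((totalRate r (y k) / (totalRate r (y k) + s) : ℝ≥0) : ℝ≥0∞)) *
        ∏ k ∈ Finset.Ico (m + 1) (n + 1),
          ENNReal.ofReal (Real.exp (-((totalRate r (y k) : ℝ) * (t k : ℝ))))) *
          ENNReal.ofReal (Real.exp (-((totalRate r (y m) : ℝ) * u))) := by
      intro u
      have hset : {ω | (u : ℝ≥0∞) < H m ω} ∩ B =
          {ω | ∀ k ≤ n, Y k ω = y k ∧ (m ≤ k → (Function.update t m u k : ℝ≥0∞) < H k ω)} := by
        ext ω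
        simp only [hB, Set.mem_inter_iff, Set.mem_ofPred_eq]
        constructor
        · rintro ⟨h1, h2⟩ k hk
          refine ⟨(h2 k hk).1, fun hmk => ?_⟩
          rcases hmk.eq_or_lt with rfl | hlt
          · simpa using h1
          · rw [Function.update_of_ne hlt.ne']
            exact (h2 k hk).2 hlt
        · intro h
          refine ⟨by simpa using (h m (by omega)).2 le_rfl, fun k hk => ⟨(h k hk).1, fun hmk => ?_⟩⟩
          have := (h k hk).2 (by omega)
          rwa [Function.update_of_ne (by omega)] at this
      have hu := measurableSet_lt (measurable_const (a := (u : ℝ≥0∞))) (hJ.measurable_holding m)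
      rw [hν, withDensity_apply _ hu, Measure.restrict_restrict hu, hset, ih (by omega),
        Finset.prod_eq_prod_Ico_succ_bot (by omega : m < n + 1)]
      rw [Function.update_self, mul_comm (ENNReal.ofReal _), ← mul_assoc]
      congr 2
      refine Finset.prod_congr rfl fun k hk => ?_
      rw [Function.update_of_ne (by have := Finset.mem_Ico.1 hk; omega)]
    have hmain := lintegral_discount_of_exponential_tail ν (hJ.measurable_holding m) hpos
      (totalRate r (y m)) s hs htail
    rw [hν, lintegral_withDensity_eq_lintegral_mul _ (hmd m)
      (g := fun ω => discount s (H m ω))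
      ((measurable_discount _).comp (hJ.measurable_holding m))] at hmain
    simp_rw [Finset.prod_range_succ _ m]
    refine hmain.trans ?_
    ring

/-- Discounted probability of a path. -/
lemma setLIntegral_discount_followEvent (hJ : IsJumpChain P r Y H) (hr : ∀ x, Summable (r x))
    {s : ℝ≥0} (hs : 0 < s) (n : ℕ) (y : ℕ → S) :
    ∫⁻ ω in followEvent Y n y, discount s (∑ k ∈ Finset.range n, H k ω) ∂P =
      P {ω | Y 0 ω = y 0} * ∏ k ∈ Finset.range n,
        ((r (y k) (y (k + 1)) / (totalRate r (y k) + s) : ℝ≥0) : ℝ≥0∞) := by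
  have h := hJ.setLIntegral_prod_discount hr hs n y n le_rfl 0
  have hset : (followEvent Y n y : Set Ω) =ᵐ[P]
      {ω | ∀ k ≤ n, Y k ω = y k ∧ (n ≤ k → (((0 : ℕ → ℝ≥0) k : ℝ≥0) : ℝ≥0∞) < H k ω)} := by
    filter_upwards [hJ.ae_holding_pos hr] with ω hω
    simp only [followEvent, eq_iff_iff]
    exact ⟨fun h k hk => ⟨h k hk, fun _ => by simpa using hω k⟩, fun h k hk => (h k hk).1⟩
  simp_rw [discount_sum]
  rw [setLIntegral_congr hset, h]
  simp only [Pi.zero_apply, NNReal.coe_zero, mul_zero, neg_zero, Real.exp_zero, ENNReal.ofReal_one,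
    Finset.prod_const_one, mul_one]
  rw [mul_assoc, ← Finset.prod_mul_distrib]
  congr 1
  refine Finset.prod_congr rfl fun k _ => ?_
  rw [← ENNReal.coe_mul, jumpProb_mul_div (hr _)]

/-- One-step equation: a function that is harmonic for the discounted chain on `C` is preserved by
a jump out of a path in `C`. -/
lemma setLIntegral_stayEvent_step (hJ : IsJumpChain P r Y H) (hr : ∀ x, Summable (r x))
    {s : ℝ≥0} (hs : 0 < s) {C : Set S} (x₀ : S) {g : S → ℝ≥0∞}
    (heq : ∀ x ∈ C, ((totalRate r x + s : ℝ≥0) : ℝ≥0∞) * g x = ∑' y, (r x y : ℝ≥0∞) * g y) (n : ℕ) :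
    ∫⁻ ω in stayEvent Y C x₀ n, discount s (∑ k ∈ Finset.range n, H k ω) * g (Y n ω) ∂P =
      ∫⁻ ω in stayEvent Y C x₀ n,
        discount s (∑ k ∈ Finset.range (n + 1), H k ω) * g (Y (n + 1) ω) ∂P := by
  have hmT : ∀ n, Measurable fun ω => discount s (∑ k ∈ Finset.range n, H k ω) := fun n =>
    (measurable_discount _).comp
      (Finset.measurable_sum _ fun k _ => hJ.measurable_holding k)
  refine setLIntegral_eq_of_followEvent hJ.measurable_state n
    (fun y => y 0 = x₀ ∧ ∀ j ≤ n, y j ∈ C) ?_ ?_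
  · rintro y z hyz ⟨h0, h1⟩
    exact ⟨hyz 0 (Nat.zero_le _) ▸ h0, fun j hj => hyz j hj ▸ h1 j hj⟩
  · rintro y ⟨-, hyC⟩
    set z : S → ℕ → S := fun x => Function.update y (n + 1) x with hz
    have hzk : ∀ x k, k ≤ n → z x k = y k := fun x k hk => by
      simp [hz, Function.update_of_ne (show k ≠ n + 1 by omega)]
    have hzn : ∀ x, z x (n + 1) = x := fun x => by simp [hz]
    have hU : followEvent Y n y = ⋃ x, followEvent Y (n + 1) (z x) := by
      ext ω
      simp only [followEvent, Set.mem_ofPred_eq, Set.mem_iUnion, Nat.le_succ_iff]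
      constructor
      · intro h1
        refine ⟨Y (n + 1) ω, fun k hk => ?_⟩
        rcases hk with hk | rfl
        · rw [hzk _ _ hk]; exact h1 k hk
        · rw [hzn]
      · rintro ⟨x, hx⟩ k hk
        exact hzk x k hk ▸ hx k (Or.inl hk)
    have hd : Pairwise (Function.onFun Disjoint fun x => followEvent Y (n + 1) (z x)) := by
      intro x x' hne
      refine Set.disjoint_left.2 fun ω h1 h2 => hne ?_
      have := (h1 (n + 1) le_rfl).symm.trans (h2 (n + 1) le_rfl)
      rwa [hzn, hzn] at this
    have hmF := measurableSet_followEvent hJ.measurable_state (Y := Y)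
    have hL : ∫⁻ ω in followEvent Y n y, discount s (∑ k ∈ Finset.range n, H k ω) * g (Y n ω) ∂P =
        (∫⁻ ω in followEvent Y n y, discount s (∑ k ∈ Finset.range n, H k ω) ∂P) * g (y n) := by
      rw [← lintegral_mul_const _ (hmT n)]
      exact setLIntegral_congr_fun (hmF _ _) fun ω hω => by rw [hω n le_rfl]
    have hR : ∀ x, ∫⁻ ω in followEvent Y (n + 1) (z x),
        discount s (∑ k ∈ Finset.range (n + 1), H k ω) * g (Y (n + 1) ω) ∂P =
        (∫⁻ ω in followEvent Y n y, discount s (∑ k ∈ Finset.range n, H k ω) ∂P) *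
          (((totalRate r (y n) + s : ℝ≥0) : ℝ≥0∞)⁻¹ * (r (y n) x * g x)) := by
      intro x
      have h1 : ∫⁻ ω in followEvent Y (n + 1) (z x),
          discount s (∑ k ∈ Finset.range (n + 1), H k ω) * g (Y (n + 1) ω) ∂P =
          (∫⁻ ω in followEvent Y (n + 1) (z x),
            discount s (∑ k ∈ Finset.range (n + 1), H k ω) ∂P) * g x := by
        rw [← lintegral_mul_const _ (hmT (n + 1))]
        exact setLIntegral_congr_fun (hmF _ _) fun ω hω => by rw [hω (n + 1) le_rfl, hzn]
      rw [h1, hJ.setLIntegral_discount_followEvent hr hs, hJ.setLIntegral_discount_followEvent hr hs,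
        Finset.prod_range_succ, hzk x 0 (Nat.zero_le _), hzk x n le_rfl, hzn,
        ENNReal.coe_div (by positivity)]
      have hp : ∏ k ∈ Finset.range n,
          ((r (z x k) (z x (k + 1)) / (totalRate r (z x k) + s) : ℝ≥0) : ℝ≥0∞) =
          ∏ k ∈ Finset.range n,
          ((r (y k) (y (k + 1)) / (totalRate r (y k) + s) : ℝ≥0) : ℝ≥0∞) := by
        refine Finset.prod_congr rfl fun k hk => ?_
        have := Finset.mem_range.1 hk
        rw [hzk x k (by omega), hzk x (k + 1) (by omega)]
      rw [hp, div_eq_mul_inv]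
      ring
    rw [hL]
    conv_rhs => rw [hU, lintegral_iUnion (fun x => hmF _ _) hd]
    simp_rw [hR]
    -- Summing over the next state, the harmonic equation at `y n` reproduces (q+s) g, and the
    -- factor (q+s)⁻¹ of the last jump cancels it.
    rw [ENNReal.tsum_mul_left, ENNReal.tsum_mul_left, ← heq _ (hyC n le_rfl),
      ← mul_assoc _ _ (g (y n)),
      ENNReal.inv_mul_cancel (by simp [hs.ne']) ENNReal.coe_ne_top, one_mul]

/-- Discounted exit law: a bounded function that is harmonic on `C` for the chain discounted at
rate `s` is the mean of its discounted value at the exit from `C`. -/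
theorem tsum_setLIntegral_exitEvent (hJ : IsJumpChain P r Y H) (hr : ∀ x, Summable (r x))
    (hexp : ∀ᵐ ω ∂P, ∑' k, H k ω = ∞) {s : ℝ≥0} (hs : 0 < s) {C : Set S} {x₀ : S} (hx₀ : x₀ ∈ C)
    {g : S → ℝ≥0∞} (hg : ∀ x, g x ≤ 1)
    (heq : ∀ x ∈ C, ((totalRate r x + s : ℝ≥0) : ℝ≥0∞) * g x = ∑' y, (r x y : ℝ≥0∞) * g y) :
    ∑' n, ∫⁻ ω in exitEvent Y C x₀ n,
        discount s (∑ k ∈ Finset.range (n + 1), H k ω) * g (Y (n + 1) ω) ∂P =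
      P {ω | Y 0 ω = x₀} * g x₀ := by
  set c : ℕ → ℝ≥0∞ := fun n => ∫⁻ ω in stayEvent Y C x₀ n,
    discount s (∑ k ∈ Finset.range n, H k ω) * g (Y n ω) ∂P with hc
  set b : ℕ → ℝ≥0∞ := fun n => ∫⁻ ω in exitEvent Y C x₀ n,
        discount s (∑ k ∈ Finset.range (n + 1), H k ω) * g (Y (n + 1) ω) ∂P with hb
  have hmS := measurableSet_stayEvent hJ.measurable_state C x₀
  have hmg : ∀ n, Measurable fun ω =>
      discount s (∑ k ∈ Finset.range n, H k ω) * g (Y n ω) := fun n =>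
    ((measurable_discount _).comp
      (Finset.measurable_sum _ fun k _ => hJ.measurable_holding k)).mul
      ((measurable_of_countable g).comp (hJ.measurable_state n))
  -- The discounted mass at time n splits after the next jump into the part that leaves C and the
  -- part that stays.
  have hstep : ∀ n, c n = b n + c (n + 1) := by
    intro n
    rw [hc, hb]
    simp only
    rw [hJ.setLIntegral_stayEvent_step hr hs x₀ heq n, exitEvent_eq_diff,
      ← lintegral_inter_add_sdiff _ (stayEvent Y C x₀ n) (hmS (n + 1)),
      Set.inter_eq_self_of_subset_right (stayEvent_succ_subset C x₀ n)]
    exact add_comm _ _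
  have hsum : ∀ n, c 0 = ∑ k ∈ Finset.range n, b k + c n := by
    intro n
    induction n with
    | zero => simp
    | succ n ih => rw [ih, Finset.sum_range_succ, hstep n, add_assoc]
  have hc0 : c 0 = P {ω | Y 0 ω = x₀} * g x₀ := by
    have hS0 : stayEvent Y C x₀ 0 = {ω | Y 0 ω = x₀} := by
      ext ω
      simp only [stayEvent, Nat.le_zero, forall_eq, Set.mem_ofPred_eq, and_iff_left_iff_imp]
      exact fun h => h ▸ hx₀
    have hm0 : MeasurableSet {ω | Y 0 ω = x₀} := hJ.measurable_state 0 (measurableSet_singleton _)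
    simp only [hc, hS0, Finset.range_zero, Finset.sum_empty, discount_zero, one_mul]
    rw [setLIntegral_congr_fun (g := fun _ => g x₀) hm0 (fun ω hω => by
      rw [show Y 0 ω = x₀ from hω]), setLIntegral_const, mul_comm]
  -- Non-explosion enters here: the jump times tend to infinity, so their discounts tend to 0,
  -- dominated by 1.
  have hlim : Tendsto c atTop (𝓝 0) := by
    have hdom : Tendsto (fun n => ∫⁻ ω, (stayEvent Y C x₀ n).indicator (fun ω =>
        discount s (∑ k ∈ Finset.range n, H k ω) * g (Y n ω)) ω ∂P) atTop
        (𝓝 (∫⁻ _, 0 ∂P)) := by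
      refine tendsto_lintegral_of_dominated_convergence (fun _ => 1)
        (fun n => (hmg n).indicator (hmS n)) (fun n => ae_of_all _ fun ω => ?_) (by simp) ?_
      · refine Set.indicator_le' (fun ω _ => ?_) (fun _ _ => zero_le_one) ω
        exact mul_le_one' (discount_le_one s.2 _) (hg _)
      · filter_upwards [hexp] with ω hω
        have h1 : Tendsto (fun n => ∑ k ∈ Finset.range n, H k ω) atTop (𝓝 ∞) :=
          hω ▸ ENNReal.tendsto_nat_tsum _
        refine tendsto_of_tendsto_of_tendsto_of_le_of_le tendsto_const_nhds
          (discount_tendsto_zero (show (0:ℝ) < s from hs) h1) (fun n => zero_le) (fun n => ?_)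
        refine Set.indicator_apply_le' (fun _ => ?_) (fun _ => zero_le)
        exact mul_le_of_le_one_right' (hg _)
    simpa [lintegral_indicator (hmS _)] using hdom
  rw [← hc0]
  have h1 : Tendsto (fun n => ∑ k ∈ Finset.range n, b k + c n) atTop (𝓝 (∑' k, b k + 0)) :=
    (ENNReal.tendsto_nat_tsum b).add hlim
  simp_rw [← hsum] at h1
  simpa using tendsto_nhds_unique h1 tendsto_const_nhds

end IsJumpChain
end Discounted

/-! ### Paths of a jump process -/

section Path

variable {S : Type*}

/-- `z` is the right-continuous path that visits the states `y` for the holding times `h`,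
which are positive and sum to infinity. -/
structure IsJumpPath (h : ℕ → ℝ≥0∞) (y : ℕ → S) (z : ℝ≥0 → S) : Prop where
  pos : ∀ k, 0 < h k
  eq : ∀ (n : ℕ) (t : ℝ≥0), ∑ k ∈ Finset.range n, h k ≤ t →
        (t : ℝ≥0∞) < ∑ k ∈ Finset.range (n + 1), h k → z t = y n
  tsum_eq_top : ∑' k, h k = ∞

namespace IsJumpPath

variable {h : ℕ → ℝ≥0∞} {y : ℕ → S} {z : ℝ≥0 → S}

/-- Jump times tend to infinity, so every finite t lies between two consecutive ones; the first jump
time exceeding t is not the zeroth. -/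
lemma exists_interval (hp : IsJumpPath h y z) (t : ℝ≥0) :
    ∃ n, ∑ k ∈ Finset.range n, h k ≤ t ∧ (t : ℝ≥0∞) < ∑ k ∈ Finset.range (n + 1), h k := by
  classical
  have hex : ∃ n, (t : ℝ≥0∞) < ∑ k ∈ Finset.range n, h k := by
    have h1 : Tendsto (fun n => ∑ k ∈ Finset.range n, h k) atTop (𝓝 ∞) :=
      hp.tsum_eq_top ▸ ENNReal.tendsto_nat_tsum h
    exact (h1.eventually (lt_mem_nhds ENNReal.coe_lt_top)).exists
  have h0 : Nat.find hex ≠ 0 := by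
    intro h0
    have := Nat.find_spec hex
    rw [h0] at this
    simp at this
  obtain ⟨m, hm⟩ := Nat.exists_eq_succ_of_ne_zero h0
  refine ⟨m, not_lt.1 (Nat.find_min hex (by omega)), ?_⟩
  have := Nat.find_spec hex
  rwa [hm] at this

lemma apply_zero (hp : IsJumpPath h y z) : z 0 = y 0 :=
  hp.eq 0 0 (by simp) (by simpa using hp.pos 0)

lemma mem_of_forall (hp : IsJumpPath h y z) {C : Set S} (hC : ∀ j, y j ∈ C) (t : ℝ≥0) :
    z t ∈ C := by
  obtain ⟨n, h1, h2⟩ := hp.exists_interval t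
  exact hp.eq n t h1 h2 ▸ hC n

lemma mem_of_lt (hp : IsJumpPath h y z) {C : Set S} {n : ℕ} (hC : ∀ j ≤ n, y j ∈ C) {t : ℝ≥0}
    (ht : (t : ℝ≥0∞) < ∑ k ∈ Finset.range (n + 1), h k) : z t ∈ C := by
  obtain ⟨m, h1, h2⟩ := hp.exists_interval t
  rw [hp.eq m t h1 h2]
  refine hC m (not_lt.1 fun hlt => ?_)
  have : ∑ k ∈ Finset.range (n + 1), h k ≤ ∑ k ∈ Finset.range m, h k :=
    Finset.sum_le_sum_of_subset (Finset.range_mono hlt)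
  exact absurd (ht.trans_le (this.trans h1)) (lt_irrefl _)

lemma apply_jumpTime (hp : IsJumpPath h y z) {n : ℕ} {t : ℝ≥0}
    (ht : (t : ℝ≥0∞) = ∑ k ∈ Finset.range n, h k) : z t = y n := by
  refine hp.eq n t ht.ge ?_
  rw [Finset.sum_range_succ, ← ht]
  exact ENNReal.lt_add_right ENNReal.coe_ne_top (hp.pos n).ne'

/-- The first passage time to a state is the time of the first jump into it. -/
lemma iInf_eq_jumpTime (hp : IsJumpPath h y z) {x : S} {n : ℕ} (hC : ∀ j ≤ n, y j ≠ x)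
    (hx : y (n + 1) = x) :
    ⨅ (t : ℝ≥0) (_ : z t = x), (t : ℝ≥0∞) = ∑ k ∈ Finset.range (n + 1), h k := by
  apply le_antisymm
  · by_cases htop : ∑ k ∈ Finset.range (n + 1), h k = ∞
    · simp [htop]
    · lift ∑ k ∈ Finset.range (n + 1), h k to ℝ≥0 using htop with T hT
      exact iInf₂_le T ((hp.apply_jumpTime hT).trans hx)
  · refine le_iInf₂ fun t ht => not_lt.1 fun hlt => ?_
    exact hp.mem_of_lt (C := {x}ᶜ) hC hlt ht

lemma iInf_eq_top (hp : IsJumpPath h y z) {x : S} (hC : ∀ j, y j ≠ x) :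
    ⨅ (t : ℝ≥0) (_ : z t = x), (t : ℝ≥0∞) = ∞ := by
  refine _root_.iInf_eq_top.2 fun t => _root_.iInf_eq_top.2 fun ht => ?_
  exact absurd ht (hp.mem_of_forall (C := {x}ᶜ) hC t)

/-- A real observable `φ` that is constant on `C` and changes at the exit from `C` takes its first
new value at the exit. -/
lemma apply_sInf_ne (hp : IsJumpPath h y z) {C : Set S} {φ : S → ℝ} {c : ℝ}
    (hφ : ∀ x ∈ C, φ x = c) {n : ℕ} (hC : ∀ j ≤ n, y j ∈ C) (hn : φ (y (n + 1)) ≠ c)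
    (hfin : ∑ k ∈ Finset.range (n + 1), h k ≠ ∞) :
    z (sInf {t | φ (z t) ≠ φ (z 0)}) = y (n + 1) := by
  have h0 : φ (z 0) = c := by rw [hp.apply_zero]; exact hφ _ (hC 0 (Nat.zero_le _))
  lift ∑ k ∈ Finset.range (n + 1), h k to ℝ≥0 using hfin with T hT
  have hzT := hp.apply_jumpTime hT
  have : IsLeast {t | φ (z t) ≠ φ (z 0)} T := by
    refine ⟨?_, fun t ht => not_lt.1 fun hlt => ht ?_⟩
    · change φ (z T) ≠ φ (z 0)
      rw [hzT, h0]; exact hn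
    · rw [h0]
      refine hφ _ (hp.mem_of_lt hC ?_)
      rw [← hT]; exact_mod_cast hlt
  rw [this.csInf_eq, hzT]

end IsJumpPath

end Path

/-! ### Exit laws and first passage times -/

section ExitLaw

variable {S : Type*} [MeasurableSpace S] {Ω : Type*} [MeasurableSpace Ω]
  [Countable S] [MeasurableSingletonClass S] {P : Measure Ω} {r : S → S → ℝ≥0}
  {Y : ℕ → Ω → S} {H : ℕ → Ω → ℝ≥0∞}

lemma disjoint_exitEvent (C : Set S) (x₀ : S) :
    Pairwise (Function.onFun Disjoint (exitEvent Y C x₀)) := by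
  have key : ∀ m n, m < n → Disjoint (exitEvent Y C x₀ m) (exitEvent Y C x₀ n) := fun m n hmn =>
    Set.disjoint_left.2 fun ω h1 h2 => h1.2.2 (h2.2.1 (m + 1) hmn)
  intro m n hne
  rcases lt_or_gt_of_ne hne with h | h
  · exact key m n h
  · exact (key n m h).symm

lemma exists_mem_exitEvent {C : Set S} {x₀ : S} (hx₀ : x₀ ∈ C) {ω : Ω} (h0 : Y 0 ω = x₀)
    (h : ¬ ∀ j, Y j ω ∈ C) : ∃ n, ω ∈ exitEvent Y C x₀ n := by
  classical
  push Not at h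
  have hne : Nat.find h ≠ 0 := fun h' => by
    have := Nat.find_spec h
    rw [h', h0] at this
    exact this hx₀
  obtain ⟨m, hm⟩ := Nat.exists_eq_succ_of_ne_zero hne
  refine ⟨m, h0, fun j hj => not_not.1 (Nat.find_min h (by omega)), ?_⟩
  have := Nat.find_spec h
  rwa [hm] at this

/-- Integrals of functions that vanish on paths which never leave `C`. -/
lemma setLIntegral_eq_tsum_exitEvent (hY : ∀ k, Measurable (Y k)) {C : Set S} {x₀ : S}
    (hx₀ : x₀ ∈ C) {F : Ω → ℝ≥0∞} (hF : ∀ᵐ ω ∂P, (∀ j, Y j ω ∈ C) → F ω = 0) :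
    ∫⁻ ω in {ω | Y 0 ω = x₀}, F ω ∂P = ∑' n, ∫⁻ ω in exitEvent Y C x₀ n, F ω ∂P := by
  rw [← lintegral_iUnion (measurableSet_exitEvent hY C x₀) (disjoint_exitEvent C x₀)]
  have hm0 : MeasurableSet {ω | Y 0 ω = x₀} := hY 0 (measurableSet_singleton _)
  rw [← lintegral_indicator hm0,
    ← lintegral_indicator (MeasurableSet.iUnion (measurableSet_exitEvent hY C x₀))]
  refine lintegral_congr_ae ?_
  filter_upwards [hF] with ω hω
  by_cases h0 : Y 0 ω = x₀
  · by_cases h : ∀ j, Y j ω ∈ C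
    · simp [Set.indicator, hω h]
    · have := exists_mem_exitEvent hx₀ h0 h
      simp [Set.indicator, h0, this]
  · have : ω ∉ ⋃ n, exitEvent Y C x₀ n := by
      simp only [Set.mem_iUnion, not_exists]
      exact fun n hn => h0 hn.1
    rw [Set.indicator_of_notMem this, Set.indicator_of_notMem (by exact h0)]

/-- The event that the chain leaves `C` in finite time and lands in `U`. -/
def exitInto (Y : ℕ → Ω → S) (H : ℕ → Ω → ℝ≥0∞) (C U : Set S) : Set Ω :=
  {ω | ∃ n, (∀ j ≤ n, Y j ω ∈ C) ∧ Y (n + 1) ω ∉ C ∧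
    ∑ k ∈ Finset.range (n + 1), H k ω ≠ ∞ ∧ Y (n + 1) ω ∈ U}

/-- Exit law, as the limit of discounted exit laws. -/
lemma IsJumpChain.measure_exitInto [IsProbabilityMeasure P] (hJ : IsJumpChain P r Y H)
    (hr : ∀ x, Summable (r x)) (hexp : ∀ᵐ ω ∂P, ∑' k, H k ω = ∞) {C U : Set S} {x₀ : S}
    (hx₀ : x₀ ∈ C) {g : ℝ≥0 → S → ℝ≥0∞} (hg : ∀ s x, 0 < s → g s x ≤ 1)
    (hgU : ∀ s x, x ∉ C → g s x = U.indicator 1 x)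
    (heq : ∀ s x, 0 < s → x ∈ C →
      ((totalRate r x + s : ℝ≥0) : ℝ≥0∞) * g s x = ∑' y, (r x y : ℝ≥0∞) * g s y)
    {p : ℝ≥0∞} (hp : Tendsto (fun m : ℕ => g (1 / ((m : ℝ≥0) + 1)) x₀) atTop (𝓝 p)) :
    P (exitInto Y H C U ∩ {ω | Y 0 ω = x₀}) = P {ω | Y 0 ω = x₀} * p := by
  classical
  set T : ℕ → Ω → ℝ≥0∞ := fun n ω => ∑ k ∈ Finset.range n, H k ω with hT
  have hmE := measurableSet_exitEvent hJ.measurable_state C x₀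
  have hmT : ∀ n, Measurable (T n) := fun n =>
    Finset.measurable_sum _ fun k _ => hJ.measurable_holding k
  have hmU : ∀ n, Measurable fun ω => U.indicator (1 : S → ℝ≥0∞) (Y n ω) := fun n =>
    (measurable_of_countable (U.indicator (1 : S → ℝ≥0∞))).comp (hJ.measurable_state n)
  -- At most one term of the series is non-zero, the one of the actual exit. As the discount rate
  -- 1/(m+1) tends to 0, the discount at the exit becomes the indicator of a finite exit time.
  set F : ℕ → Ω → ℝ≥0∞ := fun m ω => ∑' n, (exitEvent Y C x₀ n).indicator
    (fun ω => discount (1 / ((m : ℝ) + 1)) (T (n + 1) ω) * U.indicator 1 (Y (n + 1) ω)) ω with hF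
  have hFn : ∀ m n ω, ω ∈ exitEvent Y C x₀ n →
      F m ω = discount (1 / ((m : ℝ) + 1)) (T (n + 1) ω) * U.indicator 1 (Y (n + 1) ω) := by
    intro m n ω hω
    rw [hF]
    simp only
    rw [tsum_eq_single n, Set.indicator_of_mem hω]
    intro n' hne
    exact Set.indicator_of_notMem
      (fun h => Set.disjoint_left.1 (disjoint_exitEvent C x₀ hne) h hω) _
  have hF0 : ∀ m ω, (∀ n, ω ∉ exitEvent Y C x₀ n) → F m ω = 0 := by
    intro m ω hω
    simp [hF, Set.indicator_of_notMem (hω _)]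
  have hmFn : ∀ m n : ℕ, Measurable ((exitEvent Y C x₀ n).indicator fun ω =>
      discount (1 / ((m : ℝ) + 1)) (T (n + 1) ω) * U.indicator 1 (Y (n + 1) ω)) := fun m n =>
    (((measurable_discount _).comp (hmT _)).mul (hmU _)).indicator (hmE n)
  have hmF : ∀ m, Measurable (F m) := fun m => Measurable.tsum fun n => hmFn m n
  have hI1 : ∀ x, U.indicator (1 : S → ℝ≥0∞) x ≤ 1 := fun x =>
    Set.indicator_apply_le' (fun _ => le_rfl) (fun _ => zero_le)
  have hint : ∀ m : ℕ, ∫⁻ ω, F m ω ∂P =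
      P {ω | Y 0 ω = x₀} * g (1 / ((m : ℝ≥0) + 1)) x₀ := by
    intro m
    have hs : (0 : ℝ≥0) < 1 / ((m : ℝ≥0) + 1) := by positivity
    rw [← hJ.tsum_setLIntegral_exitEvent hr hexp hs hx₀ (fun x => hg _ x hs)
      (fun x hx => heq _ x hs hx)]
    simp only [hF]
    rw [lintegral_tsum fun n => (hmFn m n).aemeasurable]
    refine tsum_congr fun n => ?_
    rw [lintegral_indicator (hmE n)]
    refine setLIntegral_congr_fun (hmE n) fun ω hω => ?_
    simp only [hT]
    rw [hgU _ _ hω.2.2]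
    push_cast
    rfl
  set G : Ω → ℝ≥0∞ := (exitInto Y H C U ∩ {ω | Y 0 ω = x₀}).indicator 1 with hG
  have hlim : ∀ ω, Tendsto (fun m => F m ω) atTop (𝓝 (G ω)) := by
    intro ω
    by_cases hω : ∃ n, ω ∈ exitEvent Y C x₀ n
    · obtain ⟨n, hn⟩ := hω
      simp_rw [hFn _ n ω hn]
      have h1 := ENNReal.Tendsto.mul_const (b := U.indicator 1 (Y (n + 1) ω))
        (tendsto_discount_inv_nat (T (n + 1) ω))
        (Or.inr (ne_top_of_le_ne_top ENNReal.one_ne_top (hI1 _)))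
      have h2 : ω ∈ exitInto Y H C U ∩ {ω | Y 0 ω = x₀} ↔
          T (n + 1) ω ≠ ∞ ∧ Y (n + 1) ω ∈ U := by
        constructor
        · rintro ⟨⟨n', h1, h2, h3⟩, h0⟩
          have : n' = n := by
            by_contra hne
            exact Set.disjoint_left.1 (disjoint_exitEvent C x₀ hne)
              (show ω ∈ exitEvent Y C x₀ n' from ⟨h0, h1, h2⟩) hn
          exact this ▸ h3
        · exact fun h => ⟨⟨n, hn.2.1, hn.2.2, h⟩, hn.1⟩
      convert h1 using 2
      rw [hG]
      by_cases hTn : T (n + 1) ω = ∞ <;> by_cases hUn : Y (n + 1) ω ∈ U <;>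
        simp [Set.indicator, h2, hTn, hUn]
    · push Not at hω
      simp_rw [hF0 _ ω hω]
      have : G ω = 0 := Set.indicator_of_notMem
        (by rintro ⟨⟨n, h1, h2, -⟩, h0⟩; exact hω n ⟨h0, h1, h2⟩) _
      rw [this]
      exact tendsto_const_nhds
  have hle : ∀ m ω, F m ω ≤ 1 := by
    intro m ω
    by_cases hω : ∃ n, ω ∈ exitEvent Y C x₀ n
    · obtain ⟨n, hn⟩ := hω
      rw [hFn m n ω hn]
      exact mul_le_one' (discount_le_one (by positivity) _) (hI1 _)
    · push Not at hω
      rw [hF0 m ω hω]; exact zero_le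
  have hconv := tendsto_lintegral_of_dominated_convergence (μ := P) (fun _ => 1) hmF
    (fun m => ae_of_all _ (hle m)) (by simp) (ae_of_all _ hlim)
  simp_rw [hint] at hconv
  have hconv2 := ENNReal.Tendsto.const_mul (a := P {ω | Y 0 ω = x₀}) hp
    (Or.inr (measure_ne_top _ _))
  -- The exit event is measurable because its indicator is the pointwise limit of the measurable `F
  -- m`.
  have hmG : Measurable G := measurable_of_tendsto_metrizable hmF (tendsto_pi_nhds.2 hlim)
  have hmset : MeasurableSet (exitInto Y H C U ∩ {ω | Y 0 ω = x₀}) := by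
    have := hmG (measurableSet_singleton 1)
    convert this using 1
    ext ω
    by_cases h : ω ∈ exitInto Y H C U ∩ {ω | Y 0 ω = x₀} <;> simp [hG, Set.indicator, h]
  rw [← tendsto_nhds_unique hconv hconv2, hG, lintegral_indicator_one hmset]

/-- A Markov jump process comes with a jump chain whose paths it follows. -/
lemma IsMarkovJumpProcess.exists_isJumpChain [IsProbabilityMeasure P] {Z : ℝ≥0 → Ω → S}
    (hZ : IsMarkovJumpProcess P r Z) (hr : ∀ x, Summable (r x)) :
    ∃ (Y : ℕ → Ω → S) (H : ℕ → Ω → ℝ≥0∞), IsJumpChain P r Y H ∧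
      ∀ᵐ ω ∂P, IsJumpPath (fun k => H k ω) (fun k => Y k ω) (fun t => Z t ω) := by
  obtain ⟨-, Y, H, hY, hH, hcyl, hae⟩ := hZ
  have hJ : IsJumpChain P r Y H := ⟨hY, hH, hcyl⟩
  refine ⟨Y, H, hJ, ?_⟩
  filter_upwards [hae, hJ.ae_holding_pos hr] with ω h1 h2
  exact ⟨h2, h1.1, h1.2⟩

/-- Laplace transform of a first passage time, from a bounded solution of the resolvent
equation. -/
lemma lintegral_discount_firstPassage [IsProbabilityMeasure P] {Z : ℝ≥0 → Ω → S}
    (hZ : IsMarkovJumpProcess P r Z) (hr : ∀ x, Summable (r x)) {x₀ y₀ : S} (hne : x₀ ≠ y₀)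
    (hZ0 : ∀ᵐ ω ∂P, Z 0 ω = x₀) {s : ℝ≥0} (hs : 0 < s) {g : S → ℝ≥0∞} (hg : ∀ x, g x ≤ 1)
    (hgy : g y₀ = 1)
    (heq : ∀ x ≠ y₀, ((totalRate r x + s : ℝ≥0) : ℝ≥0∞) * g x = ∑' y, (r x y : ℝ≥0∞) * g y) :
    ∫⁻ ω, discount s (firstPassage Z y₀ ω) ∂P = g x₀ := by
  obtain ⟨Y, H, hJ, hpath⟩ := hZ.exists_isJumpChain hr
  have hY0 : ∀ᵐ ω ∂P, Y 0 ω = x₀ := by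
    filter_upwards [hpath, hZ0] with ω h1 h2
    rw [← h2, h1.apply_zero]
  have hm0 : MeasurableSet {ω | Y 0 ω = x₀} := hJ.measurable_state 0 (measurableSet_singleton _)
  have hexp : ∀ᵐ ω ∂P, ∑' k, H k ω = ∞ := by
    filter_upwards [hpath] with ω h using h.tsum_eq_top
  have hx₀ : x₀ ∈ ({y₀}ᶜ : Set S) := hne
  have h := hJ.tsum_setLIntegral_exitEvent hr hexp hs hx₀ hg heq
  have hP : P {ω | Y 0 ω = x₀} = 1 := by
    rw [measure_congr (eventuallyEq_univ.2 hY0), measure_univ]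
  rw [hP, one_mul] at h
  rw [← h]
  have h2 : ∫⁻ ω, discount s (firstPassage Z y₀ ω) ∂P =
      ∫⁻ ω in {ω | Y 0 ω = x₀}, discount s (firstPassage Z y₀ ω) ∂P := by
    rw [setLIntegral_congr (eventuallyEq_univ.2 hY0), setLIntegral_univ]
  rw [h2, setLIntegral_eq_tsum_exitEvent hJ.measurable_state hx₀]
  · refine tsum_congr fun n => ?_
    refine setLIntegral_congr_fun_ae (measurableSet_exitEvent hJ.measurable_state _ _ n) ?_
    filter_upwards [hpath] with ω hω hn
    have hy : Y (n + 1) ω = y₀ := by simpa using hn.2.2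
    rw [hy, hgy, mul_one]
    congr 1
    exact hω.iInf_eq_jumpTime (fun j hj => hn.2.1 j hj) hy
  · filter_upwards [hpath] with ω hω h
    have : firstPassage Z y₀ ω = ∞ := hω.iInf_eq_top h
    rw [this, discount_top]

end ExitLaw

section

/-! ### First passage densities of birth-death chains -/

/-- The exponential kernel `exp (-q v)` on `(0, ∞)`. -/
def expKernel (q : ℝ) : ℝ → ℝ≥0∞ :=
  (Set.Ioi 0).indicator fun v => ENNReal.ofReal (Real.exp (-(q * v)))

@[fun_prop]
lemma measurable_expKernel (q : ℝ) : Measurable (expKernel q) :=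
  Measurable.indicator (by fun_prop) measurableSet_Ioi

/-- Laplace transform of the exponential kernel. -/
def kernelLaplace (q x : ℝ) : ℝ≥0∞ := ∫⁻ v, ENNReal.ofReal (Real.exp (-(x * v))) * expKernel q v

lemma kernelLaplace_eq (q x : ℝ) :
    kernelLaplace q x = ∫⁻ v in Set.Ioi 0, ENNReal.ofReal (Real.exp (-((q + x) * v))) := by
  rw [kernelLaplace, ← lintegral_indicator measurableSet_Ioi]
  refine lintegral_congr fun v => ?_
  by_cases hv : v ∈ Set.Ioi (0 : ℝ)
  · simp only [expKernel, Set.indicator_of_mem hv]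
    rw [← ENNReal.ofReal_mul (Real.exp_nonneg _), ← Real.exp_add]
    congr 2; ring
  · simp [expKernel, Set.indicator_of_notMem hv]

lemma kernelLaplace_of_pos {q x : ℝ} (h : 0 < q + x) :
    kernelLaplace q x = ENNReal.ofReal (1 / (q + x)) := by
  rw [kernelLaplace_eq, lintegral_exp_neg_mul_Ioi h]; simp

lemma kernelLaplace_of_nonpos {q x : ℝ} (h : q + x ≤ 0) : kernelLaplace q x = ∞ := by
  rw [kernelLaplace_eq, eq_top_iff]
  calc (∞ : ℝ≥0∞) = ∫⁻ v in Set.Ioi (0 : ℝ), 1 := by simp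
    _ ≤ _ := by
      refine setLIntegral_mono (by fun_prop) fun v hv => ?_
      rw [← ENNReal.ofReal_one]
      refine ENNReal.ofReal_le_ofReal (Real.one_le_exp ?_)
      have := mul_nonpos_of_nonpos_of_nonneg h (le_of_lt (Set.mem_Ioi.1 hv))
      linarith

lemma kernelLaplace_ne_zero (q x : ℝ) : kernelLaplace q x ≠ 0 := by
  rcases lt_or_ge 0 (q + x) with h | h
  · rw [kernelLaplace_of_pos h]; simpa using h
  · simp [kernelLaplace_of_nonpos h]

/-- Tonelli and translation invariance. Working in [0, ∞] allows every real x, also where the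
transforms diverge. -/
lemma lintegral_exp_mul_conv (x : ℝ) {f g : ℝ → ℝ≥0∞} (hf : Measurable f) (hg : Measurable g) :
    ∫⁻ t, ENNReal.ofReal (Real.exp (-(x * t))) * ∫⁻ v, f v * g (t - v) =
      (∫⁻ v, ENNReal.ofReal (Real.exp (-(x * v))) * f v) *
        ∫⁻ t, ENNReal.ofReal (Real.exp (-(x * t))) * g t := by
  have h1 : ∀ t, ENNReal.ofReal (Real.exp (-(x * t))) * ∫⁻ v, f v * g (t - v) =
      ∫⁻ v, (ENNReal.ofReal (Real.exp (-(x * v))) * f v) *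
        (ENNReal.ofReal (Real.exp (-(x * (t - v)))) * g (t - v)) := by
    intro t
    rw [← lintegral_const_mul _ (by fun_prop)]
    refine lintegral_congr fun v => ?_
    have : ENNReal.ofReal (Real.exp (-(x * t))) =
        ENNReal.ofReal (Real.exp (-(x * v))) * ENNReal.ofReal (Real.exp (-(x * (t - v)))) := by
      rw [← ENNReal.ofReal_mul (Real.exp_nonneg _), ← Real.exp_add]
      congr 2; ring
    rw [this]; ring
  simp_rw [h1]
  rw [lintegral_lintegral_swap (by fun_prop), ← lintegral_mul_const _ (by fun_prop)]
  refine lintegral_congr fun v => ?_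
  rw [lintegral_const_mul _ (by fun_prop)]
  congr 1
  exact lintegral_sub_right_eq_self (fun t => ENNReal.ofReal (Real.exp (-(x * t))) * g t) v

/-- Convolution with the exponential kernel. -/
def expConv (q : ℝ) (h : ℝ → ℝ≥0∞) (t : ℝ) : ℝ≥0∞ := ∫⁻ v, expKernel q v * h (t - v)

@[fun_prop]
lemma measurable_expConv (q : ℝ) {h : ℝ → ℝ≥0∞} (hh : Measurable h) : Measurable (expConv q h) :=
  Measurable.lintegral_prod_right' (f := fun p : ℝ × ℝ => expKernel q p.2 * h (p.1 - p.2))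
    (by fun_prop)

lemma expConv_mono (q : ℝ) {h k : ℝ → ℝ≥0∞} (hk : h ≤ k) (t : ℝ) : expConv q h t ≤ expConv q k t := by
  unfold expConv
  gcongr
  exact hk _

lemma expConv_iSup (q : ℝ) {h : ℕ → ℝ → ℝ≥0∞} (hm : ∀ n, Measurable (h n)) (hmono : Monotone h)
    (t : ℝ) : expConv q (fun u => ⨆ n, h n u) t = ⨆ n, expConv q (h n) t := by
  unfold expConv
  rw [← lintegral_iSup (fun n => by have := hm n; fun_prop)]
  · simp_rw [ENNReal.mul_iSup]
  · intro m n hmn v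
    dsimp only
    gcongr
    exact hmono hmn _

lemma expConv_of_nonpos (q : ℝ) {h : ℝ → ℝ≥0∞} (hh : ∀ t ≤ 0, h t = 0) {t : ℝ} (ht : t ≤ 0) :
    expConv q h t = 0 := by
  have : ∀ v, expKernel q v * h (t - v) = 0 := by
    intro v
    by_cases hv : 0 < v
    · rw [hh _ (by linarith), mul_zero]
    · rw [expKernel, Set.indicator_of_notMem (by simpa using hv), zero_mul]
  simp [expConv, this]

lemma lintegral_exp_mul_expConv (x q : ℝ) {h : ℝ → ℝ≥0∞} (hh : Measurable h) :
    ∫⁻ t, ENNReal.ofReal (Real.exp (-(x * t))) * expConv q h t =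
      kernelLaplace q x * ∫⁻ t, ENNReal.ofReal (Real.exp (-(x * t))) * h t :=
  lintegral_exp_mul_conv x (by fun_prop) hh

variable (b d : ℕ → ℝ≥0)

/-- Total rate of a birth-death chain in state `a`. -/
def bdRate (a : ℕ) : ℝ := (b a : ℝ) + d a

/-- Density of the first passage time from `a` to `0` on the event that at most `n` jumps are
made. -/
def passIter : ℕ → ℕ → ℝ → ℝ≥0∞
  | 0, _, _ => 0
  | _ + 1, 0, _ => 0
  | n + 1, a + 1, t =>
    -- The passage time from 0 is a point mass at 0 and has no density, so the death from state 1
    -- into 0 contributes this separate term.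
    (if a = 0 then (d 1 : ℝ≥0∞) * expKernel (bdRate b d 1) t else 0) +
      (b (a + 1) * expConv (bdRate b d (a + 1)) (passIter n (a + 2)) t +
        d (a + 1) * expConv (bdRate b d (a + 1)) (passIter n a) t)

/-- Density of the first passage time from `a` to `0`. -/
def passDensity (a : ℕ) (t : ℝ) : ℝ≥0∞ := ⨆ n, passIter b d n a t

lemma passIter_succ_succ (n a : ℕ) (t : ℝ) : passIter b d (n + 1) (a + 1) t =
    (if a = 0 then (d 1 : ℝ≥0∞) * expKernel (bdRate b d 1) t else 0) +
      (b (a + 1) * expConv (bdRate b d (a + 1)) (passIter b d n (a + 2)) t +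
        d (a + 1) * expConv (bdRate b d (a + 1)) (passIter b d n a) t) := by
  rw [passIter]

@[fun_prop]
lemma measurable_passIter (n a : ℕ) : Measurable (passIter b d n a) := by
  induction n generalizing a with
  | zero => exact measurable_const
  | succ n ih =>
    cases a with
    | zero => exact measurable_const
    | succ a =>
      have h1 := ih (a + 2)
      have h2 := ih a
      simp_rw [funext (passIter_succ_succ b d n a)]
      split_ifs <;> fun_prop

@[fun_prop]
lemma measurable_passDensity (a : ℕ) : Measurable (passDensity b d a) :=
  Measurable.iSup fun n => measurable_passIter b d n a

lemma passIter_mono (a : ℕ) : Monotone fun n => passIter b d n a := by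
  refine monotone_nat_of_le_succ fun n => ?_
  induction n generalizing a with
  | zero => exact fun t => zero_le
  | succ n ih =>
    intro t
    cases a with
    | zero => exact le_rfl
    | succ a =>
      rw [passIter_succ_succ, passIter_succ_succ]
      gcongr
      · exact expConv_mono _ (ih _) t
      · exact expConv_mono _ (ih _) t

lemma passIter_zero_state (n : ℕ) (t : ℝ) : passIter b d n 0 t = 0 := by
  cases n <;> rfl

lemma passDensity_zero_state (t : ℝ) : passDensity b d 0 t = 0 := by
  simp [passDensity, passIter_zero_state]

/-- The renewal equation at the first jump survives the limit in the number of jumps by monotone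
convergence. -/
lemma passDensity_succ (a : ℕ) (t : ℝ) :
    passDensity b d (a + 1) t =
      (if a = 0 then (d 1 : ℝ≥0∞) * expKernel (bdRate b d 1) t else 0) +
      (b (a + 1) * expConv (bdRate b d (a + 1)) (passDensity b d (a + 2)) t +
        d (a + 1) * expConv (bdRate b d (a + 1)) (passDensity b d a) t) := by
  have h1 : passDensity b d (a + 1) t = ⨆ n, passIter b d (n + 1) (a + 1) t :=
    (Monotone.iSup_nat_add (f := fun n => passIter b d n (a + 1) t)
      (fun m n hmn => passIter_mono b d (a + 1) hmn t) 1).symm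
  have h2 : ∀ a', expConv (bdRate b d (a + 1)) (passDensity b d a') t =
      ⨆ n, expConv (bdRate b d (a + 1)) (passIter b d n a') t := fun a' =>
    expConv_iSup _ (fun n => measurable_passIter b d n a') (passIter_mono b d a') t
  have h3 : ∀ (c : ℝ≥0∞) a',
      Monotone fun n => c * expConv (bdRate b d (a + 1)) (passIter b d n a') t :=
    fun c a' m n hmn => mul_le_mul_right (expConv_mono _ (passIter_mono b d a' hmn) t) c
  simp_rw [h1, h2, passIter_succ_succ]
  rw [ENNReal.mul_iSup, ENNReal.mul_iSup, ENNReal.iSup_add_iSup_of_monotone (h3 _ _) (h3 _ _),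
    ENNReal.add_iSup]

lemma passIter_of_nonpos (n a : ℕ) {t : ℝ} (ht : t ≤ 0) : passIter b d n a t = 0 := by
  induction n generalizing a t with
  | zero => rfl
  | succ n ih =>
    cases a with
    | zero => rfl
    | succ a =>
      have h1 : expKernel (bdRate b d 1) t = 0 := Set.indicator_of_notMem (by simpa using ht) _
      rw [passIter_succ_succ, expConv_of_nonpos _ (fun t ht => ih _ ht) ht,
        expConv_of_nonpos _ (fun t ht => ih _ ht) ht, h1]
      simp

lemma passDensity_of_nonpos (a : ℕ) {t : ℝ} (ht : t ≤ 0) : passDensity b d a t = 0 := by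
  simp [passDensity, passIter_of_nonpos b d _ a ht]

/-- Laplace transform of `passIter`; the passage time from `0` is `0`. -/
def lapIter (n a : ℕ) (x : ℝ) : ℝ≥0∞ :=
  if a = 0 then 1 else ∫⁻ t, ENNReal.ofReal (Real.exp (-(x * t))) * passIter b d n a t

/-- Laplace transform of `passDensity`; the passage time from `0` is `0`. -/
def lap (a : ℕ) (x : ℝ) : ℝ≥0∞ :=
  if a = 0 then 1 else ∫⁻ t, ENNReal.ofReal (Real.exp (-(x * t))) * passDensity b d a t

lemma lap_zero (x : ℝ) : lap b d 0 x = 1 := rfl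

lemma lapIter_zero_state (n : ℕ) (x : ℝ) : lapIter b d n 0 x = 1 := rfl

lemma lapIter_zero_succ (a : ℕ) (x : ℝ) : lapIter b d 0 (a + 1) x = 0 := by
  simp [lapIter, passIter]

lemma lapIter_mono (a : ℕ) (x : ℝ) : Monotone fun n => lapIter b d n a x := by
  intro m n hmn
  unfold lapIter
  dsimp only
  split_ifs
  · exact le_rfl
  · gcongr
    exact passIter_mono b d _ hmn _

lemma lap_eq_iSup (a : ℕ) (x : ℝ) : lap b d a x = ⨆ n, lapIter b d n a x := by
  by_cases h : a = 0
  · simp [lap, lapIter, h]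
  · simp only [lap, lapIter, h, if_false]
    rw [← lintegral_iSup (fun n => by fun_prop)]
    · simp_rw [← ENNReal.mul_iSup]; rfl
    · intro m n hmn t
      dsimp only
      gcongr
      exact passIter_mono b d _ hmn _

lemma tendsto_lapIter (a : ℕ) (x : ℝ) :
    Tendsto (fun n => lapIter b d n a x) atTop (𝓝 (lap b d a x)) := by
  rw [lap_eq_iSup]; exact tendsto_atTop_iSup (lapIter_mono b d a x)

/-- Convolution becomes a product. The extra kernel from state 1 is absorbed by the convention that
the transform from 0 equals 1. -/
lemma lapIter_succ (n a : ℕ) (x : ℝ) :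
    lapIter b d (n + 1) (a + 1) x = kernelLaplace (bdRate b d (a + 1)) x *
      (b (a + 1) * lapIter b d n (a + 2) x + d (a + 1) * lapIter b d n a x) := by
  simp only [lapIter, Nat.add_eq_zero_iff, one_ne_zero, and_false, if_false, OfNat.ofNat_ne_zero]
  simp_rw [passIter_succ_succ]
  have h1 : ∫⁻ t, ENNReal.ofReal (Real.exp (-(x * t))) *
      ((if a = 0 then (d 1 : ℝ≥0∞) * expKernel (bdRate b d 1) t else 0) +
      (b (a + 1) * expConv (bdRate b d (a + 1)) (passIter b d n (a + 2)) t +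
        d (a + 1) * expConv (bdRate b d (a + 1)) (passIter b d n a) t)) =
      (∫⁻ t, ENNReal.ofReal (Real.exp (-(x * t))) *
        (if a = 0 then (d 1 : ℝ≥0∞) * expKernel (bdRate b d 1) t else 0)) +
      (b (a + 1) * (∫⁻ t, ENNReal.ofReal (Real.exp (-(x * t))) *
          expConv (bdRate b d (a + 1)) (passIter b d n (a + 2)) t) +
        d (a + 1) * (∫⁻ t, ENNReal.ofReal (Real.exp (-(x * t))) *
          expConv (bdRate b d (a + 1)) (passIter b d n a) t)) := by
    rw [← lintegral_const_mul _ (by fun_prop), ← lintegral_const_mul _ (by fun_prop),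
      ← lintegral_add_left (by fun_prop), ← lintegral_add_left (by split_ifs <;> fun_prop)]
    exact lintegral_congr fun t => by ring
  rw [h1, lintegral_exp_mul_expConv x _ (by fun_prop),
    lintegral_exp_mul_expConv x _ (by fun_prop)]
  by_cases ha : a = 0
  · subst ha
    simp only [if_true, passIter_zero_state, mul_zero, lintegral_zero, add_zero, zero_add, mul_one]
    have : ∫⁻ t, ENNReal.ofReal (Real.exp (-(x * t))) *
        ((d 1 : ℝ≥0∞) * expKernel (bdRate b d 1) t) = kernelLaplace (bdRate b d 1) x * d 1 := by
      rw [kernelLaplace, ← lintegral_mul_const _ (by fun_prop)]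
      exact lintegral_congr fun v => by ring
    rw [this]; ring
  · simp only [ha, if_false, mul_zero, lintegral_zero, zero_add]
    ring

/-- This is the resolvent equation, valid in [0, ∞] at every real x. Infinite values are kept on
purpose: finiteness of one `lap` is later read off from it. -/
lemma lap_succ (a : ℕ) (x : ℝ) :
    lap b d (a + 1) x = kernelLaplace (bdRate b d (a + 1)) x *
      (b (a + 1) * lap b d (a + 2) x + d (a + 1) * lap b d a x) := by
  rw [lap_eq_iSup, ← (lapIter_mono b d (a + 1) x).iSup_nat_add 1]
  simp_rw [lapIter_succ]
  have h3 : ∀ (c : ℝ≥0∞) a', Monotone fun n => c * lapIter b d n a' x :=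
    fun c a' m n hmn => mul_le_mul_right (lapIter_mono b d a' x hmn) c
  rw [← ENNReal.mul_iSup, ← ENNReal.iSup_add_iSup_of_monotone (h3 _ _) (h3 _ _),
    ← ENNReal.mul_iSup, ← ENNReal.mul_iSup, lap_eq_iSup, lap_eq_iSup]

/-- `lap` is the minimal non-negative solution of the resolvent equation. -/
lemma lap_le_of_supersolution (x : ℝ) {m : ℕ → ℝ≥0∞} (h0 : 1 ≤ m 0)
    (hm : ∀ a, kernelLaplace (bdRate b d (a + 1)) x *
      (b (a + 1) * m (a + 2) + d (a + 1) * m a) ≤ m (a + 1)) (a : ℕ) : lap b d a x ≤ m a := by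
  rw [lap_eq_iSup]
  refine iSup_le fun n => ?_
  induction n generalizing a with
  | zero =>
    cases a with
    | zero => exact h0
    | succ a => rw [lapIter_zero_succ]; exact zero_le
  | succ n ih =>
    cases a with
    | zero => exact h0
    | succ a =>
      rw [lapIter_succ]
      refine le_trans ?_ (hm a)
      gcongr
      · exact ih _
      · exact ih _

lemma bdRate_pos {b d : ℕ → ℝ≥0} (hb : ∀ k, 0 < b k) (a : ℕ) : 0 < bdRate b d a :=
  add_pos_of_pos_of_nonneg (hb a) (d a).2

/-- For x ≥ 0 the constant 1 is a supersolution. -/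
lemma lap_le_one {b d : ℕ → ℝ≥0} (hb : ∀ k, 0 < b k) {x : ℝ} (hx : 0 ≤ x) (a : ℕ) :
    lap b d a x ≤ 1 := by
  refine lap_le_of_supersolution b d x (m := fun _ => 1) le_rfl (fun a => ?_) a
  have hq := bdRate_pos (d := d) hb (a + 1)
  rw [kernelLaplace_of_pos (by linarith), mul_one, mul_one, ← ENNReal.ofReal_coe_nnreal,
    ← ENNReal.ofReal_coe_nnreal, ← ENNReal.ofReal_add (by positivity) (by positivity),
    ← ENNReal.ofReal_mul (by positivity), ENNReal.ofReal_le_one]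
  change 1 / (bdRate b d (a + 1) + x) * bdRate b d (a + 1) ≤ 1
  rw [one_div_mul_eq_div, div_le_one (by linarith)]
  linarith

end

/-! ### Continuity and differentiability of the passage density -/

section

/-- Variation of constants: the dependence on t is moved into a prefactor and an integration limit,
which yields continuity and derivatives. -/
lemma expConv_of_support (q : ℝ) {h : ℝ → ℝ≥0∞} (hm : Measurable h) (hh : ∀ t ≤ 0, h t = 0)
    (t : ℝ) : expConv q h t = ENNReal.ofReal (Real.exp (-(q * t))) *
      ∫⁻ w in Set.Ioc 0 t, ENNReal.ofReal (Real.exp (q * w)) * h w := by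
  have h1 : expConv q h t = ∫⁻ w, expKernel q (t - w) * h w := by
    rw [expConv, ← lintegral_sub_left_eq_self _ t]
    simp
  rw [h1, setLIntegral_congr (Ioo_ae_eq_Ioc (a := (0:ℝ)) (b := t)).symm,
    ← lintegral_const_mul _ (by fun_prop), ← lintegral_indicator measurableSet_Ioo]
  refine lintegral_congr fun w => ?_
  by_cases hw0 : w ≤ 0
  · rw [hh w hw0, Set.indicator_of_notMem (by simp [hw0]), mul_zero]
  by_cases hwt : w < t
  · rw [Set.indicator_of_mem (Set.mem_Ioo.2 ⟨not_le.1 hw0, hwt⟩), expKernel,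
      Set.indicator_of_mem (by simpa using hwt), ← mul_assoc,
      ← ENNReal.ofReal_mul (Real.exp_nonneg _), ← Real.exp_add]
    congr 3; ring
  · rw [Set.indicator_of_notMem (by simp [hwt]), expKernel,
      Set.indicator_of_notMem (by simpa using hwt), zero_mul]

lemma expConv_le_lintegral {q : ℝ} (hq : 0 ≤ q) (h : ℝ → ℝ≥0∞) (t : ℝ) :
    expConv q h t ≤ ∫⁻ w, h w := by
  rw [expConv, ← lintegral_sub_left_eq_self h t]
  refine lintegral_mono fun v => ?_
  refine mul_le_of_le_one_left' (Set.indicator_apply_le' (fun hv => ?_) fun _ => zero_le)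
  rw [ENNReal.ofReal_le_one, Real.exp_le_one_iff]
  have := mul_nonneg hq (le_of_lt (Set.mem_Ioi.1 hv))
  linarith

variable (b d : ℕ → ℝ≥0)

/-- The continuous version of the first passage density on `[0, ∞)`. -/
def passPdf : ℕ → ℝ → ℝ
  | 0, _ => 0
  | a + 1, t => Real.exp (-(bdRate b d (a + 1) * t)) * ((if a = 0 then (d 1 : ℝ) else 0) +
      ∫ w in (0 : ℝ)..t, Real.exp (bdRate b d (a + 1) * w) *
        (b (a + 1) * (passDensity b d (a + 2) w).toReal +
          d (a + 1) * (passDensity b d a w).toReal))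

lemma passPdf_zero_state (t : ℝ) : passPdf b d 0 t = 0 := rfl

lemma passPdf_succ (a : ℕ) (t : ℝ) : passPdf b d (a + 1) t =
    Real.exp (-(bdRate b d (a + 1) * t)) * ((if a = 0 then (d 1 : ℝ) else 0) +
      ∫ w in (0 : ℝ)..t, Real.exp (bdRate b d (a + 1) * w) *
        (b (a + 1) * (passDensity b d (a + 2) w).toReal +
          d (a + 1) * (passDensity b d a w).toReal)) := rfl

lemma passPdf_apply_zero (a : ℕ) : passPdf b d (a + 1) 0 = if a = 0 then (d 1 : ℝ) else 0 := by
  simp [passPdf_succ]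

variable {b d} (hb : ∀ k, 0 < b k)

include hb

lemma lintegral_passDensity_le_one (a : ℕ) : ∫⁻ t, passDensity b d a t ≤ 1 := by
  cases a with
  | zero => simp [passDensity_zero_state]
  | succ a =>
    have := lap_le_one (d := d) hb le_rfl (a + 1)
    simpa [lap] using this

/-- The kernel is at most 1, so each convolution in the renewal equation is bounded by the total
mass of a density, which is at most 1. -/
lemma passDensity_ne_top (a : ℕ) (t : ℝ) : passDensity b d a t ≠ ∞ := by
  cases a with
  | zero => simp [passDensity_zero_state]
  | succ a =>
    have hq := (bdRate_pos (d := d) hb (a + 1)).le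
    have hconv : ∀ a', expConv (bdRate b d (a + 1)) (passDensity b d a') t ≠ ∞ := fun a' =>
      ne_top_of_le_ne_top ENNReal.one_ne_top
        ((expConv_le_lintegral hq _ t).trans (lintegral_passDensity_le_one hb a'))
    rw [passDensity_succ]
    refine ENNReal.add_ne_top.2 ⟨?_, ENNReal.add_ne_top.2
      ⟨ENNReal.mul_ne_top ENNReal.coe_ne_top (hconv _),
        ENNReal.mul_ne_top ENNReal.coe_ne_top (hconv _)⟩⟩
    split_ifs
    · refine ENNReal.mul_ne_top ENNReal.coe_ne_top ?_
      unfold expKernel Set.indicator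
      split_ifs <;> simp
    · simp

lemma integrable_passDensity_toReal (a : ℕ) :
    Integrable fun t => (passDensity b d a t).toReal :=
  integrable_toReal_of_lintegral_ne_top (by fun_prop)
    (ne_top_of_le_ne_top ENNReal.one_ne_top (lintegral_passDensity_le_one hb a))

lemma integrableOn_exp_mul_inflow (q : ℝ) (a : ℕ) (u v : ℝ) :
    IntervalIntegrable (fun w => Real.exp (q * w) *
        (b (a + 1) * (passDensity b d (a + 2) w).toReal +
          d (a + 1) * (passDensity b d a w).toReal)) volume u v := by
  refine IntervalIntegrable.continuousOn_mul ?_ (by fun_prop)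
  exact (((integrable_passDensity_toReal hb _).const_mul _).add
    ((integrable_passDensity_toReal hb _).const_mul _)).intervalIntegrable

lemma continuous_passPdf (a : ℕ) : Continuous (passPdf b d a) := by
  cases a with
  | zero => exact continuous_const
  | succ a =>
    simp_rw [funext (passPdf_succ b d a)]
    refine Continuous.mul (by fun_prop) (continuous_const.add ?_)
    exact intervalIntegral.continuous_primitive (fun u v => integrableOn_exp_mul_inflow hb _ a u v) 0

/-- The renewal equation in its variation-of-constants form, transferred to real numbers once
everything is known to be finite. -/
lemma passDensity_eq_ofReal_passPdf (a : ℕ) {t : ℝ} (ht : 0 < t) :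
    passDensity b d a t = ENNReal.ofReal (passPdf b d a t) := by
  cases a with
  | zero => simp [passDensity_zero_state, passPdf_zero_state]
  | succ a =>
    set q := bdRate b d (a + 1) with hq
    have hpt : ∀ w, ENNReal.ofReal (Real.exp (q * w) *
        (b (a + 1) * (passDensity b d (a + 2) w).toReal +
          d (a + 1) * (passDensity b d a w).toReal)) = ENNReal.ofReal (Real.exp (q * w)) *
          (b (a + 1) * passDensity b d (a + 2) w + d (a + 1) * passDensity b d a w) := by
      intro w
      rw [ENNReal.ofReal_mul (Real.exp_nonneg _), ENNReal.ofReal_add (by positivity)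
        (by positivity), ENNReal.ofReal_mul (by positivity), ENNReal.ofReal_mul (by positivity),
        ENNReal.ofReal_toReal (passDensity_ne_top hb _ _),
        ENNReal.ofReal_toReal (passDensity_ne_top hb _ _), ENNReal.ofReal_coe_nnreal,
        ENNReal.ofReal_coe_nnreal]
    have hI : ∫ w in (0 : ℝ)..t, Real.exp (q * w) * (b (a + 1) * (passDensity b d (a + 2) w).toReal +
          d (a + 1) * (passDensity b d a w).toReal) =
        (∫⁻ w in Set.Ioc 0 t, ENNReal.ofReal (Real.exp (q * w)) *
          (b (a + 1) * passDensity b d (a + 2) w + d (a + 1) * passDensity b d a w)).toReal := by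
      rw [intervalIntegral.integral_of_le ht.le, integral_eq_lintegral_of_nonneg_ae]
      · congr 1
        exact lintegral_congr hpt
      · exact ae_of_all _ fun w => by positivity
      · fun_prop
    have hfin : ∫⁻ w in Set.Ioc 0 t, ENNReal.ofReal (Real.exp (q * w)) *
          (b (a + 1) * passDensity b d (a + 2) w + d (a + 1) * passDensity b d a w) ≠ ∞ := by
      have h1 := (integrableOn_exp_mul_inflow (d := d) hb q a 0 t).1
      have h2 := h1.lintegral_lt_top.ne
      rwa [lintegral_congr hpt] at h2
    rw [passPdf_succ, hI, ENNReal.ofReal_mul (Real.exp_nonneg _), ENNReal.ofReal_add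
      (by split_ifs <;> positivity) ENNReal.toReal_nonneg, ENNReal.ofReal_toReal hfin,
      passDensity_succ, expConv_of_support _ (by fun_prop) (fun t ht => passDensity_of_nonpos b d _ ht),
      expConv_of_support _ (by fun_prop) (fun t ht => passDensity_of_nonpos b d _ ht), mul_add, ← hq]
    congr 1
    · by_cases ha : a = 0
      · subst ha
        simp only [if_true, expKernel]
        rw [Set.indicator_of_mem (by simpa using ht), ENNReal.ofReal_coe_nnreal, mul_comm]
      · simp [ha]
    · rw [mul_left_comm, mul_left_comm (d (a + 1) : ℝ≥0∞), ← mul_add]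
      congr 1
      rw [← lintegral_const_mul _ (by fun_prop), ← lintegral_const_mul _ (by fun_prop),
        ← lintegral_add_left (by fun_prop)]
      exact lintegral_congr fun w => by ring

lemma passDensity_toReal (a : ℕ) {t : ℝ} (ht : 0 < t) :
    (passDensity b d a t).toReal = passPdf b d a t := by
  have h0 : 0 ≤ passPdf b d a t := by
    cases a with
    | zero => exact le_rfl
    | succ a =>
      rw [passPdf_succ]
      refine mul_nonneg (Real.exp_nonneg _) (add_nonneg (by split_ifs <;> positivity) ?_)
      exact intervalIntegral.integral_nonneg ht.le fun w _ => by positivity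
  rw [passDensity_eq_ofReal_passPdf hb a ht, ENNReal.toReal_ofReal h0]

lemma passPdf_nonneg (a : ℕ) {t : ℝ} (ht : 0 ≤ t) : 0 ≤ passPdf b d a t := by
  rcases ht.eq_or_lt with rfl | ht
  · cases a with
    | zero => exact le_rfl
    | succ a => rw [passPdf_apply_zero]; split_ifs <;> positivity
  · rw [← passDensity_toReal hb a ht]; exact ENNReal.toReal_nonneg

/-- The Kolmogorov backward equation. The inflow under the integral agrees near t > 0 with its
continuous version, so the fundamental theorem of calculus applies. -/
lemma hasDerivAt_passPdf (a : ℕ) {t : ℝ} (ht : 0 < t) :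
    HasDerivAt (passPdf b d (a + 1)) (-bdRate b d (a + 1) * passPdf b d (a + 1) t +
      b (a + 1) * passPdf b d (a + 2) t + d (a + 1) * passPdf b d a t) t := by
  set q := bdRate b d (a + 1) with hq
  set h : ℝ → ℝ := fun w => Real.exp (q * w) * (b (a + 1) * (passDensity b d (a + 2) w).toReal +
          d (a + 1) * (passDensity b d a w).toReal) with hh
  have hcont : ContinuousAt h t := by
    have : (fun w => Real.exp (q * w) * (b (a + 1) * passPdf b d (a + 2) w +
          d (a + 1) * passPdf b d a w)) =ᶠ[𝓝 t] h := by
      filter_upwards [lt_mem_nhds ht] with w hw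
      rw [hh]
      simp only
      rw [passDensity_toReal hb _ hw, passDensity_toReal hb _ hw]
    refine ContinuousAt.congr ?_ this
    have h1 := continuous_passPdf (d := d) hb (a + 2)
    have h2 := continuous_passPdf (d := d) hb a
    fun_prop
  have hmeas : Measurable h := by fun_prop
  have hprim := intervalIntegral.integral_hasDerivAt_right
    (integrableOn_exp_mul_inflow (d := d) hb q a 0 t)
    (hmeas.stronglyMeasurable.stronglyMeasurableAtFilter) hcont
  have hexp : HasDerivAt (fun t => Real.exp (-(q * t))) (Real.exp (-(q * t)) * (-(q * 1))) t :=
    ((hasDerivAt_id t).const_mul q).neg.exp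
  refine (hexp.mul (hprim.const_add (if a = 0 then (d 1 : ℝ) else 0))).congr_deriv ?_
  rw [passPdf_succ, passDensity_toReal hb _ ht, passDensity_toReal hb _ ht]
  have he : Real.exp (-(q * t)) * Real.exp (q * t) = 1 := by
    rw [← Real.exp_add]; simp
  rw [← mul_assoc (Real.exp (-(q * t))) (Real.exp (q * t)), he, ← hq]
  ring

lemma lap_eq_setLIntegral (a : ℕ) (ha : a ≠ 0) (x : ℝ) :
    lap b d a x = ∫⁻ t in Set.Ioi 0, ENNReal.ofReal (Real.exp (-(x * t)) * passPdf b d a t) := by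
  rw [lap, if_neg ha, ← lintegral_indicator measurableSet_Ioi]
  refine lintegral_congr fun t => ?_
  by_cases ht : 0 < t
  · rw [Set.indicator_of_mem (Set.mem_Ioi.2 ht), ENNReal.ofReal_mul (Real.exp_nonneg _),
      passDensity_eq_ofReal_passPdf hb a ht]
  · rw [Set.indicator_of_notMem (by simpa using ht), passDensity_of_nonpos b d a (not_lt.1 ht),
      mul_zero]

end

/-! ### Finiteness of the Laplace transforms -/

section Finite

variable {b d : ℕ → ℝ≥0} (hb : ∀ k, 0 < b k) (hd : ∀ k, 1 ≤ k → 0 < d k)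

include hb hd

/-- The path that goes straight down to 0 already has positive weight, since all death rates are
positive. -/
lemma lap_ne_zero (a : ℕ) (x : ℝ) : lap b d a x ≠ 0 := by
  induction a with
  | zero => simp [lap_zero]
  | succ a ih =>
    rw [lap_succ]
    refine mul_ne_zero (kernelLaplace_ne_zero _ _) ?_
    have : (d (a + 1) : ℝ≥0∞) * lap b d a x ≠ 0 :=
      mul_ne_zero (by simpa using (hd (a + 1) (by omega)).ne') ih
    exact fun h => this (add_eq_zero.1 h).2

lemma inflow_ne_top {a : ℕ} {x : ℝ} (h : lap b d (a + 1) x ≠ ∞) :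
    b (a + 1) * lap b d (a + 2) x + d (a + 1) * lap b d a x ≠ ∞ := by
  intro htop
  rw [lap_succ, htop, ENNReal.mul_top (kernelLaplace_ne_zero _ _)] at h
  exact h rfl

/-- By irreducibility, finiteness at one state a ≥ 1 spreads: in the resolvent equation both
neighbours carry positive coefficients, so an infinite neighbour would make `lap` at a infinite. -/
lemma lap_ne_top {q : ℕ} (hq : 1 ≤ q) {x : ℝ} (h : lap b d q x ≠ ∞) (a : ℕ) :
    lap b d a x ≠ ∞ := by
  have hstep : ∀ a, lap b d (a + 1) x ≠ ∞ → lap b d (a + 2) x ≠ ∞ ∧ lap b d a x ≠ ∞ := by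
    intro a ha
    have := ENNReal.add_ne_top.1 (inflow_ne_top hb hd ha)
    refine ⟨fun h => this.1 ?_, fun h => this.2 ?_⟩
    · rw [h, ENNReal.mul_top (by simpa using (hb _).ne')]
    · rw [h, ENNReal.mul_top (by simpa using (hd (a + 1) (by omega)).ne')]
  have hdown : ∀ k a, a + k = q → lap b d a x ≠ ∞ := by
    intro k
    induction k with
    | zero => rintro a rfl; exact h
    | succ k ih => intro a ha; exact (hstep a (ih (a + 1) (by omega))).2
  have hup : ∀ k, lap b d (q + k) x ≠ ∞ := by
    intro k
    induction k with
    | zero => exact h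
    | succ k ih =>
      obtain ⟨m, rfl⟩ := Nat.exists_eq_succ_of_ne_zero (by omega : q ≠ 0)
      have h1 := (hstep (m + k) (by rwa [show m + k + 1 = m.succ + k by omega])).1
      rwa [show m.succ + (k + 1) = m + k + 2 by omega]
  rcases le_total a q with ha | ha
  · exact hdown (q - a) a (by omega)
  · have := hup (a - q)
    rwa [show q + (a - q) = a by omega] at this

/-- Otherwise the exponential kernel has an infinite transform, multiplied by a non-zero inflow. -/
lemma bdRate_add_pos {x : ℝ} (h : ∀ a, lap b d a x ≠ ∞) (a : ℕ) :
    0 < bdRate b d (a + 1) + x := by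
  by_contra hcon
  refine h (a + 1) ?_
  rw [lap_succ, kernelLaplace_of_nonpos (not_lt.1 hcon), ENNReal.top_mul]
  have : (d (a + 1) : ℝ≥0∞) * lap b d a x ≠ 0 :=
    mul_ne_zero (by simpa using (hd (a + 1) (by omega)).ne') (lap_ne_zero hb hd a x)
  exact fun h => this (add_eq_zero.1 h).2

lemma lap_toReal_succ {x : ℝ} (h : ∀ a, lap b d a x ≠ ∞) (a : ℕ) :
    (bdRate b d (a + 1) + x) * (lap b d (a + 1) x).toReal =
      b (a + 1) * (lap b d (a + 2) x).toReal + d (a + 1) * (lap b d a x).toReal := by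
  have hq := bdRate_add_pos hb hd h a
  rw [lap_succ, kernelLaplace_of_pos hq, ENNReal.toReal_mul, ENNReal.toReal_ofReal (by positivity),
    ENNReal.toReal_add (ENNReal.mul_ne_top ENNReal.coe_ne_top (h _))
      (ENNReal.mul_ne_top ENNReal.coe_ne_top (h _)), ENNReal.toReal_mul, ENNReal.toReal_mul,
    ENNReal.coe_toReal, ENNReal.coe_toReal, ← mul_assoc, mul_one_div_cancel hq.ne', one_mul]

lemma lapIter_toReal_succ {x : ℝ} (h : ∀ a, lap b d a x ≠ ∞) (n a : ℕ) :
    (bdRate b d (a + 1) + x) * (lapIter b d (n + 1) (a + 1) x).toReal =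
      b (a + 1) * (lapIter b d n (a + 2) x).toReal + d (a + 1) * (lapIter b d n a x).toReal := by
  have hq := bdRate_add_pos hb hd h a
  have hfin : ∀ a, lapIter b d n a x ≠ ∞ := fun a => ne_top_of_le_ne_top (h a) (by
    rw [lap_eq_iSup]; exact le_iSup (fun n => lapIter b d n a x) n)
  rw [lapIter_succ, kernelLaplace_of_pos hq, ENNReal.toReal_mul,
    ENNReal.toReal_ofReal (by positivity),
    ENNReal.toReal_add (ENNReal.mul_ne_top ENNReal.coe_ne_top (hfin _))
      (ENNReal.mul_ne_top ENNReal.coe_ne_top (hfin _)), ENNReal.toReal_mul, ENNReal.toReal_mul,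
    ENNReal.coe_toReal, ENNReal.coe_toReal, ← mul_assoc, mul_one_div_cancel hq.ne', one_mul]

/-- Complex solutions of the resolvent equation that are dominated by the minimal solution are
determined by their value at `0`. -/
lemma eq_of_dominated {s : ℂ} (h : ∀ a, lap b d a s.re ≠ ∞) {w z : ℕ → ℂ} (h0 : w 0 = z 0)
    (hw : ∀ a, (bdRate b d (a + 1) + s) * w (a + 1) = b (a + 1) * w (a + 2) + d (a + 1) * w a)
    (hz : ∀ a, (bdRate b d (a + 1) + s) * z (a + 1) = b (a + 1) * z (a + 2) + d (a + 1) * z a)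
    (hwb : ∀ a, ‖w a‖ ≤ (lap b d a s.re).toReal) (hzb : ∀ a, ‖z a‖ ≤ (lap b d a s.re).toReal)
    (a : ℕ) : w a = z a := by
  set x := s.re with hx
  -- Both solutions are dominated by `lap`, hence the factor 2 at n = 0. Each use of the resolvent
  -- equation replaces the bound by the next remainder `lap - lapIter n`, since |q + s| ≥ q + Re s;
  -- the remainder tends to 0.
  have key : ∀ n a, ‖w a - z a‖ ≤
      2 * ((lap b d a x).toReal - (lapIter b d n a x).toReal) := by
    intro n
    induction n with
    | zero =>
      intro a
      cases a with
      | zero => simp [h0, lap_zero, lapIter_zero_state]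
      | succ a =>
        rw [lapIter_zero_succ]
        have := norm_sub_le (w (a + 1)) (z (a + 1))
        have := hwb (a + 1)
        have := hzb (a + 1)
        simp only [ENNReal.toReal_zero, sub_zero]
        linarith
    | succ n ih =>
      intro a
      cases a with
      | zero => simp [h0, lap_zero, lapIter_zero_state]
      | succ a =>
        have hq := bdRate_add_pos hb hd h a
        have h1 : (bdRate b d (a + 1) + s) * (w (a + 1) - z (a + 1)) =
            b (a + 1) * (w (a + 2) - z (a + 2)) + d (a + 1) * (w a - z a) := by
          linear_combination hw a - hz a
        have h2 : bdRate b d (a + 1) + x ≤ ‖(bdRate b d (a + 1) : ℂ) + s‖ := by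
          refine le_trans (le_of_eq ?_) (Complex.re_le_norm _)
          simp [hx]
        have h3 : (bdRate b d (a + 1) + x) * ‖w (a + 1) - z (a + 1)‖ ≤
            b (a + 1) * ‖w (a + 2) - z (a + 2)‖ + d (a + 1) * ‖w a - z a‖ := by
          calc _ ≤ ‖(bdRate b d (a + 1) : ℂ) + s‖ * ‖w (a + 1) - z (a + 1)‖ := by gcongr
            _ = ‖(b (a + 1) : ℂ) * (w (a + 2) - z (a + 2)) + d (a + 1) * (w a - z a)‖ := by
              rw [← norm_mul, h1]
            _ ≤ _ := by
              refine (norm_add_le _ _).trans (le_of_eq ?_)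
              simp
        have h4 := mul_le_mul_of_nonneg_left (ih (a + 2)) (b (a + 1)).2
        have h5 := mul_le_mul_of_nonneg_left (ih a) (d (a + 1)).2
        have h6 := lap_toReal_succ hb hd h a
        have h7 := lapIter_toReal_succ hb hd h n a
        refine le_of_mul_le_mul_left ?_ hq
        simp only [NNReal.val_eq_coe] at h4 h5
        calc _ ≤ _ := h3
          _ ≤ _ := add_le_add h4 h5
          _ = _ := by linear_combination 2 * h7 - 2 * h6
  have hlim : Tendsto (fun n => 2 * ((lap b d a x).toReal - (lapIter b d n a x).toReal)) atTop
      (𝓝 (2 * ((lap b d a x).toReal - (lap b d a x).toReal))) :=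
    (tendsto_const_nhds.sub ((ENNReal.tendsto_toReal (h a)).comp
      (tendsto_lapIter b d a x))).const_mul 2
  have := ge_of_tendsto' hlim fun n => key n a
  simp only [sub_self, mul_zero] at this
  exact sub_eq_zero.1 (norm_le_zero_iff.1 this)

end Finite

/-! ### Convergence of the continued fractions -/

section ContFrac

variable (b d : ℕ → ℝ≥0)

/-- Transform of the passage from `j` to `j - 1` before reaching `j + n`, at a real argument. -/
def stepApproxReal (x : ℝ) : ℕ → ℕ → ℝ
  | 0, _ => 0
  | n + 1, j => d j / (bdRate b d j + x - b j * stepApproxReal x n (j + 1))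

/-- Transform of the passage from `j` to `j - 1` before reaching `j + n`. -/
def stepApprox (s : ℂ) : ℕ → ℕ → ℂ
  | 0, _ => 0
  | n + 1, j => d j / (bdRate b d j + s - b j * stepApprox s n (j + 1))

lemma stepApproxReal_succ (x : ℝ) (n j : ℕ) : stepApproxReal b d x (n + 1) j =
    d j / (bdRate b d j + x - b j * stepApproxReal b d x n (j + 1)) := rfl

lemma stepApprox_succ (s : ℂ) (n j : ℕ) : stepApprox b d s (n + 1) j =
    d j / (bdRate b d j + s - b j * stepApprox b d s n (j + 1)) := rfl

variable {b d} (hb : ∀ k, 0 < b k) (hd : ∀ k, 1 ≤ k → 0 < d k)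

/-- The numerator -λ_{k-1} d_k splits as -λ_{k-1} times d_k; the first factor is pulled out, the
second is the numerator of the passage recursion. -/
lemma cfApprox_eq_stepApprox (s : ℂ) (n j : ℕ) :
    cfApprox (numer b d) (denom b d s) n (j + 1) = -(b j : ℂ) * stepApprox b d s n (j + 1) := by
  induction n generalizing j with
  | zero => simp [cfApprox, stepApprox]
  | succ n ih =>
    rw [cfApprox, ih, stepApprox, numer, denom, bdRate]
    simp only [Nat.add_sub_cancel]
    push_cast
    rw [mul_div_assoc]
    congr 2
    ring

include hb hd

/-- The ratios `lap (j+1) / lap j` form a fixed point of the recursion, by the resolvent equation.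
The map y ↦ d/(q + x - b y) is increasing while its denominator is positive, so the iterates from 0
increase, stay below the fixed point, and keep their denominators above the positive one of the
fixed point. -/
lemma stepApproxReal_bounds {x : ℝ} (h : ∀ a, lap b d a x ≠ ∞) (n j : ℕ) :
    0 ≤ stepApproxReal b d x n (j + 1) ∧
    stepApproxReal b d x n (j + 1) ≤ (lap b d (j + 1) x).toReal / (lap b d j x).toReal ∧
    0 < bdRate b d (j + 1) + x - b (j + 1) * stepApproxReal b d x n (j + 2) ∧
    stepApproxReal b d x n (j + 1) ≤ stepApproxReal b d x (n + 1) (j + 1) := by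
  have hpos : ∀ a, 0 < (lap b d a x).toReal := fun a =>
    ENNReal.toReal_pos (lap_ne_zero hb hd a x) (h a)
  have hρ : ∀ j, (bdRate b d (j + 1) + x -
      b (j + 1) * ((lap b d (j + 2) x).toReal / (lap b d (j + 1) x).toReal)) =
      d (j + 1) * (lap b d j x).toReal / (lap b d (j + 1) x).toReal := by
    intro j
    have h1 := lap_toReal_succ hb hd h j
    have := (hpos (j + 1)).ne'
    field_simp
    linarith
  have hdpos : ∀ j, (0 : ℝ) < d (j + 1) := fun j => hd _ (by omega)
  have hDpos : ∀ j, 0 < d (j + 1) * (lap b d j x).toReal / (lap b d (j + 1) x).toReal :=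
    fun j => div_pos (mul_pos (hdpos j) (hpos j)) (hpos _)
  have hden : ∀ n j, stepApproxReal b d x n (j + 2) ≤
      (lap b d (j + 2) x).toReal / (lap b d (j + 1) x).toReal →
      d (j + 1) * (lap b d j x).toReal / (lap b d (j + 1) x).toReal ≤
        bdRate b d (j + 1) + x - b (j + 1) * stepApproxReal b d x n (j + 2) := by
    intro n j hn
    rw [← hρ j]
    have := mul_le_mul_of_nonneg_left hn (b (j + 1)).2
    simp only [NNReal.val_eq_coe] at this
    linarith
  induction n generalizing j with
  | zero =>
    have h0 : ∀ j, stepApproxReal b d x 0 (j + 1) ≤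
        (lap b d (j + 1) x).toReal / (lap b d j x).toReal := fun j =>
      div_nonneg (hpos _).le (hpos _).le
    have h1 := (hDpos j).trans_le (hden 0 j (h0 (j + 1)))
    refine ⟨le_rfl, h0 j, h1, ?_⟩
    exact div_nonneg (hdpos j).le h1.le
  | succ n ih =>
    have hle : ∀ j, stepApproxReal b d x (n + 1) (j + 1) ≤
        (lap b d (j + 1) x).toReal / (lap b d j x).toReal := by
      intro j
      calc stepApproxReal b d x (n + 1) (j + 1) ≤
          d (j + 1) / (d (j + 1) * (lap b d j x).toReal / (lap b d (j + 1) x).toReal) :=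
            div_le_div_of_nonneg_left (hdpos j).le (hDpos j) (hden n j (ih (j + 1)).2.1)
        _ = _ := by
          have := (hpos j).ne'
          have := (hpos (j + 1)).ne'
          have := (hdpos j).ne'
          field_simp
    have h1 := (hDpos j).trans_le (hden (n + 1) j (hle (j + 1)))
    refine ⟨div_nonneg (hdpos j).le (ih j).2.2.1.le, hle j, h1, ?_⟩
    refine div_le_div_of_nonneg_left (hdpos j).le h1 ?_
    have := mul_le_mul_of_nonneg_left (ih (j + 1)).2.2.2 (b (j + 1)).2
    simp only [NNReal.val_eq_coe] at this
    linarith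

lemma norm_denom_ge {s : ℂ} {q c y : ℝ} {w : ℂ} (hc : 0 ≤ c) (hw : ‖w‖ ≤ y) :
    q + s.re - c * y ≤ ‖(q : ℂ) + s - c * w‖ := by
  have h1 : c * w.re ≤ c * y := mul_le_mul_of_nonneg_left ((Complex.re_le_norm w).trans hw) hc
  refine le_trans ?_ (Complex.re_le_norm _)
  simp only [Complex.sub_re, Complex.add_re, Complex.ofReal_re, Complex.mul_re, Complex.ofReal_im,
    zero_mul, sub_zero]
  linarith

lemma norm_stepApprox_le {s : ℂ} (h : ∀ a, lap b d a s.re ≠ ∞) (n j : ℕ) :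
    ‖stepApprox b d s n (j + 1)‖ ≤ stepApproxReal b d s.re n (j + 1) := by
  induction n generalizing j with
  | zero => simp [stepApprox, stepApproxReal]
  | succ n ih =>
    rw [stepApprox, stepApproxReal, norm_div]
    have h1 := norm_denom_ge hb hd (s := s) (q := bdRate b d (j + 1)) (b (j + 1)).2 (ih (j + 1))
    have h2 := (stepApproxReal_bounds hb hd h n j).2.2.1
    have h3 : ‖(d (j + 1) : ℂ)‖ = d (j + 1) := by simp
    rw [h3]
    exact div_le_div_of_nonneg_left (d (j + 1)).2 h2 h1

lemma stepApprox_denom_ne_zero {s : ℂ} (h : ∀ a, lap b d a s.re ≠ ∞) (n j : ℕ) :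
    (bdRate b d (j + 1) : ℂ) + s - b (j + 1) * stepApprox b d s n (j + 2) ≠ 0 := by
  have h1 := norm_denom_ge hb hd (s := s) (q := bdRate b d (j + 1)) (b (j + 1)).2
    (norm_stepApprox_le hb hd h n (j + 1))
  have h2 := (stepApproxReal_bounds hb hd h n j).2.2.1
  exact norm_pos_iff.1 (h2.trans_le h1)

/-- Successive differences obey the same identity at s and at Re s. Numerators compare by induction,
and each complex denominator is at least as large in modulus as the real one. The real differences
telescope, which will give the Cauchy property. -/
lemma norm_stepApprox_sub_le {s : ℂ} (h : ∀ a, lap b d a s.re ≠ ∞) (n j : ℕ) :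
    ‖stepApprox b d s (n + 1) (j + 1) - stepApprox b d s n (j + 1)‖ ≤
      stepApproxReal b d s.re (n + 1) (j + 1) - stepApproxReal b d s.re n (j + 1) := by
  induction n generalizing j with
  | zero =>
    have := norm_stepApprox_le hb hd h 1 j
    simpa [stepApprox, stepApproxReal] using this
  | succ n ih =>
    have hne1 := stepApprox_denom_ne_zero hb hd h (n + 1) j
    have hne2 := stepApprox_denom_ne_zero hb hd h n j
    have hp1 := (stepApproxReal_bounds hb hd h (n + 1) j).2.2.1
    have hp2 := (stepApproxReal_bounds hb hd h n j).2.2.1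
    have hn1 := norm_denom_ge hb hd (s := s) (q := bdRate b d (j + 1)) (b (j + 1)).2
      (norm_stepApprox_le hb hd h (n + 1) (j + 1))
    have hn2 := norm_denom_ge hb hd (s := s) (q := bdRate b d (j + 1)) (b (j + 1)).2
      (norm_stepApprox_le hb hd h n (j + 1))
    have e1 : stepApprox b d s (n + 2) (j + 1) - stepApprox b d s (n + 1) (j + 1) =
        d (j + 1) * b (j + 1) * (stepApprox b d s (n + 1) (j + 2) - stepApprox b d s n (j + 2)) /
        ((bdRate b d (j + 1) + s - b (j + 1) * stepApprox b d s (n + 1) (j + 2)) *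
         (bdRate b d (j + 1) + s - b (j + 1) * stepApprox b d s n (j + 2))) := by
      rw [stepApprox_succ b d s (n + 1), stepApprox_succ b d s n (j + 1), div_sub_div _ _ hne1 hne2]
      congr 1
      ring
    have e2 : stepApproxReal b d s.re (n + 2) (j + 1) - stepApproxReal b d s.re (n + 1) (j + 1) =
        d (j + 1) * b (j + 1) *
          (stepApproxReal b d s.re (n + 1) (j + 2) - stepApproxReal b d s.re n (j + 2)) /
        ((bdRate b d (j + 1) + s.re - b (j + 1) * stepApproxReal b d s.re (n + 1) (j + 2)) *
         (bdRate b d (j + 1) + s.re - b (j + 1) * stepApproxReal b d s.re n (j + 2))) := by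
      rw [stepApproxReal_succ b d _ (n + 1), stepApproxReal_succ b d _ n (j + 1),
        div_sub_div _ _ hp1.ne' hp2.ne']
      congr 1
      ring
    rw [e1, e2, norm_div, norm_mul, norm_mul, norm_mul]
    have h3 : ‖(d (j + 1) : ℂ)‖ = d (j + 1) := by simp
    have h4 : ‖(b (j + 1) : ℂ)‖ = b (j + 1) := by simp
    rw [h3, h4]
    have h5 := ih (j + 1)
    have h6 : 0 ≤ stepApproxReal b d s.re (n + 1) (j + 2) - stepApproxReal b d s.re n (j + 2) :=
      (norm_nonneg _).trans h5
    refine div_le_div₀ (by positivity) (by gcongr) (mul_pos hp1 hp2) ?_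
    exact mul_le_mul hn1 hn2 hp2.le (norm_nonneg _)

lemma exists_tendsto_stepApprox {s : ℂ} (h : ∀ a, lap b d a s.re ≠ ∞) (j : ℕ) :
    ∃ v : ℂ, Tendsto (fun n => stepApprox b d s n (j + 1)) atTop (𝓝 v) := by
  refine cauchySeq_tendsto_of_complete ?_
  refine cauchySeq_of_dist_le_of_summable (fun n =>
    stepApproxReal b d s.re (n + 1) (j + 1) - stepApproxReal b d s.re n (j + 1)) (fun n => ?_) ?_
  · rw [dist_comm, dist_eq_norm]
    exact norm_stepApprox_sub_le hb hd h n j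
  · refine summable_of_sum_range_le (c := (lap b d (j + 1) s.re).toReal / (lap b d j s.re).toReal)
      (fun n => sub_nonneg.2 (stepApproxReal_bounds hb hd h n j).2.2.2) fun n => ?_
    rw [Finset.sum_range_sub (fun n => stepApproxReal b d s.re n (j + 1))]
    simpa [stepApproxReal] using (stepApproxReal_bounds hb hd h n j).2.1

/-- The continued fractions converge, and their product is the value at `a` of any solution of the
resolvent equation dominated by the minimal solution. -/
lemma exists_hasContFrac_and_cfTransform_eq {s : ℂ} (h : ∀ a, lap b d a s.re ≠ ∞) {z : ℕ → ℂ}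
    (h0 : z 0 = 1)
    (hz : ∀ a, (bdRate b d (a + 1) + s) * z (a + 1) = b (a + 1) * z (a + 2) + d (a + 1) * z a)
    (hzb : ∀ a, ‖z a‖ ≤ (lap b d a s.re).toReal) :
    (∀ j, 1 ≤ j → ∃ v, HasContFrac (numer b d) (denom b d s) j v) ∧
      ∀ a, cfTransform b d a s = z a := by
  choose G hG using exists_tendsto_stepApprox hb hd h
  have hcf : ∀ j, HasContFrac (numer b d) (denom b d s) (j + 1) (-(b j : ℂ) * G j) := by
    intro j
    unfold HasContFrac
    simp_rw [cfApprox_eq_stepApprox]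
    exact (hG j).const_mul _
  refine ⟨fun j hj => ?_, fun a => ?_⟩
  · obtain ⟨k, rfl⟩ := Nat.exists_eq_add_of_le' hj
    exact ⟨_, hcf k⟩
  have hpos : ∀ a, 0 < (lap b d a s.re).toReal := fun a =>
    ENNReal.toReal_pos (lap_ne_zero hb hd a _) (h a)
  have hM : ∀ a, cfTransform b d a s = ∏ j ∈ Finset.range a, G j := by
    intro a
    unfold cfTransform
    rw [← Finset.Ico_succ_right_eq_Icc, Nat.succ_eq_succ, Finset.prod_Ico_eq_prod_range]
    refine Finset.prod_congr (by simp) fun j _ => ?_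
    have h1 : contFrac (numer b d) (denom b d s) (j + 1) = -(b j : ℂ) * G j := (hcf j).limUnder_eq
    have h2 : ((b j : ℝ) : ℂ) ≠ 0 := by simpa using (hb j).ne'
    rw [add_comm 1 j, h1, Nat.add_sub_cancel]
    field_simp
  rw [hM]
  -- Uniqueness of dominated solutions, applied to the partial products of the limits. Passing to
  -- the limit in the recursion (`h1`) yields their resolvent equation, and the ratio bounds on the
  -- factors telescope to domination by `lap`.
  refine eq_of_dominated hb hd h (w := fun a => ∏ j ∈ Finset.range a, G j) (by simp [h0])
    (fun a => ?_) hz (fun a => ?_) hzb a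
  · have h1 : G a * (bdRate b d (a + 1) + s - b (a + 1) * G (a + 1)) = d (a + 1) := by
      have hl : Tendsto (fun n => stepApprox b d s (n + 1) (a + 1) *
          (bdRate b d (a + 1) + s - b (a + 1) * stepApprox b d s n (a + 2))) atTop
          (𝓝 (G a * (bdRate b d (a + 1) + s - b (a + 1) * G (a + 1)))) :=
        ((hG a).comp (tendsto_add_atTop_nat 1)).mul
          (tendsto_const_nhds.sub ((hG (a + 1)).const_mul _))
      refine tendsto_nhds_unique hl ?_
      refine tendsto_const_nhds.congr fun n => ?_
      rw [stepApprox, div_mul_cancel₀ _ (stepApprox_denom_ne_zero hb hd h n a)]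
    simp only [Finset.prod_range_succ]
    linear_combination (∏ j ∈ Finset.range a, G j) * h1
  · induction a with
    | zero => simp [lap_zero]
    | succ a ih =>
      have hGa : ‖G a‖ ≤ (lap b d (a + 1) s.re).toReal / (lap b d a s.re).toReal :=
        le_of_tendsto' (hG a).norm fun n =>
          (norm_stepApprox_le hb hd h n a).trans (stepApproxReal_bounds hb hd h n a).2.1
      rw [Finset.prod_range_succ, norm_mul]
      calc _ ≤ (lap b d a s.re).toReal *
            ((lap b d (a + 1) s.re).toReal / (lap b d a s.re).toReal) := by gcongr
        _ = _ := by have := (hpos a).ne'; field_simp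

end ContFrac

/-! ### Complex Laplace transforms of the first passage densities -/

/-- Fundamental theorem of calculus on `(0, ∞)` for integrable functions. -/
lemma integral_Ioi_zero_of_hasDerivAt {E : Type*} [NormedAddCommGroup E] [NormedSpace ℝ E]
    [CompleteSpace E] {f f' : ℝ → E} (hcont : ContinuousWithinAt f (Set.Ici 0) 0)
    (hderiv : ∀ t, 0 < t → HasDerivAt f (f' t) t) (hf : IntegrableOn f (Set.Ioi 0))
    (hf' : IntegrableOn f' (Set.Ioi 0)) : ∫ t in Set.Ioi 0, f' t = -f 0 := by
  have h0 := tendsto_zero_of_hasDerivAt_of_integrableOn_Ioi (a := (0 : ℝ)) (f := f) (f' := f')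
    (fun t ht => hderiv t ht) hf' hf
  rw [integral_Ioi_of_hasDerivAt_of_tendsto hcont (fun t ht => hderiv t ht) hf' h0, zero_sub]

lemma norm_cexp_neg_mul (s : ℂ) (t : ℝ) : ‖Complex.exp (-s * t)‖ = Real.exp (-(s.re * t)) := by
  rw [Complex.norm_exp]; simp

lemma hasDerivAt_cexp_neg_mul (s : ℂ) (t : ℝ) :
    HasDerivAt (fun t : ℝ => Complex.exp (-s * t)) (-s * Complex.exp (-s * t)) t := by
  have h1 : HasDerivAt (fun t : ℝ => -s * (t : ℂ)) (-s * 1) t :=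
    (Complex.ofRealCLM.hasDerivAt (x := t)).const_mul (-s)
  have := h1.cexp
  rw [mul_one] at this
  rwa [mul_comm] at this

section Transform

variable {b d : ℕ → ℝ≥0} (hb : ∀ k, 0 < b k) (hd : ∀ k, 1 ≤ k → 0 < d k)

variable (b d) in
/-- Laplace transform of the first passage time from `a` to `0`. -/
def passTransform (a : ℕ) (s : ℂ) : ℂ :=
  if a = 0 then 1 else ∫ t in Set.Ioi (0 : ℝ), Complex.exp (-s * t) * (passPdf b d a t : ℂ)

include hb

/-- The density is non-negative, so absolute convergence depends on Re s only. -/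
lemma integrableOn_exp_mul_passPdf_iff {a : ℕ} (ha : a ≠ 0) (s : ℂ) :
    IntegrableOn (fun t : ℝ => Complex.exp (-s * t) * (passPdf b d a t : ℂ)) (Set.Ioi 0) ↔
      lap b d a s.re ≠ ∞ := by
  have hc := continuous_passPdf (d := d) hb a
  have hm : AEStronglyMeasurable (fun t : ℝ => Complex.exp (-s * t) * (passPdf b d a t : ℂ))
      (volume.restrict (Set.Ioi 0)) := by
    apply Continuous.aestronglyMeasurable
    fun_prop
  rw [IntegrableOn, Integrable, and_iff_right hm, HasFiniteIntegral, lt_top_iff_ne_top,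
    lap_eq_setLIntegral hb a ha]
  have : ∫⁻ t in Set.Ioi (0 : ℝ), ‖Complex.exp (-s * t) * (passPdf b d a t : ℂ)‖ₑ =
      ∫⁻ t in Set.Ioi (0 : ℝ), ENNReal.ofReal (Real.exp (-(s.re * t)) * passPdf b d a t) := by
    refine setLIntegral_congr_fun measurableSet_Ioi fun t ht => ?_
    rw [← ofReal_norm, norm_mul, norm_cexp_neg_mul, Complex.norm_real, Real.norm_of_nonneg
      (passPdf_nonneg hb a (le_of_lt ht))]
  rw [this]

lemma norm_passTransform_le {a : ℕ} {s : ℂ} (h : lap b d a s.re ≠ ∞) :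
    ‖passTransform b d a s‖ ≤ (lap b d a s.re).toReal := by
  unfold passTransform
  split_ifs with ha
  · simp [ha, lap_zero]
  · refine (norm_integral_le_integral_norm _).trans (le_of_eq ?_)
    rw [lap_eq_setLIntegral hb a ha, integral_eq_lintegral_of_nonneg_ae
      (ae_of_all _ fun _ => norm_nonneg _)]
    · congr 1
      refine setLIntegral_congr_fun measurableSet_Ioi fun t ht => ?_
      rw [norm_mul, norm_cexp_neg_mul, Complex.norm_real, Real.norm_of_nonneg
        (passPdf_nonneg hb a (le_of_lt ht))]
    · exact ((integrableOn_exp_mul_passPdf_iff hb ha s).2 h).norm.aestronglyMeasurable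

lemma integrableOn_exp_mul_passPdf {a : ℕ} {s : ℂ} (h : lap b d a s.re ≠ ∞) :
    IntegrableOn (fun t : ℝ => Complex.exp (-s * t) * (passPdf b d a t : ℂ)) (Set.Ioi 0) := by
  by_cases ha : a = 0
  · simp [ha, passPdf_zero_state]
  · exact (integrableOn_exp_mul_passPdf_iff hb ha s).2 h

include hd

/-- Integrate the derivative of e^{-st} times the density over (0, ∞), using the backward equation.
The boundary value at 0 is d_1 for state 1 and 0 for higher states, which is accounted for by the
transform 1 of state 0. -/
lemma passTransform_succ {s : ℂ} (h : ∀ a, lap b d a s.re ≠ ∞) (a : ℕ) :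
    (bdRate b d (a + 1) + s) * passTransform b d (a + 1) s =
      b (a + 1) * passTransform b d (a + 2) s + d (a + 1) * passTransform b d a s := by
  have hI : ∀ a, IntegrableOn (fun t : ℝ => Complex.exp (-s * t) * (passPdf b d a t : ℂ))
      (Set.Ioi 0) := fun a => integrableOn_exp_mul_passPdf hb (h a)
  set q := bdRate b d (a + 1) with hq
  set f : ℝ → ℂ := fun t => Complex.exp (-s * t) * (passPdf b d (a + 1) t : ℂ) with hf
  set f' : ℝ → ℂ := fun t => -(q + s) * (Complex.exp (-s * t) * (passPdf b d (a + 1) t : ℂ)) +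
    b (a + 1) * (Complex.exp (-s * t) * (passPdf b d (a + 2) t : ℂ)) +
    d (a + 1) * (Complex.exp (-s * t) * (passPdf b d a t : ℂ)) with hf'
  have hderiv : ∀ t, 0 < t → HasDerivAt f (f' t) t := by
    intro t ht
    refine ((hasDerivAt_cexp_neg_mul s t).mul (hasDerivAt_passPdf hb a ht).ofReal_comp).congr_deriv ?_
    rw [hf', ← hq]
    push_cast
    ring
  have hc := continuous_passPdf (d := d) hb (a + 1)
  have hint1 := (hI (a + 1)).const_mul (-(q + s))
  have hint2 := (hI (a + 2)).const_mul (b (a + 1) : ℂ)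
  have hint3 := (hI a).const_mul (d (a + 1) : ℂ)
  have key := integral_Ioi_zero_of_hasDerivAt (f := f) (f' := f') (by
    apply Continuous.continuousWithinAt; fun_prop) hderiv (hI (a + 1))
    ((hint1.add hint2).add hint3)
  have hint12 : IntegrableOn (fun t : ℝ =>
      -(q + s) * (Complex.exp (-s * t) * (passPdf b d (a + 1) t : ℂ)) +
      b (a + 1) * (Complex.exp (-s * t) * (passPdf b d (a + 2) t : ℂ))) (Set.Ioi 0) :=
    hint1.add hint2
  simp only [hf'] at key
  rw [integral_add hint12 hint3, integral_add hint1 hint2, integral_const_mul,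
    integral_const_mul, integral_const_mul] at key
  simp only [hf, Complex.ofReal_zero, mul_zero, Complex.exp_zero, one_mul, passPdf_apply_zero] at key
  simp only [passTransform, Nat.add_eq_zero_iff, one_ne_zero, and_false, if_false,
    OfNat.ofNat_ne_zero]
  by_cases ha : a = 0
  · subst ha
    simp only [passPdf_zero_state, Complex.ofReal_zero, mul_zero, integral_zero, if_true,
      zero_add, add_zero] at key ⊢
    linear_combination -key
  · simp only [ha, if_false, Complex.ofReal_zero, neg_zero] at key ⊢
    linear_combination -key

/-- The Laplace transform of the first passage time is the product of continued fractions, wherever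
it converges absolutely. -/
theorem hasContFrac_and_cfTransform_eq {q : ℕ} (hq : 1 ≤ q) {s : ℂ} (h : lap b d q s.re ≠ ∞) :
    (∀ j, 1 ≤ j → ∃ v, HasContFrac (numer b d) (denom b d s) j v) ∧
      cfTransform b d q s = ∫ t in Set.Ioi (0 : ℝ), Complex.exp (-s * t) * (passPdf b d q t : ℂ) := by
  have hall := lap_ne_top hb hd hq h
  obtain ⟨h1, h2⟩ := exists_hasContFrac_and_cfTransform_eq hb hd hall
    (z := fun a => passTransform b d a s) (by simp [passTransform])
    (passTransform_succ hb hd hall) (fun a => norm_passTransform_le hb (hall a))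
  refine ⟨h1, ?_⟩
  rw [h2, passTransform, if_neg (by omega)]

end Transform

/-! ### Uniqueness of Laplace transforms -/

/-- Transforms are compared only at s > 0; the total mass is recovered as s → 0. -/
lemma tendsto_lintegral_exp_inv_nat (μ : Measure ℝ) [IsFiniteMeasure μ] (h0 : ∀ᵐ x ∂μ, 0 ≤ x) :
    Tendsto (fun n : ℕ => ∫⁻ x, ENNReal.ofReal (Real.exp (-(1 / ((n : ℝ) + 1) * x))) ∂μ) atTop
      (𝓝 (μ Set.univ)) := by
  rw [← lintegral_one]
  refine tendsto_lintegral_of_dominated_convergence (fun _ => 1) (fun n => by fun_prop)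
    (fun n => ?_) (by simp) (ae_of_all _ fun x => ?_)
  · filter_upwards [h0] with x hx
    rw [ENNReal.ofReal_le_one, Real.exp_le_one_iff]
    have : 0 ≤ 1 / ((n : ℝ) + 1) * x := by positivity
    linarith
  · rw [← ENNReal.ofReal_one]
    apply ENNReal.tendsto_ofReal
    have h1 : Tendsto (fun n : ℕ => Real.exp (-(1 / ((n : ℝ) + 1) * x))) atTop
        (𝓝 (Real.exp (-(0 * x)))) :=
      (Real.continuous_exp.tendsto _).comp
        (tendsto_one_div_add_atTop_nhds_zero_nat.mul_const _).neg
    simpa using h1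

/-- The substitution e^{-x} maps [0, ∞) into a bounded interval, and the n-th moment of the image is
the Laplace transform at n. Boundedness justifies expanding the characteristic function in moments.
-/
lemma charFun_map_exp_neg (μ : Measure ℝ) [IsFiniteMeasure μ] (h0 : ∀ᵐ x ∂μ, 0 ≤ x) (u : ℝ) :
    charFun (μ.map fun x => Real.exp (-x)) u =
      ∑' n : ℕ, (u * Complex.I) ^ n / (n.factorial : ℂ) *
        ((∫⁻ x, ENNReal.ofReal (Real.exp (-((n : ℝ) * x))) ∂μ).toReal : ℂ) := by
  rw [charFun_apply_real, integral_map (by fun_prop) (by fun_prop)]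
  set F : ℕ → ℝ → ℂ := fun n x =>
    (u * Complex.I) ^ n / (n.factorial : ℂ) * (Real.exp (-((n : ℝ) * x)) : ℂ) with hF
  have hle : ∀ n : ℕ, ∀ᵐ x ∂μ, Real.exp (-((n : ℝ) * x)) ≤ 1 := by
    intro n
    filter_upwards [h0] with x hx
    rw [Real.exp_le_one_iff]
    have : 0 ≤ (n : ℝ) * x := by positivity
    linarith
  have hint0 : ∀ n : ℕ, Integrable (fun x => (Real.exp (-((n : ℝ) * x)))) μ := fun n => by
    refine Integrable.of_bound (by fun_prop) 1 ?_
    filter_upwards [hle n] with x hx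
    rwa [Real.norm_of_nonneg (Real.exp_nonneg _)]
  have hint : ∀ n, Integrable (F n) μ := fun n => ((hint0 n).ofReal).const_mul _
  have hsum : Summable fun n => ∫ x, ‖F n x‖ ∂μ := by
    refine Summable.of_nonneg_of_le (fun n => integral_nonneg fun _ => norm_nonneg _) (fun n => ?_)
      ((Real.summable_pow_div_factorial |u|).mul_right (μ.real Set.univ))
    have : ∀ x, ‖F n x‖ = |u| ^ n / n.factorial * Real.exp (-((n : ℝ) * x)) := by
      intro x
      simp [hF, -Complex.ofReal_exp, Complex.norm_real]
    simp_rw [this]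
    rw [integral_const_mul]
    gcongr
    calc _ ≤ ∫ x, (1 : ℝ) ∂μ := integral_mono_ae (hint0 n) (integrable_const 1) (hle n)
      _ = _ := by simp
  have h1 := hasSum_integral_of_summable_integral_norm hint hsum
  have h2 : ∀ x, ∑' n, F n x = Complex.exp (u * (Real.exp (-x) : ℝ) * Complex.I) := by
    intro x
    have h3 := NormedSpace.expSeries_div_hasSum_exp (u * (Real.exp (-x) : ℂ) * Complex.I)
    rw [← Complex.exp_eq_exp_ℂ] at h3
    rw [← h3.tsum_eq]
    refine tsum_congr fun n => ?_
    simp only [hF]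
    have : Real.exp (-((n : ℝ) * x)) = Real.exp (-x) ^ n := by
      rw [← Real.exp_nat_mul]; congr 1; ring
    rw [this]
    push_cast
    ring
  simp_rw [h2] at h1
  rw [← h1.tsum_eq]
  refine tsum_congr fun n => ?_
  simp only [hF]
  rw [integral_const_mul, integral_complex_ofReal, integral_eq_lintegral_of_nonneg_ae
    (ae_of_all _ fun _ => Real.exp_nonneg _) (by fun_prop)]

/-- Finite measures on `[0, ∞)` with the same Laplace transform are equal. -/
theorem measure_ext_of_laplace {μ ν : Measure ℝ} [IsFiniteMeasure μ] [IsFiniteMeasure ν]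
    (hμ : ∀ᵐ x ∂μ, 0 ≤ x) (hν : ∀ᵐ x ∂ν, 0 ≤ x)
    (h : ∀ s : ℝ, 0 < s → ∫⁻ x, ENNReal.ofReal (Real.exp (-(s * x))) ∂μ =
      ∫⁻ x, ENNReal.ofReal (Real.exp (-(s * x))) ∂ν) : μ = ν := by
  have hmass : μ Set.univ = ν Set.univ := by
    refine tendsto_nhds_unique (tendsto_lintegral_exp_inv_nat μ hμ) ?_
    refine (tendsto_lintegral_exp_inv_nat ν hν).congr fun n => (h _ (by positivity)).symm
  have hmap : μ.map (fun x => Real.exp (-x)) = ν.map fun x => Real.exp (-x) := by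
    refine Measure.ext_of_charFun (funext fun u => ?_)
    rw [charFun_map_exp_neg μ hμ, charFun_map_exp_neg ν hν]
    refine tsum_congr fun n => ?_
    rcases Nat.eq_zero_or_pos n with rfl | hn
    · simp [hmass]
    · rw [h n (by exact_mod_cast hn)]
  have hinv : ∀ ρ : Measure ℝ, (ρ.map fun x => Real.exp (-x)).map (fun y => -Real.log y) = ρ := by
    intro ρ
    rw [Measure.map_map (by fun_prop) (by fun_prop)]
    convert Measure.map_id using 2
    ext x
    simp
  rw [← hinv μ, hmap, hinv ν]

/-! ### Law of the first passage time of a birth-death process -/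

lemma IsJumpPath.iInf_eq_iInf_jumpTime {S : Type*} {h : ℕ → ℝ≥0∞} {y : ℕ → S} {z : ℝ≥0 → S}
    (hp : IsJumpPath h y z) (x : S) :
    ⨅ (t : ℝ≥0) (_ : z t = x), (t : ℝ≥0∞) =
      ⨅ (n : ℕ) (_ : y n = x), ∑ k ∈ Finset.range n, h k := by
  apply le_antisymm
  · refine le_iInf₂ fun n hn => ?_
    by_cases htop : ∑ k ∈ Finset.range n, h k = ∞
    · simp [htop]
    · lift ∑ k ∈ Finset.range n, h k to ℝ≥0 using htop with T hT
      exact iInf₂_le T ((hp.apply_jumpTime hT).trans hn)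
  · refine le_iInf₂ fun t ht => ?_
    obtain ⟨n, h1, h2⟩ := hp.exists_interval t
    exact (iInf₂_le n ((hp.eq n t h1 h2).symm.trans ht)).trans h1

/-- The infimum over uncountably many times equals almost surely an infimum over the jump times,
which is measurable. -/
lemma aemeasurable_firstPassage {S : Type*} [MeasurableSpace S] {Ω : Type*} [MeasurableSpace Ω]
    [Countable S] [MeasurableSingletonClass S] {P : Measure Ω} [IsProbabilityMeasure P]
    {r : S → S → ℝ≥0} {Z : ℝ≥0 → Ω → S} (hZ : IsMarkovJumpProcess P r Z)
    (hr : ∀ x, Summable (r x)) (y₀ : S) : AEMeasurable (firstPassage Z y₀) P := by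
  classical
  obtain ⟨Y, H, hJ, hpath⟩ := hZ.exists_isJumpChain hr
  refine ⟨fun ω => ⨅ n, if Y n ω = y₀ then ∑ k ∈ Finset.range n, H k ω else ∞, ?_, ?_⟩
  · refine Measurable.iInf fun n => Measurable.ite
      (hJ.measurable_state n (measurableSet_singleton _)) ?_ measurable_const
    exact Finset.measurable_sum _ fun k _ => hJ.measurable_holding k
  · filter_upwards [hpath] with ω hω
    rw [firstPassage, hω.iInf_eq_iInf_jumpTime]
    refine iInf_congr fun n => ?_
    by_cases h : Y n ω = y₀ <;> simp [h]

section Law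

variable {b d : ℕ → ℝ≥0}

lemma hasSum_birthDeathRate (k : ℕ) (g : ℕ → ℝ≥0∞) :
    ∑' l, (birthDeathRate b d (k + 1) l : ℝ≥0∞) * g l =
      b (k + 1) * g (k + 2) + d (k + 1) * g k := by
  rw [tsum_eq_sum (s := {k + 2, k})]
  · rw [Finset.sum_pair (by omega)]
    simp [birthDeathRate, show k ≠ k + 1 + 1 by omega]
  · intro l hl
    simp only [Finset.mem_insert, Finset.mem_singleton, not_or] at hl
    simp [birthDeathRate, hl.1, hl.2]

lemma summable_birthDeathRate (k : ℕ) : Summable (birthDeathRate b d k) := by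
  refine summable_of_ne_finset_zero (s := {k + 1, k - 1}) fun l hl => ?_
  simp only [Finset.mem_insert, Finset.mem_singleton, not_or] at hl
  have h2 : l + 1 ≠ k := by omega
  simp [birthDeathRate, hl.1, h2]

lemma totalRate_birthDeathRate (k : ℕ) :
    totalRate (birthDeathRate b d) (k + 1) = b (k + 1) + d (k + 1) := by
  have h := hasSum_birthDeathRate (b := b) (d := d) k (fun _ => 1)
  simp only [mul_one] at h
  rw [← ENNReal.coe_tsum (summable_birthDeathRate _)] at h
  exact_mod_cast h

variable {Ω : Type*} [MeasurableSpace Ω] {P : Measure Ω} [IsProbabilityMeasure P]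
  {Z : ℝ≥0 → Ω → ℕ} {q : ℕ}

/-- For s > 0 the function `lap` is bounded by 1, equals 1 at the target and solves the resolvent
equation, so the discounted exit law applies to it. -/
lemma lintegral_discount_firstPassage_birthDeath (hb : ∀ k, 0 < b k)
    (hZ : IsMarkovJumpProcess P (birthDeathRate b d) Z) (hq : 1 ≤ q)
    (hZ0 : ∀ᵐ ω ∂P, Z 0 ω = q) {s : ℝ≥0} (hs : 0 < s) :
    ∫⁻ ω, discount s (firstPassage Z 0 ω) ∂P = lap b d q s := by
  refine lintegral_discount_firstPassage hZ summable_birthDeathRate (by omega) hZ0 hs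
    (g := fun a => lap b d a s) (fun a => lap_le_one hb s.2 a) (lap_zero b d s) fun k hk => ?_
  obtain ⟨a, rfl⟩ := Nat.exists_eq_succ_of_ne_zero hk
  have hpos : 0 < bdRate b d (a + 1) + s := add_pos (bdRate_pos hb _) hs
  rw [Nat.succ_eq_add_one, totalRate_birthDeathRate, hasSum_birthDeathRate, lap_succ,
    kernelLaplace_of_pos hpos, ← mul_assoc]
  have : ((b (a + 1) + d (a + 1) + s : ℝ≥0) : ℝ≥0∞) *
      ENNReal.ofReal (1 / (bdRate b d (a + 1) + s)) = 1 := by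
    rw [← ENNReal.ofReal_coe_nnreal, ← ENNReal.ofReal_mul (NNReal.coe_nonneg _)]
    push_cast
    rw [show (b (a + 1) : ℝ) + d (a + 1) + s = bdRate b d (a + 1) + s from rfl,
      mul_one_div_cancel hpos.ne', ENNReal.ofReal_one]
  rw [this, one_mul]

/-- The law of the first passage time of a birth-death process on its set of finiteness. -/
theorem map_firstPassage_birthDeath (hb : ∀ k, 0 < b k)
    (hZ : IsMarkovJumpProcess P (birthDeathRate b d) Z) (hq : 1 ≤ q)
    (hZ0 : ∀ᵐ ω ∂P, Z 0 ω = q) :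
    ∃ σ : Ω → ℝ≥0∞, Measurable σ ∧ firstPassage Z 0 =ᵐ[P] σ ∧
      (P.restrict {ω | σ ω ≠ ∞}).map (fun ω => (σ ω).toReal) =
        (volume.restrict (Set.Ioi 0)).withDensity fun t => ENNReal.ofReal (passPdf b d q t) := by
  have hae := aemeasurable_firstPassage hZ summable_birthDeathRate 0
  set σ := hae.mk with hσ
  have hm : Measurable σ := hae.measurable_mk
  refine ⟨σ, hm, hae.ae_eq_mk, ?_⟩
  have hcont := continuous_passPdf (d := d) hb q
  have hset : MeasurableSet {ω | σ ω ≠ ∞} := (hm (measurableSet_singleton ∞)).compl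
  have hfin : IsFiniteMeasure
      ((volume.restrict (Set.Ioi (0 : ℝ))).withDensity fun t => ENNReal.ofReal (passPdf b d q t)) := by
    refine isFiniteMeasure_withDensity ?_
    have h1 := lap_eq_setLIntegral (d := d) hb q (by omega) 0
    simp only [zero_mul, neg_zero, Real.exp_zero, one_mul] at h1
    rw [← h1]
    exact ne_top_of_le_ne_top ENNReal.one_ne_top (lap_le_one hb le_rfl q)
  refine measure_ext_of_laplace ?_ ?_ fun s hs => ?_
  · rw [ae_map_iff (by fun_prop) measurableSet_Ici]
    exact ae_of_all _ fun ω => ENNReal.toReal_nonneg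
  · refine (withDensity_absolutelyContinuous _ _).ae_le ?_
    filter_upwards [ae_restrict_mem measurableSet_Ioi] with x hx using le_of_lt hx
  · rw [lintegral_map (by fun_prop) (by fun_prop),
      lintegral_withDensity_eq_lintegral_mul _ (by fun_prop) (by fun_prop)]
    have h1 : ∫⁻ t in Set.Ioi (0 : ℝ), ((fun t => ENNReal.ofReal (passPdf b d q t)) *
        fun t => ENNReal.ofReal (Real.exp (-(s * t)))) t = lap b d q s := by
      rw [lap_eq_setLIntegral hb q (by omega)]
      refine lintegral_congr fun t => ?_
      rw [ENNReal.ofReal_mul (Real.exp_nonneg _), Pi.mul_apply, mul_comm]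
    have h2 := lintegral_discount_firstPassage_birthDeath hb hZ hq hZ0
      (s := s.toNNReal) (by simpa using hs)
    rw [Real.coe_toNNReal s hs.le, lintegral_congr_ae
      (g := fun ω => discount s (σ ω)) (by
        filter_upwards [hae.ae_eq_mk] with ω hω using by rw [hω])] at h2
    rw [h1, ← h2, ← lintegral_indicator hset]
    refine lintegral_congr fun ω => ?_
    by_cases h : σ ω = ∞
    · rw [Set.indicator_of_notMem (by simpa using h), h, discount_top]
    · rw [Set.indicator_of_mem (by simpa using h), discount_of_ne_top s h]

end Law

/-! ### First passage times competing with exponential clocks -/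

section Clock

variable (b d : ℕ → ℝ≥0) (Λ : ℝ≥0)

/-- Distribution function of the first passage time from `a` to `0`. -/
def passCdf (a : ℕ) (t : ℝ) : ℝ := if a = 0 then 1 else ∫ w in (0 : ℝ)..t, passPdf b d a w

/-- Survival function of the minimum of the first passage time from `a` to `0` and an independent
exponential time of rate `Λ`. -/
def surv (a : ℕ) (t : ℝ) : ℝ := Real.exp (-(Λ * t)) * (1 - passCdf b d a t)

/-- Density of the minimum of the first passage time from `a` to `0` and an independent exponential
time of rate `Λ`. -/
def survPdf (a : ℕ) (t : ℝ) : ℝ :=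
  Real.exp (-(Λ * t)) * (passPdf b d a t + Λ * (1 - passCdf b d a t))

lemma passCdf_zero_state (t : ℝ) : passCdf b d 0 t = 1 := rfl

lemma passCdf_succ_zero (a : ℕ) : passCdf b d (a + 1) 0 = 0 := by simp [passCdf]

lemma surv_zero_state (t : ℝ) : surv b d Λ 0 t = 0 := by simp [surv, passCdf_zero_state]

lemma surv_succ_zero (a : ℕ) : surv b d Λ (a + 1) 0 = 1 := by simp [surv, passCdf_succ_zero]

lemma survPdf_zero_state (t : ℝ) : survPdf b d Λ 0 t = 0 := by
  simp [survPdf, passCdf_zero_state, passPdf_zero_state]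

lemma survPdf_succ_zero (a : ℕ) :
    survPdf b d Λ (a + 1) 0 = (if a = 0 then (d 1 : ℝ) else 0) + Λ := by
  simp [survPdf, passCdf_succ_zero, passPdf_apply_zero]

variable {b d} (hb : ∀ k, 0 < b k)

include hb

lemma hasDerivAt_passCdf (a : ℕ) (t : ℝ) : HasDerivAt (passCdf b d a) (passPdf b d a t) t := by
  by_cases ha : a = 0
  · subst ha
    exact hasDerivAt_const t 1
  · have h1 : passCdf b d a = fun t => ∫ w in (0 : ℝ)..t, passPdf b d a w := by
      ext t; simp [passCdf, ha]
    rw [h1]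
    have hc := continuous_passPdf (d := d) hb a
    exact intervalIntegral.integral_hasDerivAt_right (hc.intervalIntegrable _ _)
      hc.stronglyMeasurable.stronglyMeasurableAtFilter hc.continuousAt

lemma continuous_passCdf (a : ℕ) : Continuous (passCdf b d a) :=
  continuous_iff_continuousAt.2 fun t => (hasDerivAt_passCdf hb a t).continuousAt

lemma integrableOn_passPdf (a : ℕ) : IntegrableOn (passPdf b d a) (Set.Ioi 0) := by
  have := integrableOn_exp_mul_passPdf hb (s := 0) (a := a) (ne_top_of_le_ne_top
    ENNReal.one_ne_top (lap_le_one (d := d) hb (by simp) a))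
  simp only [neg_zero, zero_mul, Complex.exp_zero, one_mul] at this
  have h := this.re
  simp only [RCLike.re_eq_complex_re, Complex.ofReal_re] at h
  exact h

lemma integral_passPdf_le_one (a : ℕ) : ∫ t in Set.Ioi 0, passPdf b d a t ≤ 1 := by
  by_cases ha : a = 0
  · simp [ha, passPdf_zero_state]
  have h1 := lap_le_one (d := d) hb le_rfl a
  rw [lap_eq_setLIntegral hb a ha] at h1
  simp only [zero_mul, neg_zero, Real.exp_zero, one_mul] at h1
  rw [integral_eq_lintegral_of_nonneg_ae]
  · exact ENNReal.toReal_le_of_le_ofReal zero_le_one (by simpa using h1)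
  · filter_upwards [ae_restrict_mem measurableSet_Ioi] with t ht
    exact passPdf_nonneg hb a (le_of_lt ht)
  · exact (integrableOn_passPdf hb a).aestronglyMeasurable

lemma passCdf_nonneg (a : ℕ) {t : ℝ} (ht : 0 ≤ t) : 0 ≤ passCdf b d a t := by
  unfold passCdf
  split_ifs
  · exact zero_le_one
  · exact intervalIntegral.integral_nonneg ht fun w hw => passPdf_nonneg hb a hw.1

lemma passCdf_le_one (a : ℕ) {t : ℝ} (ht : 0 ≤ t) : passCdf b d a t ≤ 1 := by
  unfold passCdf
  split_ifs
  · exact le_rfl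
  · rw [intervalIntegral.integral_of_le ht]
    refine le_trans (setIntegral_mono_set (integrableOn_passPdf hb a) ?_
      (Set.Ioc_subset_Ioi_self).eventuallyLE) (integral_passPdf_le_one hb a)
    filter_upwards [ae_restrict_mem measurableSet_Ioi] with t ht
    exact passPdf_nonneg hb a (le_of_lt ht)

/-- The backward equation integrated in time: both sides have the same derivative on (0, t) and
agree at 0, where the convention `passCdf 0 = 1` supplies d_1. -/
lemma passPdf_eq_passCdf (a : ℕ) {t : ℝ} (ht : 0 ≤ t) :
    passPdf b d (a + 1) t = -bdRate b d (a + 1) * passCdf b d (a + 1) t +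
      b (a + 1) * passCdf b d (a + 2) t + d (a + 1) * passCdf b d a t := by
  set D : ℝ → ℝ := fun t => passPdf b d (a + 1) t - (-bdRate b d (a + 1) * passCdf b d (a + 1) t +
      b (a + 1) * passCdf b d (a + 2) t + d (a + 1) * passCdf b d a t) with hD
  have hcont : Continuous D := by
    have h1 := continuous_passPdf (d := d) hb (a + 1)
    have h2 := fun a => continuous_passCdf (d := d) hb a
    fun_prop
  have hderiv : ∀ x ∈ Set.Ioo 0 t, HasDerivAt D 0 x := by
    intro x hx
    refine ((hasDerivAt_passPdf hb a hx.1).sub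
      ((((hasDerivAt_passCdf hb (a + 1) x).const_mul _).add
      ((hasDerivAt_passCdf hb (a + 2) x).const_mul _)).add
      ((hasDerivAt_passCdf hb a x).const_mul _))).congr_deriv ?_
    ring
  have h := intervalIntegral.integral_eq_sub_of_hasDerivAt_of_le ht hcont.continuousOn hderiv
    (by simp)
  have h0 : D 0 = 0 := by
    simp only [hD, passPdf_apply_zero, passCdf_succ_zero]
    cases a with
    | zero => simp [passCdf_zero_state]
    | succ a => simp [passCdf_succ_zero]
  rw [intervalIntegral.integral_zero, h0, sub_zero] at h
  exact sub_eq_zero.1 h.symm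

lemma hasDerivAt_surv (a : ℕ) (t : ℝ) : HasDerivAt (surv b d Λ a) (-survPdf b d Λ a t) t := by
  have hexp : HasDerivAt (fun t => Real.exp (-((Λ : ℝ) * t))) (Real.exp (-(Λ * t)) * (-(Λ * 1))) t :=
    ((hasDerivAt_id t).const_mul (Λ : ℝ)).neg.exp
  refine (hexp.mul ((hasDerivAt_passCdf hb a t).const_sub 1)).congr_deriv ?_
  unfold survPdf
  ring

lemma continuous_surv (a : ℕ) : Continuous (surv b d Λ a) :=
  continuous_iff_continuousAt.2 fun t => (hasDerivAt_surv Λ hb a t).continuousAt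

lemma continuous_survPdf (a : ℕ) : Continuous (survPdf b d Λ a) := by
  have h1 := continuous_passPdf (d := d) hb a
  have h2 := continuous_passCdf (d := d) hb a
  unfold survPdf
  fun_prop

/-- The backward equation for the survival function, with extra killing at rate Λ. The race needs it
to express the derivative of `surv` through `surv` at neighbouring states. -/
lemma survPdf_eq_surv (a : ℕ) {t : ℝ} (ht : 0 ≤ t) :
    survPdf b d Λ (a + 1) t = (bdRate b d (a + 1) + Λ) * surv b d Λ (a + 1) t -
      b (a + 1) * surv b d Λ (a + 2) t - d (a + 1) * surv b d Λ a t := by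
  unfold survPdf surv
  rw [passPdf_eq_passCdf hb a ht, bdRate]
  ring

lemma hasDerivAt_survPdf (a : ℕ) {t : ℝ} (ht : 0 < t) :
    HasDerivAt (survPdf b d Λ (a + 1)) (-(bdRate b d (a + 1) + Λ) * survPdf b d Λ (a + 1) t +
      b (a + 1) * survPdf b d Λ (a + 2) t + d (a + 1) * survPdf b d Λ a t) t := by
  have h1 : survPdf b d Λ (a + 1) =ᶠ[𝓝 t] fun t =>
      (bdRate b d (a + 1) + Λ) * surv b d Λ (a + 1) t -
      b (a + 1) * surv b d Λ (a + 2) t - d (a + 1) * surv b d Λ a t := by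
    filter_upwards [lt_mem_nhds ht] with x hx
    exact survPdf_eq_surv Λ hb a hx.le
  refine HasDerivAt.congr_of_eventuallyEq ?_ h1
  refine ((((hasDerivAt_surv Λ hb (a + 1) t).const_mul _).sub
    ((hasDerivAt_surv Λ hb (a + 2) t).const_mul _)).sub
    ((hasDerivAt_surv Λ hb a t).const_mul _)).congr_deriv ?_
  ring

lemma surv_nonneg (a : ℕ) {t : ℝ} (ht : 0 ≤ t) : 0 ≤ surv b d Λ a t :=
  mul_nonneg (Real.exp_nonneg _) (sub_nonneg.2 (passCdf_le_one hb a ht))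

lemma surv_le_one (a : ℕ) {t : ℝ} (ht : 0 ≤ t) : surv b d Λ a t ≤ 1 := by
  refine mul_le_one₀ ?_ (sub_nonneg.2 (passCdf_le_one hb a ht)) ?_
  · rw [Real.exp_le_one_iff]
    have : 0 ≤ (Λ : ℝ) * t := by positivity
    linarith
  · have := passCdf_nonneg (d := d) hb a ht
    linarith

lemma survPdf_nonneg (a : ℕ) {t : ℝ} (ht : 0 ≤ t) : 0 ≤ survPdf b d Λ a t :=
  mul_nonneg (Real.exp_nonneg _) (add_nonneg (passPdf_nonneg hb a ht)
    (mul_nonneg Λ.2 (sub_nonneg.2 (passCdf_le_one hb a ht))))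

lemma integrableOn_survPdf (a : ℕ) : IntegrableOn (survPdf b d Λ a) (Set.Ioi 0) := by
  have hbound : IntegrableOn (fun t : ℝ => passPdf b d a t + Λ * Real.exp (-(Λ * t)))
      (Set.Ioi 0) := by
    refine (integrableOn_passPdf hb a).add ?_
    -- For Λ = 0 the clock term vanishes; only for Λ > 0 is its exponential integrable.
    rcases eq_or_ne Λ 0 with rfl | hΛ
    · simp
    · have : (0 : ℝ) < Λ := by positivity
      have := integrableOn_exp_mul_Ioi (a := -(Λ : ℝ)) (by linarith) 0
      simp only [neg_mul] at this
      exact this.const_mul _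
  refine hbound.mono' (continuous_survPdf Λ hb a).aestronglyMeasurable ?_
  filter_upwards [ae_restrict_mem measurableSet_Ioi] with t ht
  have ht' : 0 ≤ t := le_of_lt ht
  rw [Real.norm_of_nonneg (survPdf_nonneg Λ hb a ht')]
  have h1 : Real.exp (-((Λ : ℝ) * t)) ≤ 1 := by
    rw [Real.exp_le_one_iff]
    have : 0 ≤ (Λ : ℝ) * t := by positivity
    linarith
  have h2 := passPdf_nonneg (d := d) hb a ht'
  have h3 := passCdf_nonneg (d := d) hb a ht'
  have h4 := Real.exp_nonneg (-((Λ : ℝ) * t))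
  have h5 := mul_le_mul_of_nonneg_right h1 h2
  have h6 : 0 ≤ Real.exp (-((Λ : ℝ) * t)) * Λ * passCdf b d a t := by positivity
  unfold survPdf
  linarith

lemma integral_survPdf_le_one (a : ℕ) : ∫ t in Set.Ioi 0, survPdf b d Λ a t ≤ 1 := by
  have h1 := intervalIntegral_tendsto_integral_Ioi 0 (integrableOn_survPdf (d := d) Λ hb a)
    tendsto_id
  refine le_of_tendsto h1 ?_
  filter_upwards [eventually_ge_atTop 0] with T hT
  have h2 : ∫ t in (0 : ℝ)..T, -survPdf b d Λ a t = surv b d Λ a T - surv b d Λ a 0 :=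
    intervalIntegral.integral_eq_sub_of_hasDerivAt (fun t _ => hasDerivAt_surv Λ hb a t)
      ((continuous_survPdf Λ hb a).neg.intervalIntegrable _ _)
  rw [intervalIntegral.integral_neg] at h2
  have h3 := surv_nonneg (d := d) Λ hb a hT
  have h4 := surv_le_one (d := d) Λ hb a le_rfl
  simp only [id]
  linarith

end Clock

/-! ### The race between the two sides -/

section Race

variable (b₁ d₁ b₂ d₂ : ℕ → ℝ≥0) (Λ : ℝ≥0)

/-- Discounted probability that the first of two competing times (with initial states `a` and `c`)
comes first. -/
def raceProb (s : ℝ) (a c : ℕ) : ℝ :=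
  if a = 0 then 1 else
    ∫ t in Set.Ioi (0 : ℝ), Real.exp (-(s * t)) * (survPdf b₁ d₁ Λ a t * surv b₂ d₂ Λ c t)

lemma raceProb_zero_left (s : ℝ) (c : ℕ) : raceProb b₁ d₁ b₂ d₂ Λ s 0 c = 1 := rfl

lemma raceProb_zero_right (s : ℝ) (a : ℕ) : raceProb b₁ d₁ b₂ d₂ Λ s (a + 1) 0 = 0 := by
  simp [raceProb, surv_zero_state]

variable {b₁ d₁ b₂ d₂} (hb₁ : ∀ k, 0 < b₁ k) (hb₂ : ∀ k, 0 < b₂ k)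

include hb₁ hb₂

lemma norm_race_integrand_le {s : ℝ} (hs : 0 ≤ s) (a c : ℕ) {t : ℝ} (ht : 0 ≤ t) :
    ‖Real.exp (-(s * t)) * (survPdf b₁ d₁ Λ a t * surv b₂ d₂ Λ c t)‖ ≤ survPdf b₁ d₁ Λ a t := by
  have h1 := survPdf_nonneg (d := d₁) Λ hb₁ a ht
  have h2 := surv_nonneg (d := d₂) Λ hb₂ c ht
  have h3 := surv_le_one (d := d₂) Λ hb₂ c ht
  have h4 : Real.exp (-(s * t)) ≤ 1 := by
    rw [Real.exp_le_one_iff]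
    have : 0 ≤ s * t := by positivity
    linarith
  rw [Real.norm_of_nonneg (by positivity)]
  calc _ ≤ 1 * (survPdf b₁ d₁ Λ a t * 1) := by gcongr
    _ = _ := by ring

lemma integrableOn_race {s : ℝ} (hs : 0 ≤ s) (a c : ℕ) :
    IntegrableOn (fun t => Real.exp (-(s * t)) * (survPdf b₁ d₁ Λ a t * surv b₂ d₂ Λ c t))
      (Set.Ioi 0) := by
  have h1 := continuous_survPdf (d := d₁) Λ hb₁ a
  have h2 := continuous_surv (d := d₂) Λ hb₂ c
  refine (integrableOn_survPdf (d := d₁) Λ hb₁ a).mono'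
    (Continuous.aestronglyMeasurable (by fun_prop)) ?_
  filter_upwards [ae_restrict_mem measurableSet_Ioi] with t ht
  exact norm_race_integrand_le Λ hb₁ hb₂ hs a c (le_of_lt ht)

lemma raceProb_nonneg (s : ℝ) (a c : ℕ) : 0 ≤ raceProb b₁ d₁ b₂ d₂ Λ s a c := by
  unfold raceProb
  split_ifs
  · exact zero_le_one
  · refine setIntegral_nonneg measurableSet_Ioi fun t ht => ?_
    have h1 := survPdf_nonneg (d := d₁) Λ hb₁ a (le_of_lt ht)
    have h2 := surv_nonneg (d := d₂) Λ hb₂ c (le_of_lt ht)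
    positivity

lemma raceProb_le_one {s : ℝ} (hs : 0 ≤ s) (a c : ℕ) : raceProb b₁ d₁ b₂ d₂ Λ s a c ≤ 1 := by
  unfold raceProb
  split_ifs
  · exact le_rfl
  · refine le_trans (setIntegral_mono_on (integrableOn_race Λ hb₁ hb₂ hs a c)
      (integrableOn_survPdf Λ hb₁ a) measurableSet_Ioi fun t ht => ?_)
      (integral_survPdf_le_one (d := d₁) Λ hb₁ a)
    exact (Real.le_norm_self _).trans (norm_race_integrand_le Λ hb₁ hb₂ hs a c (le_of_lt ht))

/-- The resolvent equation of the race. -/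
lemma raceProb_succ {s : ℝ} (hs : 0 ≤ s) (a c : ℕ) :
    (s + bdRate b₁ d₁ (a + 1) + bdRate b₂ d₂ (c + 1) + 2 * Λ) *
        raceProb b₁ d₁ b₂ d₂ Λ s (a + 1) (c + 1) =
      b₁ (a + 1) * raceProb b₁ d₁ b₂ d₂ Λ s (a + 2) (c + 1) +
      d₁ (a + 1) * raceProb b₁ d₁ b₂ d₂ Λ s a (c + 1) +
      b₂ (c + 1) * raceProb b₁ d₁ b₂ d₂ Λ s (a + 1) (c + 2) +
      d₂ (c + 1) * raceProb b₁ d₁ b₂ d₂ Λ s (a + 1) c + Λ := by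
  set J : ℕ → ℕ → ℝ → ℝ := fun a c t =>
    Real.exp (-(s * t)) * (survPdf b₁ d₁ Λ a t * surv b₂ d₂ Λ c t) with hJ
  have hI : ∀ a c, IntegrableOn (J a c) (Set.Ioi 0) := fun a c => integrableOn_race Λ hb₁ hb₂ hs a c
  set q₁ := bdRate b₁ d₁ (a + 1) with hq₁
  set q₂ := bdRate b₂ d₂ (c + 1) with hq₂
  set f' : ℝ → ℝ := fun t => -(s + q₁ + q₂ + 2 * Λ) * J (a + 1) (c + 1) t +
    b₁ (a + 1) * J (a + 2) (c + 1) t + d₁ (a + 1) * J a (c + 1) t +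
    b₂ (c + 1) * J (a + 1) (c + 2) t + d₂ (c + 1) * J (a + 1) c t with hf'
  -- The derivative is closed on the products J: one factor is differentiated by the equation for
  -- densities, the other by the equation for survival functions. The exponents s, q₁ + Λ and q₂ + Λ
  -- add up.
  have hderiv : ∀ t, 0 < t → HasDerivAt (J (a + 1) (c + 1)) (f' t) t := by
    intro t ht
    have hexp : HasDerivAt (fun t => Real.exp (-(s * t))) (Real.exp (-(s * t)) * (-(s * 1))) t :=
      ((hasDerivAt_id t).const_mul s).neg.exp
    refine (hexp.mul ((hasDerivAt_survPdf Λ hb₁ a ht).mul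
      (hasDerivAt_surv Λ hb₂ (c + 1) t))).congr_deriv ?_
    rw [survPdf_eq_surv (b := b₂) (d := d₂) Λ hb₂ c ht.le, ← hq₁, ← hq₂]
    simp only [hf', hJ, Pi.mul_apply]
    ring
  have h1 := continuous_survPdf (d := d₁) Λ hb₁ (a + 1)
  have h2 := continuous_surv (d := d₂) Λ hb₂ (c + 1)
  have i1 := (hI (a + 1) (c + 1)).const_mul (-(s + q₁ + q₂ + 2 * Λ))
  have i2 := (hI (a + 2) (c + 1)).const_mul (b₁ (a + 1) : ℝ)
  have i3 := (hI a (c + 1)).const_mul (d₁ (a + 1) : ℝ)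
  have i4 := (hI (a + 1) (c + 2)).const_mul (b₂ (c + 1) : ℝ)
  have i5 := (hI (a + 1) c).const_mul (d₂ (c + 1) : ℝ)
  have i12 : IntegrableOn (fun t => -(s + q₁ + q₂ + 2 * Λ) * J (a + 1) (c + 1) t +
    b₁ (a + 1) * J (a + 2) (c + 1) t) (Set.Ioi 0) := i1.add i2
  have i123 : IntegrableOn (fun t => -(s + q₁ + q₂ + 2 * Λ) * J (a + 1) (c + 1) t +
    b₁ (a + 1) * J (a + 2) (c + 1) t + d₁ (a + 1) * J a (c + 1) t) (Set.Ioi 0) := i12.add i3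
  have i1234 : IntegrableOn (fun t => -(s + q₁ + q₂ + 2 * Λ) * J (a + 1) (c + 1) t +
    b₁ (a + 1) * J (a + 2) (c + 1) t + d₁ (a + 1) * J a (c + 1) t +
    b₂ (c + 1) * J (a + 1) (c + 2) t) (Set.Ioi 0) := i123.add i4
  have key := integral_Ioi_zero_of_hasDerivAt (f := J (a + 1) (c + 1)) (f' := f')
    (by apply Continuous.continuousWithinAt; fun_prop) hderiv (hI _ _) (i1234.add i5)
  simp only [hf'] at key
  rw [integral_add i1234 i5, integral_add i123 i4, integral_add i12 i3, integral_add i1 i2,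
    integral_const_mul, integral_const_mul, integral_const_mul, integral_const_mul,
    integral_const_mul] at key
  -- The boundary term supplies the inhomogeneity Λ and, from state 1, the rate d₁ 1, which is the
  -- death term because the race counts as won at 0.
  have h0 : J (a + 1) (c + 1) 0 = (if a = 0 then (d₁ 1 : ℝ) else 0) + Λ := by
    simp [hJ, survPdf_succ_zero, surv_succ_zero]
  have hR : ∀ a c, raceProb b₁ d₁ b₂ d₂ Λ s (a + 1) c = ∫ t in Set.Ioi 0, J (a + 1) c t := by
    intro a c; simp [raceProb, hJ]
  rw [h0] at key
  simp only [hR]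
  cases a with
  | zero =>
    have : ∫ t in Set.Ioi 0, J 0 (c + 1) t = 0 := by simp [hJ, survPdf_zero_state]
    rw [this] at key
    rw [raceProb_zero_left]
    simp only [if_true, zero_add] at key ⊢
    linear_combination -key
  | succ a =>
    rw [hR]
    simp only [Nat.add_eq_zero_iff, one_ne_zero, and_false, if_false] at key
    linear_combination -key

/-- Dominated convergence with the density itself as majorant. -/
lemma tendsto_raceProb (a c : ℕ) :
    Tendsto (fun m : ℕ => raceProb b₁ d₁ b₂ d₂ Λ (1 / ((m : ℝ) + 1)) (a + 1) c) atTop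
      (𝓝 (∫ t in Set.Ioi (0 : ℝ), survPdf b₁ d₁ Λ (a + 1) t * surv b₂ d₂ Λ c t)) := by
  simp only [raceProb, Nat.add_eq_zero_iff, one_ne_zero, and_false, if_false]
  refine tendsto_integral_of_dominated_convergence (survPdf b₁ d₁ Λ (a + 1))
    (fun m => (integrableOn_race Λ hb₁ hb₂ (by positivity) _ _).aestronglyMeasurable)
    (integrableOn_survPdf Λ hb₁ _) (fun m => ?_) (ae_of_all _ fun t => ?_)
  · filter_upwards [ae_restrict_mem measurableSet_Ioi] with t ht
    exact norm_race_integrand_le Λ hb₁ hb₂ (by positivity) _ c (le_of_lt ht)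
  · have h1 : Tendsto (fun n : ℕ => Real.exp (-(1 / ((n : ℝ) + 1) * t))) atTop
        (𝓝 (Real.exp (-(0 * t)))) :=
      (Real.continuous_exp.tendsto _).comp
        (tendsto_one_div_add_atTop_nhds_zero_nat.mul_const _).neg
    simpa using h1.mul_const (survPdf b₁ d₁ Λ (a + 1) t * surv b₂ d₂ Λ c t)

end Race

/-! ### The Bromwich integral -/

section Bromwich

open FourierTransform

variable {A α α' : ℝ → ℝ} {γ : ℝ}

lemma integrableOn_cexp_mul {s : ℂ} (hs : 0 ≤ s.re) {φ : ℝ → ℝ} (hφ : IntegrableOn φ (Set.Ioi 0)) :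
    IntegrableOn (fun t : ℝ => Complex.exp (-s * t) * (φ t : ℂ)) (Set.Ioi 0) := by
  refine hφ.norm.mono' ((Continuous.aestronglyMeasurable (by fun_prop)).mul
    hφ.ofReal.aestronglyMeasurable) ?_
  filter_upwards [ae_restrict_mem measurableSet_Ioi] with t ht
  rw [norm_mul, norm_cexp_neg_mul, Complex.norm_real]
  refine mul_le_of_le_one_left (norm_nonneg _) ?_
  rw [Real.exp_le_one_iff]
  have := mul_nonneg hs (le_of_lt (Set.mem_Ioi.1 ht))
  linarith

/-- Laplace transform of a distribution function. -/
lemma integral_cexp_mul_one_sub (hA : ∀ t, HasDerivAt A (-α t) t) (hA0 : A 0 = 1)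
    (hA1 : ∀ t, 0 ≤ t → 0 ≤ A t ∧ A t ≤ 1) (hα : IntegrableOn α (Set.Ioi 0)) {s : ℂ}
    (hs : 0 < s.re) :
    ∫ t in Set.Ioi (0 : ℝ), Complex.exp (-s * t) * (1 - A t : ℂ) =
      1 / s * ∫ t in Set.Ioi (0 : ℝ), Complex.exp (-s * t) * (α t : ℂ) := by
  have hAc : Continuous A := continuous_iff_continuousAt.2 fun t => (hA t).continuousAt
  have hs0 : s ≠ 0 := fun h => by simp [h] at hs
  have hI1 : IntegrableOn (fun t : ℝ => Complex.exp (-s * t) * (1 - A t : ℂ)) (Set.Ioi 0) := by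
    have hexp := integrableOn_exp_mul_complex_Ioi (a := -s) (by simpa using hs) 0
    refine hexp.norm.mono' (Continuous.aestronglyMeasurable (by fun_prop)) ?_
    filter_upwards [ae_restrict_mem measurableSet_Ioi] with t ht
    rw [norm_mul]
    refine mul_le_of_le_one_right (norm_nonneg _) ?_
    have h1 := hA1 t (le_of_lt ht)
    rw [← Complex.ofReal_one, ← Complex.ofReal_sub, Complex.norm_real,
      Real.norm_of_nonneg (by linarith)]
    linarith
  have hI2 := integrableOn_cexp_mul hs.le hα
  have hderiv : ∀ t : ℝ, 0 < t → HasDerivAt (fun t : ℝ => Complex.exp (-s * t) * (1 - A t : ℂ))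
      (-s * (Complex.exp (-s * t) * (1 - A t : ℂ)) + Complex.exp (-s * t) * (α t : ℂ)) t := by
    intro t _
    refine ((hasDerivAt_cexp_neg_mul s t).mul ((hA t).ofReal_comp.const_sub 1)).congr_deriv ?_
    push_cast
    ring
  have key := integral_Ioi_zero_of_hasDerivAt (Continuous.continuousWithinAt (by fun_prop)) hderiv
    hI1 ((hI1.const_mul (-s)).add hI2)
  rw [integral_add (hI1.const_mul (-s)) hI2, integral_const_mul] at key
  simp only [hA0, Complex.ofReal_one, sub_self, mul_zero, neg_zero] at key
  rw [one_div, eq_inv_mul_iff_mul_eq₀ hs0]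
  linear_combination -key

/-- Decay of the Laplace transform of a smooth density along vertical lines. -/
lemma norm_integral_cexp_mul_le (hαc : Continuous α) (hα : IntegrableOn α (Set.Ioi 0))
    (hα' : ∀ t, 0 < t → HasDerivAt α (α' t) t) (hα'i : IntegrableOn α' (Set.Ioi 0)) {s : ℂ}
    (hs : 0 ≤ s.re) :
    ‖s‖ * ‖∫ t in Set.Ioi (0 : ℝ), Complex.exp (-s * t) * (α t : ℂ)‖ ≤
      |α 0| + ∫ t in Set.Ioi (0 : ℝ), ‖α' t‖ := by
  have hI1 := integrableOn_cexp_mul hs hα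
  have hI2 := integrableOn_cexp_mul hs hα'i
  have hderiv : ∀ t : ℝ, 0 < t → HasDerivAt (fun t : ℝ => Complex.exp (-s * t) * (α t : ℂ))
      (-s * (Complex.exp (-s * t) * (α t : ℂ)) + Complex.exp (-s * t) * (α' t : ℂ)) t := by
    intro t ht
    refine ((hasDerivAt_cexp_neg_mul s t).mul (hα' t ht).ofReal_comp).congr_deriv ?_
    ring
  have key := integral_Ioi_zero_of_hasDerivAt (Continuous.continuousWithinAt (by fun_prop)) hderiv
    hI1 ((hI1.const_mul (-s)).add hI2)
  rw [integral_add (hI1.const_mul (-s)) hI2, integral_const_mul] at key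
  simp only [Complex.ofReal_zero, mul_zero, Complex.exp_zero, one_mul] at key
  have h1 : s * ∫ t in Set.Ioi (0 : ℝ), Complex.exp (-s * t) * (α t : ℂ) =
      (α 0 : ℂ) + ∫ t in Set.Ioi (0 : ℝ), Complex.exp (-s * t) * (α' t : ℂ) := by
    linear_combination -key
  rw [← norm_mul, h1]
  refine (norm_add_le _ _).trans (add_le_add (by simp) ?_)
  refine (norm_integral_le_integral_norm _).trans ?_
  refine setIntegral_mono_on hI2.norm hα'i.norm measurableSet_Ioi fun t ht => ?_
  rw [norm_mul, norm_cexp_neg_mul, Complex.norm_real]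
  refine mul_le_of_le_one_left (norm_nonneg _) ?_
  rw [Real.exp_le_one_iff]
  have := mul_nonneg hs (le_of_lt (Set.mem_Ioi.1 ht))
  linarith

/-- The exponentially tilted distribution function `exp (-γ x) (1 - A x)`, extended by zero. -/
def tiltedCdf (A : ℝ → ℝ) (γ : ℝ) (x : ℝ) : ℂ :=
  ((Real.exp (-(γ * x)) * (1 - A (max x 0)) : ℝ) : ℂ)

lemma tiltedCdf_of_nonpos (hA0 : A 0 = 1) {x : ℝ} (hx : x ≤ 0) : tiltedCdf A γ x = 0 := by
  simp [tiltedCdf, max_eq_right hx, hA0]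

/-- Tilting by e^{-γx} moves the Laplace transform to the line Re s = γ, with s = γ + 2πiv for the
Fourier frequency v; the factor 1/s comes from passing from a density to its distribution function.
-/
lemma fourier_tiltedCdf (hγ : 0 < γ) (hA : ∀ t, HasDerivAt A (-α t) t) (hA0 : A 0 = 1)
    (hA1 : ∀ t, 0 ≤ t → 0 ≤ A t ∧ A t ≤ 1) (hα : IntegrableOn α (Set.Ioi 0)) (v : ℝ) :
    𝓕 (tiltedCdf A γ) v = 1 / ((γ : ℂ) + (2 * Real.pi * v : ℝ) * Complex.I) *
      ∫ t in Set.Ioi (0 : ℝ),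
        Complex.exp (-((γ : ℂ) + (2 * Real.pi * v : ℝ) * Complex.I) * t) * (α t : ℂ) := by
  rw [← integral_cexp_mul_one_sub hA hA0 hA1 hα (by simpa using hγ),
    Real.fourier_real_eq_integral_exp_smul,
    ← setIntegral_eq_integral_of_forall_compl_eq_zero (s := Set.Ioi (0 : ℝ))]
  · refine setIntegral_congr_fun measurableSet_Ioi fun t ht => ?_
    simp only [tiltedCdf, max_eq_left (le_of_lt (Set.mem_Ioi.1 ht)), smul_eq_mul]
    push_cast
    rw [← mul_assoc, ← Complex.exp_add]
    congr 2
    ring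
  · intro t ht
    rw [tiltedCdf_of_nonpos hA0 (by simpa using ht), smul_zero]

lemma continuous_tiltedCdf (hAc : Continuous A) : Continuous (tiltedCdf A γ) := by
  unfold tiltedCdf
  fun_prop

lemma integrable_tiltedCdf (hγ : 0 < γ) (hAc : Continuous A) (hA0 : A 0 = 1)
    (hA1 : ∀ t, 0 ≤ t → 0 ≤ A t ∧ A t ≤ 1) : Integrable (tiltedCdf A γ) := by
  have h1 : IntegrableOn (tiltedCdf A γ) (Set.Ioi 0) := by
    have hexp := integrableOn_exp_mul_Ioi (a := -γ) (by linarith) 0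
    refine hexp.mono' (continuous_tiltedCdf hAc).aestronglyMeasurable ?_
    filter_upwards [ae_restrict_mem measurableSet_Ioi] with t ht
    have h1 := hA1 t (le_of_lt ht)
    rw [tiltedCdf, Complex.norm_real, max_eq_left (le_of_lt (Set.mem_Ioi.1 ht)),
      Real.norm_of_nonneg (mul_nonneg (Real.exp_nonneg _) (by linarith)), neg_mul]
    exact mul_le_of_le_one_right (Real.exp_nonneg _) (by linarith)
  rw [← integrableOn_univ, ← Set.Iic_union_Ioi (a := (0 : ℝ))]
  refine IntegrableOn.union ?_ h1
  exact (integrableOn_zero).congr_fun (fun t ht => (tiltedCdf_of_nonpos hA0 ht).symm)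
    measurableSet_Iic

/-- The transform decays like |s|⁻²: one factor comes from the distribution function, the other from
the integrable derivative of α. -/
lemma integrable_fourier_tiltedCdf (hγ : 0 < γ) (hA : ∀ t, HasDerivAt A (-α t) t) (hA0 : A 0 = 1)
    (hA1 : ∀ t, 0 ≤ t → 0 ≤ A t ∧ A t ≤ 1) (hαc : Continuous α) (hα : IntegrableOn α (Set.Ioi 0))
    (hα' : ∀ t, 0 < t → HasDerivAt α (α' t) t) (hα'i : IntegrableOn α' (Set.Ioi 0)) :
    Integrable (𝓕 (tiltedCdf A γ)) := by
  have hAc : Continuous A := continuous_iff_continuousAt.2 fun t => (hA t).continuousAt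
  set M : ℝ := |α 0| + ∫ t in Set.Ioi (0 : ℝ), ‖α' t‖ with hM
  -- The majorant is M/|s|² on the line s = γ + 2πiv, written as a rescaled Cauchy density.
  have hdom : Integrable fun v : ℝ => M / γ ^ 2 * (1 + (2 * Real.pi / γ * v) ^ 2)⁻¹ :=
    (integrable_inv_one_add_sq.comp_mul_left' (by positivity)).const_mul _
  have hcont : Continuous (𝓕 (tiltedCdf A γ)) :=
    VectorFourier.fourierIntegral_continuous Real.continuous_fourierChar
      (by exact continuous_inner) (integrable_tiltedCdf hγ hAc hA0 hA1)
  refine hdom.mono' hcont.aestronglyMeasurable (ae_of_all _ fun v => ?_)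
  set s : ℂ := (γ : ℂ) + (2 * Real.pi * v : ℝ) * Complex.I with hs
  have hre : s.re = γ := by simp [hs]
  have hnorm : ‖s‖ ^ 2 = γ ^ 2 + (2 * Real.pi * v) ^ 2 := by
    rw [Complex.sq_norm, Complex.normSq_apply, hre]
    simp [hs]
    ring
  have hspos : 0 < ‖s‖ := by
    rw [norm_pos_iff]
    intro h
    rw [h] at hre
    simp at hre
    linarith
  have hbound := norm_integral_cexp_mul_le hαc hα hα' hα'i (s := s) (by rw [hre]; exact hγ.le)
  rw [fourier_tiltedCdf hγ hA hA0 hA1 hα, ← hs, norm_mul, norm_div, norm_one]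
  have h2 : M / γ ^ 2 * (1 + (2 * Real.pi / γ * v) ^ 2)⁻¹ = M / ‖s‖ ^ 2 := by
    rw [hnorm]
    field_simp
  rw [h2, le_div_iff₀ (by positivity)]
  calc _ = ‖s‖ * ‖∫ t in Set.Ioi (0 : ℝ), Complex.exp (-s * t) * (α t : ℂ)‖ := by
        field_simp
    _ ≤ M := hbound

/-- Bromwich inversion at `0` of the transform of a distribution function times that of an
independent density. -/
theorem hasInverseLaplaceAt_zero (hγ : 0 < γ) (hA : ∀ t, HasDerivAt A (-α t) t) (hA0 : A 0 = 1)
    (hA1 : ∀ t, 0 ≤ t → 0 ≤ A t ∧ A t ≤ 1) (hαc : Continuous α) (hα : IntegrableOn α (Set.Ioi 0))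
    (hα' : ∀ t, 0 < t → HasDerivAt α (α' t) t) (hα'i : IntegrableOn α' (Set.Ioi 0))
    {β : ℝ → ℝ} (hβ : IntegrableOn (fun t => Real.exp (γ * t) * β t) (Set.Ioi 0)) {F : ℂ → ℂ}
    (hF : ∀ u : ℝ, u ≠ 0 → F (γ + u * Complex.I) =
      1 / (γ + u * Complex.I) *
        (∫ t in Set.Ioi (0 : ℝ), Complex.exp (-(γ + u * Complex.I) * t) * (α t : ℂ)) *
        ∫ t in Set.Ioi (0 : ℝ), Complex.exp ((γ + u * Complex.I) * t) * (β t : ℂ)) :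
    HasInverseLaplaceAt F γ 0 ((∫ t in Set.Ioi (0 : ℝ), (1 - A t) * β t : ℝ) : ℂ) := by
  have hAc : Continuous A := continuous_iff_continuousAt.2 fun t => (hA t).continuousAt
  set k : ℝ → ℂ := 𝓕 (tiltedCdf A γ) with hk
  have hki : Integrable k := integrable_fourier_tiltedCdf hγ hA hA0 hA1 hαc hα hα' hα'i
  set μ : Measure ℝ := volume.restrict (Set.Ioi 0) with hμ
  set Φ : ℝ → ℝ → ℂ := fun v t => k v *
    (Complex.exp ((2 * Real.pi * v * t : ℝ) * Complex.I) * (Real.exp (γ * t) * β t : ℝ)) with hΦ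
  have hΦi : Integrable (Function.uncurry Φ) (volume.prod μ) := by
    have h1 : Integrable (fun p : ℝ × ℝ => k p.1 * ((Real.exp (γ * p.2) * β p.2 : ℝ) : ℂ))
        (volume.prod μ) := hki.mul_prod hβ.ofReal
    have h2 : Integrable (fun p : ℝ × ℝ => Complex.exp ((2 * Real.pi * p.1 * p.2 : ℝ) * Complex.I) *
        (k p.1 * ((Real.exp (γ * p.2) * β p.2 : ℝ) : ℂ))) (volume.prod μ) := by
      refine h1.norm.mono' ((Continuous.aestronglyMeasurable (by fun_prop)).mul
        h1.aestronglyMeasurable) (ae_of_all _ fun p => ?_)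
      rw [norm_mul, Complex.norm_exp_ofReal_mul_I, one_mul]
    refine h2.congr (ae_of_all _ fun p => ?_)
    simp only [hΦ, Function.uncurry]
    ring
  have hG : (fun v => ∫ t, Φ v t ∂μ) =ᵐ[volume]
      fun v : ℝ => F (γ + ((2 * Real.pi * v : ℝ) : ℂ) * Complex.I) := by
    -- The transform is only controlled off the real axis; the missing point is negligible for the
    -- integral.
    have h0 : ∀ᵐ v : ℝ, v ≠ 0 := by
      rw [ae_iff]; simp
    filter_upwards [h0] with v hv
    rw [hF _ (by positivity)]
    simp only [hΦ]
    rw [integral_const_mul, hk, fourier_tiltedCdf hγ hA hA0 hA1 hα]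
    congr 1
    refine integral_congr_ae (ae_of_all _ fun t => ?_)
    simp only
    push_cast
    rw [← mul_assoc, ← Complex.exp_add]
    congr 2
    ring
  have hint : Integrable fun v : ℝ => F (γ + ((2 * Real.pi * v : ℝ) : ℂ) * Complex.I) :=
    hΦi.integral_prod_left.congr hG
  have hval : ∫ v : ℝ, F (γ + ((2 * Real.pi * v : ℝ) : ℂ) * Complex.I) =
      ((∫ t in Set.Ioi (0 : ℝ), (1 - A t) * β t : ℝ) : ℂ) := by
    rw [← integral_congr_ae hG, integral_integral_swap hΦi, ← integral_complex_ofReal]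
    refine setIntegral_congr_fun measurableSet_Ioi fun t ht => ?_
    -- Pointwise Fourier inversion, available because the tilted distribution function is continuous
    -- and both it and its transform are integrable.
    have hinv : ∫ v : ℝ, Complex.exp ((2 * Real.pi * v * t : ℝ) * Complex.I) * k v =
        tiltedCdf A γ t := by
      have h1 := (integrable_tiltedCdf hγ hAc hA0 hA1).fourierInv_fourier_eq hki
        (v := t) (continuous_tiltedCdf hAc).continuousAt
      rw [← h1, Real.fourierInv_eq']
      refine integral_congr_ae (ae_of_all _ fun v => ?_)
      simp only [smul_eq_mul, hk, RCLike.inner_apply, conj_trivial]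
      congr 4
      ring
    have h2 : ∫ v, Φ v t = (∫ v : ℝ, Complex.exp ((2 * Real.pi * v * t : ℝ) * Complex.I) * k v) *
        (Real.exp (γ * t) * β t : ℝ) := by
      rw [← integral_mul_const]
      refine integral_congr_ae (ae_of_all _ fun v => ?_)
      simp only [hΦ]
      ring
    rw [h2, hinv, tiltedCdf, max_eq_left (le_of_lt (Set.mem_Ioi.1 ht)), ← Complex.ofReal_mul]
    congr 1
    have he : Real.exp (-(γ * t)) * Real.exp (γ * t) = 1 := by
      rw [← Real.exp_add]; simp
    linear_combination ((1 - A t) * β t) * he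
  -- It remains to pass from the frequency v to the ordinate u = 2πv; the Jacobian is the factor
  -- 1/(2π) of the Bromwich integral.
  have hpi : (2 * Real.pi : ℝ) ≠ 0 := by positivity
  have hint' : Integrable fun u : ℝ => F (γ + (u : ℂ) * Complex.I) :=
    (integrable_comp_mul_left_iff (fun u : ℝ => F (γ + (u : ℂ) * Complex.I)) hpi).1 hint
  have hval' := Measure.integral_comp_mul_left (fun u : ℝ => F (γ + (u : ℂ) * Complex.I))
    (2 * Real.pi)
  rw [hval] at hval'
  unfold HasInverseLaplaceAt
  simp only [Complex.ofReal_zero, mul_zero, Complex.exp_zero, one_mul]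
  refine ⟨fun T => hint'.intervalIntegrable, ?_⟩
  have hlim := (intervalIntegral_tendsto_integral hint' tendsto_neg_atTop_atBot tendsto_id).const_mul
    (1 / (2 * Real.pi : ℂ))
  have hconst : |(2 * Real.pi)⁻¹| • ∫ u : ℝ, F (γ + (u : ℂ) * Complex.I) =
      1 / (2 * Real.pi : ℂ) * ∫ u : ℝ, F (γ + (u : ℂ) * Complex.I) := by
    rw [abs_of_pos (by positivity), Complex.real_smul]
    push_cast
    simp
  rw [hval', hconst]
  exact hlim

end Bromwich

/-! ### Inversion of the transform of the race -/

section Clock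

variable {b d : ℕ → ℝ≥0} (Λ : ℝ≥0) (hb : ∀ k, 0 < b k) (hd : ∀ k, 1 ≤ k → 0 < d k)

include hb

lemma integrableOn_exp_mul_one_sub_passCdf {x : ℝ} (hx : 0 < x) (a : ℕ) :
    IntegrableOn (fun t => Real.exp (-(x * t)) * (1 - passCdf b d a t)) (Set.Ioi 0) := by
  have hcdf := continuous_passCdf (d := d) hb a
  have hexp := integrableOn_exp_mul_Ioi (a := -x) (by linarith) 0
  refine hexp.mono' (Continuous.aestronglyMeasurable (by fun_prop)) ?_
  filter_upwards [ae_restrict_mem measurableSet_Ioi] with t ht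
  have h1 := passCdf_le_one (d := d) hb a (le_of_lt (Set.mem_Ioi.1 ht))
  have h2 := passCdf_nonneg (d := d) hb a (le_of_lt (Set.mem_Ioi.1 ht))
  rw [Real.norm_of_nonneg (mul_nonneg (Real.exp_nonneg _) (by linarith)), neg_mul]
  exact mul_le_of_le_one_right (Real.exp_nonneg _) (by linarith)

/-- Chernoff's bound. Total mass 1 is needed for the tail of the distribution function to be the
tail integral of the density. -/
lemma one_sub_passCdf_le {a : ℕ} (ha : 1 ≤ a) {γ : ℝ} (hγ : 0 < γ)
    (h1 : ∫ t in Set.Ioi (0 : ℝ), passPdf b d a t = 1) (h : lap b d a (-γ) ≠ ∞) {t : ℝ}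
    (ht : 0 ≤ t) :
    1 - passCdf b d a t ≤
      (∫ w in Set.Ioi (0 : ℝ), Real.exp (γ * w) * passPdf b d a w) * Real.exp (-(γ * t)) := by
  have hi : IntegrableOn (fun w => Real.exp (γ * w) * passPdf b d a w) (Set.Ioi 0) := by
    have h2 := (integrableOn_exp_mul_passPdf hb (s := ((-γ : ℝ) : ℂ)) (a := a) (by simpa using h)).re
    refine h2.congr (ae_of_all _ fun w => ?_)
    simp only [RCLike.re_eq_complex_re]
    rw [Complex.re_mul_ofReal, ← Complex.ofReal_neg, ← Complex.ofReal_mul, Complex.exp_ofReal_re,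
      neg_neg]
  have hp := integrableOn_passPdf (d := d) hb a
  have hsub : Set.Ioi t ⊆ Set.Ioi 0 := Set.Ioi_subset_Ioi ht
  have hsplit : 1 - passCdf b d a t = ∫ w in Set.Ioi t, passPdf b d a w := by
    rw [passCdf, if_neg (by omega), ← h1,
      ← intervalIntegral.integral_Ioi_sub_Ioi hp ht]
    ring
  rw [hsplit, ← integral_mul_const]
  refine le_trans ?_ (setIntegral_mono_set (hi.mul_const _) ?_ hsub.eventuallyLE)
  · refine setIntegral_mono_on (hp.mono_set hsub) (IntegrableOn.mono_set (hi.mul_const _) hsub)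
      measurableSet_Ioi fun w hw => ?_
    have hw' : t < w := hw
    have h3 : 1 ≤ Real.exp (γ * w) * Real.exp (-(γ * t)) := by
      rw [← Real.exp_add, Real.one_le_exp_iff]
      nlinarith
    have h4 := passPdf_nonneg (d := d) hb a (ht.trans hw'.le)
    nlinarith
  · filter_upwards [ae_restrict_mem measurableSet_Ioi] with w hw
    have h4 := passPdf_nonneg (d := d) hb a (le_of_lt (Set.mem_Ioi.1 hw))
    simp only [Pi.zero_apply]
    positivity

include hd

/-- The density of the minimum is e^{-Λt} (f + Λ(1 - F)), and integration by parts turns the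
transform of 1 - F into (1 - f̂)/(Λ + s). For Λ = 0 the second term is absent and 1 - F need not be
integrable, so integrability is asked for only when Λ ≠ 0. -/
lemma clockTransform_cfTransform {a : ℕ} (ha : 1 ≤ a) {s : ℂ} (hw : (Λ : ℂ) + s ≠ 0)
    (h : lap b d a ((Λ : ℝ) + s.re) ≠ ∞)
    (hI : Λ ≠ 0 → IntegrableOn (fun t => Real.exp (-(((Λ : ℝ) + s.re) * t)) *
      (1 - passCdf b d a t)) (Set.Ioi 0)) :
    IntegrableOn (fun t : ℝ => Complex.exp (-s * t) * (survPdf b d Λ a t : ℂ)) (Set.Ioi 0) ∧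
    clockTransform (cfTransform b d a) (Λ : ℝ) s =
      ∫ t in Set.Ioi (0 : ℝ), Complex.exp (-s * t) * (survPdf b d Λ a t : ℂ) := by
  set w : ℂ := (Λ : ℂ) + s with hwdef
  have hre : w.re = (Λ : ℝ) + s.re := by simp [hwdef]
  have hcf := (hasContFrac_and_cfTransform_eq hb hd ha (s := w) (by rwa [hre])).2
  have hI1 := integrableOn_exp_mul_passPdf hb (s := w) (by rwa [hre] : lap b d a w.re ≠ ∞)
  have hcdf := continuous_passCdf (d := d) hb a
  have hI2 : Λ ≠ 0 → IntegrableOn (fun t : ℝ => Complex.exp (-w * t) * (1 - passCdf b d a t : ℂ))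
      (Set.Ioi 0) := by
    intro h0
    refine (hI h0).norm.mono' (Continuous.aestronglyMeasurable (by fun_prop)) (ae_of_all _ ?_)
    intro t
    rw [norm_mul, norm_cexp_neg_mul, hre, norm_mul, ← Complex.ofReal_one, ← Complex.ofReal_sub,
      Complex.norm_real, Real.norm_of_nonneg (Real.exp_nonneg _)]
  have hI3 : IntegrableOn (fun t : ℝ => (Λ : ℂ) *
      (Complex.exp (-w * t) * (1 - passCdf b d a t : ℂ))) (Set.Ioi 0) := by
    by_cases h0 : Λ = 0
    · simp [h0]
    · exact (hI2 h0).const_mul _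
  have heq : (fun t : ℝ => Complex.exp (-s * t) * (survPdf b d Λ a t : ℂ)) = fun t : ℝ =>
      Complex.exp (-w * t) * (passPdf b d a t : ℂ) +
        (Λ : ℂ) * (Complex.exp (-w * t) * (1 - passCdf b d a t : ℂ)) := by
    funext t
    have he : Complex.exp (-w * t) = Complex.exp (-s * t) * Complex.exp (-(Λ * t)) := by
      rw [← Complex.exp_add]
      congr 1
      rw [hwdef]
      ring
    rw [he, survPdf]
    push_cast
    ring
  rw [heq]
  refine ⟨hI1.add hI3, ?_⟩
  rw [integral_add hI1 hI3, integral_const_mul, clockTransform]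
  have hcast : (((Λ : ℝ≥0) : ℝ) : ℂ) + s = w := rfl
  rw [hcast, hcf]
  congr 1
  by_cases h0 : Λ = 0
  · simp [h0]
  have hderiv : ∀ t : ℝ, 0 < t → HasDerivAt
      (fun t : ℝ => Complex.exp (-w * t) * (1 - passCdf b d a t : ℂ))
      (-w * (Complex.exp (-w * t) * (1 - passCdf b d a t : ℂ)) -
        Complex.exp (-w * t) * (passPdf b d a t : ℂ)) t := by
    intro t _
    refine ((hasDerivAt_cexp_neg_mul w t).mul
      ((hasDerivAt_passCdf hb a t).ofReal_comp.const_sub 1)).congr_deriv ?_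
    ring
  have key := integral_Ioi_zero_of_hasDerivAt (Continuous.continuousWithinAt (by fun_prop)) hderiv
    (hI2 h0) (((hI2 h0).const_mul (-w)).sub hI1)
  rw [integral_sub ((hI2 h0).const_mul (-w)) hI1, integral_const_mul] at key
  obtain ⟨a, rfl⟩ : ∃ a', a = a' + 1 := ⟨a - 1, by omega⟩
  simp only [Complex.ofReal_zero, mul_zero, Complex.exp_zero, one_mul, passCdf_succ_zero,
    sub_zero] at key
  rw [div_mul_eq_mul_div, div_eq_iff hw]
  linear_combination (Λ : ℂ) * key

lemma clockTransform_cfTransform_of_re_pos {a : ℕ} (ha : 1 ≤ a) {s : ℂ}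
    (hs : 0 < (Λ : ℝ) + s.re) :
    IntegrableOn (fun t : ℝ => Complex.exp (-s * t) * (survPdf b d Λ a t : ℂ)) (Set.Ioi 0) ∧
    clockTransform (cfTransform b d a) (Λ : ℝ) s =
      ∫ t in Set.Ioi (0 : ℝ), Complex.exp (-s * t) * (survPdf b d Λ a t : ℂ) := by
  refine clockTransform_cfTransform Λ hb hd ha ?_ ?_ fun _ =>
    integrableOn_exp_mul_one_sub_passCdf hb hs a
  · intro h
    have := congrArg Complex.re h
    simp at this
    linarith
  · exact ne_top_of_le_ne_top ENNReal.one_ne_top (lap_le_one hb hs.le a)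

variable (b d) in
/-- Abscissae at which the transform of the minimum of the first passage time from `a` to `0` and an
independent exponential time of rate `Λ` can be evaluated. -/
def TiltCondition (a : ℕ) (γ : ℝ) : Prop :=
  0 < γ ∧ (γ < Λ ∨ (∫ t in Set.Ioi (0 : ℝ), passPdf b d a t = 1 ∧ lap b d a (-γ) ≠ ∞))

-- If γ < Λ, then Re (Λ + s) > 0 and everything converges. Otherwise the exponential moment controls
-- both the density and the tail. In that case a non-zero imaginary part keeps Λ + s away from 0,
-- where division would yield a default value.
variable {Λ} in
lemma TiltCondition.clockTransform_eq {a : ℕ} (ha : 1 ≤ a) {γ : ℝ} (hγ : TiltCondition b d Λ a γ)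
    {s : ℂ} (hs : s.re = -γ) (him : s.im ≠ 0) :
    IntegrableOn (fun t : ℝ => Complex.exp (-s * t) * (survPdf b d Λ a t : ℂ)) (Set.Ioi 0) ∧
    clockTransform (cfTransform b d a) (Λ : ℝ) s =
      ∫ t in Set.Ioi (0 : ℝ), Complex.exp (-s * t) * (survPdf b d Λ a t : ℂ) := by
  obtain ⟨hγ0, hγ | ⟨h1, h2⟩⟩ := hγ
  · exact clockTransform_cfTransform_of_re_pos Λ hb hd ha (by rw [hs]; linarith)
  · refine clockTransform_cfTransform Λ hb hd ha ?_ ?_ ?_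
    · intro h
      have := congrArg Complex.im h
      simp at this
      exact him this
    · rw [hs]
      refine ne_top_of_le_ne_top h2 ?_
      rw [lap_eq_setLIntegral hb a (by omega), lap_eq_setLIntegral hb a (by omega)]
      refine setLIntegral_mono' measurableSet_Ioi fun t ht => ENNReal.ofReal_le_ofReal ?_
      have ht0 : 0 < t := ht
      refine mul_le_mul_of_nonneg_right ?_ (passPdf_nonneg hb a ht0.le)
      rw [Real.exp_le_exp]
      have : 0 ≤ (Λ : ℝ) * t := by positivity
      linarith
    · intro h0
      have hΛ : 0 < (Λ : ℝ) := by positivity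
      have hcdf := continuous_passCdf (d := d) hb a
      have hexp := (integrableOn_exp_mul_Ioi (a := -(Λ : ℝ)) (by linarith) 0).const_mul
        (∫ w in Set.Ioi (0 : ℝ), Real.exp (γ * w) * passPdf b d a w)
      refine hexp.mono' (Continuous.aestronglyMeasurable (by fun_prop)) ?_
      filter_upwards [ae_restrict_mem measurableSet_Ioi] with t ht
      have ht0 : 0 < t := ht
      have h3 := passCdf_le_one (d := d) hb a ht0.le
      have h4 := one_sub_passCdf_le hb ha hγ0 h1 h2 ht0.le
      rw [Real.norm_of_nonneg (mul_nonneg (Real.exp_nonneg _) (by linarith)), hs]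
      refine (mul_le_mul_of_nonneg_left h4 (Real.exp_nonneg _)).trans_eq ?_
      have he : Real.exp (-((Λ + -γ) * t)) * Real.exp (-(γ * t)) = Real.exp (-(Λ : ℝ) * t) := by
        rw [← Real.exp_add]
        ring_nf
      rw [← he]
      ring

variable {Λ} in
lemma TiltCondition.integrableOn {a : ℕ} (ha : 1 ≤ a) {γ : ℝ} (hγ : TiltCondition b d Λ a γ) :
    IntegrableOn (fun t => Real.exp (γ * t) * survPdf b d Λ a t) (Set.Ioi 0) := by
  -- Only the modulus of the integrand matters, so any non-zero imaginary part serves; it is taken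
  -- to be 1.
  have h := (hγ.clockTransform_eq hb hd ha (s := -γ + Complex.I) (by simp) (by simp)).1.norm
  refine h.congr ?_
  filter_upwards [ae_restrict_mem measurableSet_Ioi] with t ht
  rw [norm_mul, norm_cexp_neg_mul, Complex.norm_real,
    Real.norm_of_nonneg (survPdf_nonneg Λ hb a (le_of_lt (Set.mem_Ioi.1 ht)))]
  simp

-- The minimum is almost surely finite: either the clock has positive rate, or the passage time has
-- mass 1 and an exponential tail. This makes the boundary term at infinity vanish in the
-- integration by parts below.
variable {Λ} in
lemma TiltCondition.tendsto_surv {a : ℕ} (ha : 1 ≤ a) {γ : ℝ} (hγ : TiltCondition b d Λ a γ) :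
    Tendsto (surv b d Λ a) atTop (𝓝 0) := by
  have hexp : ∀ x : ℝ, 0 < x → Tendsto (fun t : ℝ => Real.exp (-(x * t))) atTop (𝓝 0) := by
    intro x hx
    exact Real.tendsto_exp_neg_atTop_nhds_zero.comp (tendsto_id.const_mul_atTop hx)
  obtain ⟨hγ0, hγ | ⟨h1, h2⟩⟩ := hγ
  · refine squeeze_zero' ?_ ?_ (hexp Λ (by linarith))
    · filter_upwards [eventually_ge_atTop 0] with t ht using surv_nonneg Λ hb a ht
    · filter_upwards [eventually_ge_atTop 0] with t ht
      have := passCdf_nonneg (d := d) hb a ht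
      exact mul_le_of_le_one_right (Real.exp_nonneg _) (by linarith)
  · have h3 := (hexp γ hγ0).const_mul (∫ w in Set.Ioi (0 : ℝ), Real.exp (γ * w) * passPdf b d a w)
    rw [mul_zero] at h3
    refine squeeze_zero' ?_ ?_ h3
    · filter_upwards [eventually_ge_atTop 0] with t ht using surv_nonneg Λ hb a ht
    · filter_upwards [eventually_ge_atTop 0] with t ht
      have h4 := passCdf_le_one (d := d) hb a ht
      refine le_trans ?_ (one_sub_passCdf_le hb ha hγ0 h1 h2 ht)
      refine mul_le_of_le_one_left (by linarith) ?_
      rw [Real.exp_le_one_iff]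
      have : 0 ≤ (Λ : ℝ) * t := by positivity
      linarith

end Clock

section RaceInversion

variable {b₁ d₁ b₂ d₂ : ℕ → ℝ≥0} {Λ : ℝ≥0} (hb₁ : ∀ k, 0 < b₁ k) (hd₁ : ∀ k, 1 ≤ k → 0 < d₁ k)
  (hb₂ : ∀ k, 0 < b₂ k) (hd₂ : ∀ k, 1 ≤ k → 0 < d₂ k)

include hb₁ hd₁ hb₂ hd₂

/-- Inversion at `0` of the transform of the difference of two independent minima. -/
theorem hasInverseLaplaceAt_moveTransform {a c : ℕ} {γ : ℝ}
    (hγ : TiltCondition b₂ d₂ Λ (c + 1) γ) :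
    HasInverseLaplaceAt
      (moveTransform (cfTransform b₁ d₁ (a + 1)) (cfTransform b₂ d₂ (c + 1)) Λ) γ 0
      ((∫ t in Set.Ioi (0 : ℝ), survPdf b₁ d₁ Λ (a + 1) t * surv b₂ d₂ Λ (c + 1) t : ℝ) : ℂ) := by
  have hγ0 := hγ.1
  have hα := integrableOn_survPdf (d := d₁) Λ hb₁
  have hA := hasDerivAt_surv (d := d₁) Λ hb₁ (a + 1)
  have hB := hasDerivAt_surv (d := d₂) Λ hb₂ (c + 1)
  have hβ : IntegrableOn (survPdf b₂ d₂ Λ (c + 1)) (Set.Ioi 0) := integrableOn_survPdf Λ hb₂ _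
  have hAc := continuous_surv (d := d₁) Λ hb₁ (a + 1)
  have hBc := continuous_surv (d := d₂) Λ hb₂ (c + 1)
  have hA1 : ∀ t, 0 ≤ t → 0 ≤ surv b₁ d₁ Λ (a + 1) t ∧ surv b₁ d₁ Λ (a + 1) t ≤ 1 :=
    fun t ht => ⟨surv_nonneg Λ hb₁ _ ht, surv_le_one Λ hb₁ _ ht⟩
  -- Both integrals are the probability that the first minimum comes before the second. They differ
  -- by the boundary values of (1 - A) B, which vanish at 0 since A(0) = 1 and at infinity since B
  -- tends to 0.
  have hparts : ∫ t in Set.Ioi (0 : ℝ), (1 - surv b₁ d₁ Λ (a + 1) t) * survPdf b₂ d₂ Λ (c + 1) t =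
      ∫ t in Set.Ioi (0 : ℝ), survPdf b₁ d₁ Λ (a + 1) t * surv b₂ d₂ Λ (c + 1) t := by
    have hI1 : IntegrableOn (fun t => survPdf b₁ d₁ Λ (a + 1) t * surv b₂ d₂ Λ (c + 1) t)
        (Set.Ioi 0) := by
      simpa using integrableOn_race (d₁ := d₁) (d₂ := d₂) Λ hb₁ hb₂ le_rfl (a + 1) (c + 1)
    have hI2 : IntegrableOn (fun t => (1 - surv b₁ d₁ Λ (a + 1) t) * survPdf b₂ d₂ Λ (c + 1) t)
        (Set.Ioi 0) := by
      have hβc := continuous_survPdf (d := d₂) Λ hb₂ (c + 1)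
      refine hβ.norm.mono' (Continuous.aestronglyMeasurable (by fun_prop)) ?_
      filter_upwards [ae_restrict_mem measurableSet_Ioi] with t ht
      have h1 := hA1 t (le_of_lt ht)
      rw [norm_mul]
      refine mul_le_of_le_one_left (norm_nonneg _) ?_
      rw [Real.norm_of_nonneg (by linarith)]
      linarith
    have hlim : Tendsto (fun t => (1 - surv b₁ d₁ Λ (a + 1) t) * surv b₂ d₂ Λ (c + 1) t) atTop
        (𝓝 0) := by
      refine squeeze_zero' ?_ ?_ (hγ.tendsto_surv hb₂ hd₂ (by omega))
      · filter_upwards [eventually_ge_atTop 0] with t ht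
        exact mul_nonneg (by linarith [(hA1 t ht).2]) (surv_nonneg Λ hb₂ _ ht)
      · filter_upwards [eventually_ge_atTop 0] with t ht
        exact mul_le_of_le_one_left (surv_nonneg Λ hb₂ _ ht) (by linarith [(hA1 t ht).1])
    have key := integral_Ioi_of_hasDerivAt_of_tendsto (a := (0 : ℝ))
      (f := fun t => (1 - surv b₁ d₁ Λ (a + 1) t) * surv b₂ d₂ Λ (c + 1) t)
      (f' := fun t => survPdf b₁ d₁ Λ (a + 1) t * surv b₂ d₂ Λ (c + 1) t -
        (1 - surv b₁ d₁ Λ (a + 1) t) * survPdf b₂ d₂ Λ (c + 1) t)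
      (Continuous.continuousWithinAt (by fun_prop))
      (fun t _ => (((hA t).const_sub 1).mul (hB t)).congr_deriv (by ring)) (hI1.sub hI2) hlim
    rw [integral_sub hI1 hI2, surv_succ_zero] at key
    simp at key
    linarith
  rw [← hparts]
  refine hasInverseLaplaceAt_zero hγ0 hA (surv_succ_zero b₁ d₁ Λ a) hA1
    (continuous_survPdf Λ hb₁ _) (hα _) (fun t ht => hasDerivAt_survPdf Λ hb₁ a ht)
    ((((hα _).const_mul _).add ((hα _).const_mul _)).add ((hα _).const_mul _))
    (hγ.integrableOn hb₂ hd₂ (by omega)) fun u hu => ?_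
  have h1 := (clockTransform_cfTransform_of_re_pos Λ hb₁ hd₁ (a := a + 1) (by omega)
    (s := γ + u * Complex.I) (by simp; positivity)).2
  have h2 := (hγ.clockTransform_eq hb₂ hd₂ (by omega) (s := -(γ + u * Complex.I)) (by simp)
    (by simpa using hu)).2
  rw [moveTransform, h1, h2, neg_neg]

end RaceInversion

/-! ### Consequences of the law of the passage time -/

section PassageLaw

variable {b d : ℕ → ℝ≥0} {Ω : Type*} [MeasurableSpace Ω] {P : Measure Ω} [IsProbabilityMeasure P]
  {Z : ℝ≥0 → Ω → ℕ} {q : ℕ}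

/-- The formula for `passPdf` need not vanish at negative times, hence the indicator. -/
lemma isDensity_passPdf (hb : ∀ k, 0 < b k) (hZ : IsMarkovJumpProcess P (birthDeathRate b d) Z)
    (hq : 1 ≤ q) (hZ0 : ∀ᵐ ω ∂P, Z 0 ω = q) :
    IsDensity P (firstPassage Z 0) ((Set.Ioi 0).indicator (passPdf b d q)) := by
  obtain ⟨σ, hσ, hae, hmap⟩ := map_firstPassage_birthDeath hb hZ hq hZ0
  have hcont := continuous_passPdf (d := d) hb q
  refine ⟨hcont.measurable.indicator measurableSet_Ioi, fun t => Set.indicator_nonneg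
    (fun t ht => passPdf_nonneg hb q (le_of_lt ht)) t, fun t ht => ?_⟩
  have hset : MeasurableSet {ω | σ ω ≠ ∞} := (hσ (measurableSet_singleton ∞)).compl
  have h1 := congrArg (fun μ : Measure ℝ => μ (Set.Iic t)) hmap
  beta_reduce at h1
  rw [Measure.map_apply hσ.ennreal_toReal measurableSet_Iic,
    Measure.restrict_apply (hσ.ennreal_toReal measurableSet_Iic),
    withDensity_apply _ measurableSet_Iic, Measure.restrict_restrict measurableSet_Iic,
    Set.inter_comm (Set.Iic t), Set.Ioi_inter_Iic] at h1
  have h2 : P {ω | firstPassage Z 0 ω ≤ ENNReal.ofReal t} =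
      P ((fun ω => (σ ω).toReal) ⁻¹' Set.Iic t ∩ {ω | σ ω ≠ ∞}) := by
    refine measure_congr ?_
    filter_upwards [hae] with ω hω
    refine propext ?_
    change firstPassage Z 0 ω ≤ ENNReal.ofReal t ↔ (σ ω).toReal ≤ t ∧ σ ω ≠ ∞
    rw [hω]
    constructor
    · intro h
      have hne : σ ω ≠ ∞ := ne_top_of_le_ne_top ENNReal.ofReal_ne_top h
      exact ⟨ENNReal.toReal_le_of_le_ofReal ht h, hne⟩
    · rintro ⟨h, hne⟩
      exact (ENNReal.le_ofReal_iff_toReal_le hne ht).2 h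
  rw [h2, h1]
  refine setLIntegral_congr_fun measurableSet_Ioc fun u hu => ?_
  rw [Set.indicator_of_mem (Set.mem_Ioi.2 hu.1)]

/-- Almost sure finiteness says that the density has mass 1, and the exponential moment of the law
is `lap` at -γ. -/
lemma tiltCondition_of_admissible (hb : ∀ k, 0 < b k)
    (hZ : IsMarkovJumpProcess P (birthDeathRate b d) Z) (hq : 1 ≤ q) (hZ0 : ∀ᵐ ω ∂P, Z 0 ω = q)
    {Λ : ℝ≥0} {γ : ℝ} (h : Admissible P (firstPassage Z 0) Λ γ) : TiltCondition b d Λ q γ := by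
  obtain ⟨hγ, h | ⟨hfin, hint⟩⟩ := h
  · exact ⟨hγ, Or.inl h⟩
  refine ⟨hγ, Or.inr ?_⟩
  obtain ⟨σ, hσ, hae, hmap⟩ := map_firstPassage_birthDeath hb hZ hq hZ0
  have hcont := continuous_passPdf (d := d) hb q
  have hfull : P.restrict {ω | σ ω ≠ ∞} = P := by
    refine Measure.restrict_eq_self_of_ae_mem ?_
    filter_upwards [hae, hfin] with ω h1 h2
    exact h1 ▸ h2.ne
  rw [hfull] at hmap
  constructor
  · rw [integral_eq_lintegral_of_nonneg_ae]
    · have h1 := congrArg (fun μ : Measure ℝ => μ Set.univ) hmap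
      beta_reduce at h1
      rw [Measure.map_apply hσ.ennreal_toReal MeasurableSet.univ, Set.preimage_univ, measure_univ,
        withDensity_apply _ MeasurableSet.univ, Measure.restrict_univ] at h1
      rw [← h1, ENNReal.toReal_one]
    · filter_upwards [ae_restrict_mem measurableSet_Ioi] with t ht
      exact passPdf_nonneg hb q (le_of_lt ht)
    · exact hcont.aestronglyMeasurable
  · rw [lap_eq_setLIntegral hb q (by omega)]
    have h1 : ∫⁻ ω, ENNReal.ofReal (Real.exp (γ * (σ ω).toReal)) ∂P =
        ∫⁻ t in Set.Ioi 0, ENNReal.ofReal (Real.exp (-(-γ * t)) * passPdf b d q t) := by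
      rw [← lintegral_map (f := fun t => ENNReal.ofReal (Real.exp (γ * t))) (by fun_prop)
        hσ.ennreal_toReal, hmap,
        lintegral_withDensity_eq_lintegral_mul _ hcont.measurable.ennreal_ofReal (by fun_prop)]
      refine lintegral_congr fun t => ?_
      rw [Pi.mul_apply, mul_comm, ← ENNReal.ofReal_mul (Real.exp_nonneg _), neg_mul, neg_neg]
    rw [← h1]
    have h2 : Integrable (fun ω => Real.exp (γ * (σ ω).toReal)) P := by
      refine hint.congr ?_
      filter_upwards [hae] with ω hω
      rw [hω]
    exact h2.lintegral_lt_top.ne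

end PassageLaw

/-! ### Best quotes -/

section Quotes

variable {N : ℕ} {x : Book N} {i j ia ib : Fin N}

lemma level_lt_level : level i < level j ↔ i < j := by simp [level]

lemma level_inj : level i = level j ↔ i = j := by simp [level, Fin.ext_iff]

lemma bestAsk_mem (x : Book N) : bestAsk x = N + 1 ∨ ∃ i, level i = bestAsk x ∧ 0 < x i :=
  Nat.sInf_mem (s := insert (N + 1) {l | ∃ i, level i = l ∧ 0 < x i}) (Set.insert_nonempty _ _)

lemma bestAsk_le (h : 0 < x i) : bestAsk x ≤ level i := Nat.sInf_le (Or.inr ⟨i, rfl, h⟩)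

lemma bddAbove_bid (x : Book N) : BddAbove (insert 0 {l | ∃ i, level i = l ∧ x i < 0}) := by
  refine ⟨N, ?_⟩
  rintro l (rfl | ⟨i, rfl, -⟩)
  · exact Nat.zero_le _
  · exact i.2

lemma bestBid_mem (x : Book N) : bestBid x = 0 ∨ ∃ i, level i = bestBid x ∧ x i < 0 :=
  Nat.sSup_mem (s := insert 0 {l | ∃ i, level i = l ∧ x i < 0}) (Set.insert_nonempty _ _)
    (bddAbove_bid x)

lemma le_bestBid (h : x i < 0) : level i ≤ bestBid x :=
  le_csSup (bddAbove_bid x) (Or.inr ⟨i, rfl, h⟩)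

lemma lt_bestAsk (h : ∀ j, j ≤ i → x j ≤ 0) : level i < bestAsk x := by
  rcases bestAsk_mem x with h1 | ⟨j, h1, h2⟩
  · have := i.2
    simp only [level]
    omega
  · rw [← h1, level_lt_level]
    by_contra hle
    exact absurd (h j (not_lt.1 hle)) (not_le.2 h2)

lemma bestBid_lt (h : ∀ j, i ≤ j → 0 ≤ x j) : bestBid x < level i := by
  rcases bestBid_mem x with h1 | ⟨j, h1, h2⟩
  · simp only [level]
    omega
  · rw [← h1, level_lt_level]
    by_contra hle
    exact absurd (h j (not_lt.1 hle)) (not_le.2 h2)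

lemma bestAsk_eq_level_iff : bestAsk x = level i ↔ 0 < x i ∧ ∀ j, j < i → x j ≤ 0 := by
  constructor
  · intro h
    have h1 : 0 < x i := by
      rcases bestAsk_mem x with h1 | ⟨j, h1, h2⟩
      · have := i.2
        simp only [level] at h
        omega
      · rw [h, level_inj] at h1
        exact h1 ▸ h2
    refine ⟨h1, fun j hj => not_lt.1 fun hpos => ?_⟩
    have := bestAsk_le hpos
    rw [h] at this
    exact absurd (level_lt_level.2 hj) (not_lt.2 this)
  · rintro ⟨h1, h2⟩
    refine le_antisymm (bestAsk_le h1) ?_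
    rcases bestAsk_mem x with h3 | ⟨j, h3, h4⟩
    · have := i.2
      simp only [level]
      omega
    · rw [← h3]
      refine not_lt.1 fun hlt => ?_
      exact absurd (h2 j (level_lt_level.1 hlt)) (not_le.2 h4)

lemma bestBid_eq_level_iff : bestBid x = level i ↔ x i < 0 ∧ ∀ j, i < j → 0 ≤ x j := by
  constructor
  · intro h
    have h1 : x i < 0 := by
      rcases bestBid_mem x with h1 | ⟨j, h1, h2⟩
      · simp only [level] at h
        omega
      · rw [h, level_inj] at h1
        exact h1 ▸ h2
    refine ⟨h1, fun j hj => not_lt.1 fun hneg => ?_⟩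
    have := le_bestBid hneg
    rw [h] at this
    exact absurd (level_lt_level.2 hj) (not_lt.2 this)
  · rintro ⟨h1, h2⟩
    refine le_antisymm ?_ (le_bestBid h1)
    rcases bestBid_mem x with h3 | ⟨j, h3, h4⟩
    · rw [h3]; exact Nat.zero_le _
    · rw [← h3]
      refine not_lt.1 fun hlt => ?_
      exact absurd (h2 j (level_lt_level.1 hlt)) (not_le.2 h4)

lemma queueSize_level (x : Book N) (i : Fin N) : queueSize x (level i) = (x i).natAbs := by
  simp [queueSize, level_inj]

/-- The books whose best quotes are at the indices `ia` and `ib`. -/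
def quoteSet (ia ib : Fin N) : Set (Book N) :=
  {x | bestAsk x = level ia ∧ bestBid x = level ib}

/-- The mid-price of the books in `quoteSet ia ib`. -/
def quoteMid (ia ib : Fin N) : ℝ := ((level ib : ℝ) + (level ia : ℝ)) / 2

/-- Sign form of the quotes; with it, the effect of a unit order reduces to integer arithmetic. -/
lemma mem_quoteSet_iff : x ∈ quoteSet ia ib ↔
    (0 < x ia ∧ ∀ j, j < ia → x j ≤ 0) ∧ (x ib < 0 ∧ ∀ j, ib < j → 0 ≤ x j) := by
  rw [← bestAsk_eq_level_iff, ← bestBid_eq_level_iff]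
  rfl

lemma midPrice_of_mem (hx : x ∈ quoteSet ia ib) : midPrice x = quoteMid ia ib := by
  rw [midPrice, hx.1, hx.2, quoteMid]

lemma midPrice_lt (h1 : bestBid x ≤ level ib) (h2 : bestAsk x < level ia) :
    midPrice x < quoteMid ia ib := by
  have h1' : (bestBid x : ℝ) ≤ level ib := by exact_mod_cast h1
  have h2' : (bestAsk x : ℝ) < level ia := by exact_mod_cast h2
  unfold midPrice quoteMid
  linarith

lemma midPrice_lt' (h1 : bestBid x < level ib) (h2 : bestAsk x ≤ level ia) :
    midPrice x < quoteMid ia ib := by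
  have h1' : (bestBid x : ℝ) < level ib := by exact_mod_cast h1
  have h2' : (bestAsk x : ℝ) ≤ level ia := by exact_mod_cast h2
  unfold midPrice quoteMid
  linarith

lemma lt_midPrice (h1 : level ib ≤ bestBid x) (h2 : level ia < bestAsk x) :
    quoteMid ia ib < midPrice x := by
  have h1' : (level ib : ℝ) ≤ bestBid x := by exact_mod_cast h1
  have h2' : (level ia : ℝ) < bestAsk x := by exact_mod_cast h2
  unfold midPrice quoteMid
  linarith

lemma lt_midPrice' (h1 : level ib < bestBid x) (h2 : level ia ≤ bestAsk x) :
    quoteMid ia ib < midPrice x := by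
  have h1' : (level ib : ℝ) < bestBid x := by exact_mod_cast h1
  have h2' : (level ia : ℝ) ≤ bestAsk x := by exact_mod_cast h2
  unfold midPrice quoteMid
  linarith

lemma add_single_apply (x : Book N) (i j : Fin N) :
    (x + Pi.single i 1 : Book N) j = x j + if j = i then 1 else 0 := by
  rw [Pi.add_apply, Pi.single_apply]

lemma sub_single_apply (x : Book N) (i j : Fin N) :
    (x - Pi.single i 1 : Book N) j = x j - if j = i then 1 else 0 := by
  rw [Pi.sub_apply, Pi.single_apply]

variable (hlt : ib < ia) (hx : x ∈ quoteSet ia ib)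

include hlt hx

lemma eq_zero_of_between (h1 : ib < i) (h2 : i < ia) : x i = 0 := by
  have h := mem_quoteSet_iff.1 hx
  have h3 := h.1.2 i h2
  have h4 := h.2.2 i h1
  omega

/-- A unit order that changes the sign pattern neither at the best quotes nor elsewhere keeps the
best quotes. -/
lemma add_single_mem (hi : ia ≤ i ∨ (i ≤ ib ∧ x i < 0 ∧ (i = ib → x ib ≠ -1))) :
    (x + Pi.single i 1 : Book N) ∈ quoteSet ia ib := by
  have h := mem_quoteSet_iff.1 hx
  rw [mem_quoteSet_iff]
  simp only [add_single_apply]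
  refine ⟨⟨?_, fun j hj => ?_⟩, ?_, fun j hj => ?_⟩
  · have := h.1.1
    split_ifs <;> omega
  · have := h.1.2 j hj
    split_ifs with hji
    · subst hji
      rcases hi with hi | hi
      · exact absurd hj (not_lt.2 hi)
      · omega
    · omega
  · have := h.2.1
    split_ifs with hji
    · subst hji
      rcases hi with hi | hi
      · exact absurd hlt (not_lt.2 hi)
      · have := hi.2.2 rfl
        omega
    · omega
  · have := h.2.2 j hj
    split_ifs <;> omega

lemma sub_single_mem (hi : i ≤ ib ∨ (ia ≤ i ∧ 0 < x i ∧ (i = ia → x ia ≠ 1))) :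
    (x - Pi.single i 1 : Book N) ∈ quoteSet ia ib := by
  have h := mem_quoteSet_iff.1 hx
  rw [mem_quoteSet_iff]
  simp only [sub_single_apply]
  refine ⟨⟨?_, fun j hj => ?_⟩, ?_, fun j hj => ?_⟩
  · have := h.1.1
    split_ifs with hji
    · subst hji
      rcases hi with hi | hi
      · exact absurd hlt (not_lt.2 hi)
      · have := hi.2.2 rfl
        omega
    · omega
  · have := h.1.2 j hj
    split_ifs <;> omega
  · have := h.2.1
    split_ifs <;> omega
  · have := h.2.2 j hj
    split_ifs with hji
    · subst hji
      rcases hi with hi | hi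
      · exact absurd hj (not_lt.2 hi)
      · omega
    · omega

lemma midPrice_add_single_lt_of_between (h1 : ib < i) (h2 : i < ia) :
    midPrice (x + Pi.single i 1 : Book N) < quoteMid ia ib := by
  have h := mem_quoteSet_iff.1 hx
  have h0 := eq_zero_of_between hlt hx h1 h2
  refine midPrice_lt (le_of_eq (bestBid_eq_level_iff.2 ?_))
    ((bestAsk_le (i := i) ?_).trans_lt (level_lt_level.2 h2))
  · simp only [add_single_apply]
    refine ⟨?_, fun j hj => ?_⟩
    · rw [if_neg h1.ne]
      have := h.2.1
      omega
    · have := h.2.2 j hj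
      split_ifs <;> omega
  · simp [h0]

lemma lt_midPrice_sub_single_of_between (h1 : ib < i) (h2 : i < ia) :
    quoteMid ia ib < midPrice (x - Pi.single i 1 : Book N) := by
  have h := mem_quoteSet_iff.1 hx
  have h0 := eq_zero_of_between hlt hx h1 h2
  refine lt_midPrice' ((level_lt_level.2 h1).trans_le (le_bestBid (i := i) ?_))
    (le_of_eq (bestAsk_eq_level_iff.2 ?_).symm)
  · simp [h0]
  · simp only [sub_single_apply]
    refine ⟨?_, fun j hj => ?_⟩
    · rw [if_neg h2.ne']
      have := h.1.1
      omega
    · have := h.1.2 j hj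
      split_ifs <;> omega

/-- The emptied level and everything above it hold no bids, so the best bid drops strictly while the
ask stays. How far it drops does not matter. -/
lemma midPrice_add_single_lt_of_depleted (h1 : x ib = -1) :
    midPrice (x + Pi.single ib 1 : Book N) < quoteMid ia ib := by
  have h := mem_quoteSet_iff.1 hx
  refine midPrice_lt' (bestBid_lt fun j hj => ?_) (le_of_eq (bestAsk_eq_level_iff.2 ?_))
  · rw [add_single_apply]
    rcases eq_or_lt_of_le hj with rfl | hj
    · simp [h1]
    · have := h.2.2 j hj
      split_ifs <;> omega
  · simp only [add_single_apply]
    refine ⟨?_, fun j hj => ?_⟩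
    · rw [if_neg hlt.ne']
      have := h.1.1
      omega
    · have := h.1.2 j hj
      split_ifs with hji
      · subst hji
        omega
      · omega

lemma lt_midPrice_sub_single_of_depleted (h1 : x ia = 1) :
    quoteMid ia ib < midPrice (x - Pi.single ia 1 : Book N) := by
  have h := mem_quoteSet_iff.1 hx
  refine lt_midPrice (le_of_eq (bestBid_eq_level_iff.2 ?_).symm) (lt_bestAsk fun j hj => ?_)
  · simp only [sub_single_apply]
    refine ⟨?_, fun j hj => ?_⟩
    · rw [if_neg hlt.ne]
      have := h.2.1
      omega
    · have := h.2.2 j hj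
      split_ifs with hji
      · subst hji
        omega
      · omega
  · rw [sub_single_apply]
    rcases eq_or_lt_of_le hj with rfl | hj
    · simp [h1]
    · have := h.1.2 j hj
      split_ifs <;> omega

end Quotes

/-! ### Rates at fixed best quotes -/

section Rates

variable {N : ℕ} {𝒳 : Type*} {R : OrderFlow N 𝒳} {x : Book N} {i ia ib : Fin N} {s₀ : ℕ}
  {ξ : ℕ → 𝒳}

/-- Reduces sums over the infinite state space to the finitely many unit moves. -/
lemma tsum_bookRate_mul (R : OrderFlow N 𝒳) (x : Book N) (g : Book N → ℝ≥0∞) :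
    ∑' y, (bookRate R x y : ℝ≥0∞) * g y =
      ∑ i, ((upRate R x i : ℝ≥0∞) * g (x + Pi.single i 1) +
        (downRate R x i : ℝ≥0∞) * g (x - Pi.single i 1)) := by
  classical
  have h1 : ∀ y, (bookRate R x y : ℝ≥0∞) * g y = ∑ i,
      ((if y = x + Pi.single i 1 then (upRate R x i : ℝ≥0∞) * g (x + Pi.single i 1) else 0) +
        (if y = x - Pi.single i 1 then (downRate R x i : ℝ≥0∞) * g (x - Pi.single i 1) else 0)) := by
    intro y
    rw [bookRate, ENNReal.ofNNReal_finsetSum, Finset.sum_mul]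
    refine Finset.sum_congr rfl fun i _ => ?_
    rw [ENNReal.coe_add, add_mul]
    congr 1
    · split_ifs with h
      · rw [h]
      · simp
    · split_ifs with h
      · rw [h]
      · simp
  simp_rw [h1]
  exact (hasSum_sum fun i _ => (hasSum_ite_eq _ _).add (hasSum_ite_eq _ _)).tsum_eq

lemma hasSum_bookRate (R : OrderFlow N 𝒳) (x : Book N) :
    HasSum (bookRate R x) (∑ i, (upRate R x i + downRate R x i)) := by
  have h := hasSum_sum (s := Finset.univ) fun i (_ : i ∈ Finset.univ) =>
    (hasSum_ite_eq (x + Pi.single i 1 : Book N) (upRate R x i)).add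
      (hasSum_ite_eq (x - Pi.single i 1 : Book N) (downRate R x i))
  exact h

variable (hlt : ib < ia) (hs₀ : level ia = level ib + s₀) (hξ : FactorsAtSpread R s₀ ξ)
  (hx : x ∈ quoteSet ia ib)

include hs₀ hξ hx

lemma factor_eq (h1 : ib ≤ i) (h2 : i ≤ ia) : R.factor x i = ξ (level i - level ib) := by
  have h := hξ x i (by rw [hx.2]; simp [level]) (by rw [hx.1]; exact ia.2)
    (by rw [spread, hx.1, hx.2, hs₀]; push_cast; ring) (by rw [hx.2]; simpa [level] using h1)
    (by rw [hx.1]; simpa [level] using h2)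
  rwa [hx.2] at h

include hlt

lemma upRate_ask : upRate R x ia = birth R s₀ ξ .ask (x ia).natAbs := by
  have h := level_lt_level.2 hlt
  have hf := factor_eq hs₀ hξ hx hlt.le le_rfl
  rw [hs₀, Nat.add_sub_cancel_left] at hf
  simp [upRate, hx.2, h, h.ne', not_le.2 h, birth, quotePos, hf]

lemma downRate_bid : downRate R x ib = birth R s₀ ξ .bid (x ib).natAbs := by
  have h := level_lt_level.2 hlt
  have hf := factor_eq hs₀ hξ hx le_rfl hlt.le
  rw [Nat.sub_self] at hf
  simp [downRate, hx.1, h, h.ne, not_le.2 h, birth, quotePos, hf]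

lemma upRate_bid : upRate R x ib = death R s₀ ξ .bid (x ib).natAbs := by
  have h0 : x ib ≠ 0 := (mem_quoteSet_iff.1 hx).2.1.ne
  have hf := factor_eq hs₀ hξ hx le_rfl hlt.le
  rw [Nat.sub_self] at hf
  simp [upRate, hx.2, death, quotePos, hf, h0]

lemma downRate_ask : downRate R x ia = death R s₀ ξ .ask (x ia).natAbs := by
  have h0 : x ia ≠ 0 := (mem_quoteSet_iff.1 hx).1.1.ne'
  have hf := factor_eq hs₀ hξ hx hlt.le le_rfl
  rw [hs₀, Nat.add_sub_cancel_left] at hf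
  simp [downRate, hx.1, death, quotePos, hf, h0]

lemma upRate_between (h1 : ib < i) (h2 : i < ia) :
    upRate R x i = R.lam .ask 0 (ξ (level i - level ib)) := by
  have h := level_lt_level.2 h1
  have hf := factor_eq hs₀ hξ hx h1.le h2.le
  simp [upRate, hx.2, h, h.ne', not_le.2 h, hf, eq_zero_of_between hlt hx h1 h2]

lemma downRate_between (h1 : ib < i) (h2 : i < ia) :
    downRate R x i = R.lam .bid 0 (ξ (level i - level ib)) := by
  have h := level_lt_level.2 h2
  have hf := factor_eq hs₀ hξ hx h1.le h2.le
  simp [downRate, hx.1, h, h.ne, not_le.2 h, hf, eq_zero_of_between hlt hx h1 h2]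

end Rates

/-! ### Levels outside the quotes, and jumps that change them -/

section OuterRates

variable {N : ℕ} {𝒳 : Type*} {R : OrderFlow N 𝒳} {x : Book N} {i ia ib : Fin N}

/-- Below the best bid only a cancellation can raise the entry, and that requires an outstanding
bid. So no order ever creates an ask below the best bid. -/
lemma upRate_eq_zero (hx : x ∈ quoteSet ia ib) (h1 : i < ib) (h0 : ¬ x i < 0) (hlt : ib < ia) :
    upRate R x i = 0 := by
  have h := level_lt_level.2 h1
  have h2 : x i = 0 := by
    have := (mem_quoteSet_iff.1 hx).1.2 i (h1.trans hlt)
    omega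
  simp [upRate, hx.2, h.ne, not_lt.2 h.le, h2]

lemma downRate_eq_zero (hx : x ∈ quoteSet ia ib) (h1 : ia < i) (h0 : ¬ 0 < x i) (hlt : ib < ia) :
    downRate R x i = 0 := by
  have h := level_lt_level.2 h1
  have h2 : x i = 0 := by
    have := (mem_quoteSet_iff.1 hx).2.2 i (hlt.trans h1)
    omega
  simp [downRate, hx.1, h.ne', not_lt.2 h.le, h2]

/-- A jump out of the set of books with given best quotes moves the mid-price. -/
lemma midPrice_ne_of_bookRate_ne_zero (hlt : ib < ia) (hx : x ∈ quoteSet ia ib) {y : Book N}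
    (hy : y ∉ quoteSet ia ib) (hr : bookRate R x y ≠ 0) : midPrice y ≠ quoteMid ia ib := by
  obtain ⟨i, -, hi⟩ := Finset.exists_ne_zero_of_sum_ne_zero hr
  have hsplit : (y = x + Pi.single i 1 ∧ upRate R x i ≠ 0) ∨
      (y = x - Pi.single i 1 ∧ downRate R x i ≠ 0) := by
    by_contra hcon
    push Not at hcon
    apply hi
    split_ifs with h1 h2 h2
    · rw [hcon.1 h1, hcon.2 h2, add_zero]
    · rw [hcon.1 h1, add_zero]
    · rw [hcon.2 h2, add_zero]
    · rw [add_zero]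
  rcases hsplit with ⟨rfl, hr'⟩ | ⟨rfl, hr'⟩
  · rcases lt_trichotomy i ib with h | rfl | h
    · by_cases h0 : x i < 0
      · exact absurd (add_single_mem hlt hx (Or.inr ⟨h.le, h0, fun h' => absurd h' h.ne⟩)) hy
      · exact absurd (upRate_eq_zero hx h h0 hlt) hr'
    · by_cases h1 : x i = -1
      · exact (midPrice_add_single_lt_of_depleted hlt hx h1).ne
      · exact absurd (add_single_mem hlt hx
          (Or.inr ⟨le_rfl, (mem_quoteSet_iff.1 hx).2.1, fun _ => h1⟩)) hy
    · by_cases h2 : i < ia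
      · exact (midPrice_add_single_lt_of_between hlt hx h h2).ne
      · exact absurd (add_single_mem hlt hx (Or.inl (not_lt.1 h2))) hy
  · rcases lt_trichotomy i ia with h | rfl | h
    · by_cases h2 : ib < i
      · exact (lt_midPrice_sub_single_of_between hlt hx h2 h).ne'
      · exact absurd (sub_single_mem hlt hx (Or.inl (not_lt.1 h2))) hy
    · by_cases h1 : x i = 1
      · exact (lt_midPrice_sub_single_of_depleted hlt hx h1).ne'
      · exact absurd (sub_single_mem hlt hx
          (Or.inr ⟨le_rfl, (mem_quoteSet_iff.1 hx).1.1, fun _ => h1⟩)) hy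
    · by_cases h0 : 0 < x i
      · exact absurd (sub_single_mem hlt hx (Or.inr ⟨h.le, h0, fun h' => absurd h' h.ne'⟩)) hy
      · exact absurd (downRate_eq_zero hx h h0 hlt) hr'

end OuterRates

/-- Sums over the indices strictly between the best quotes. -/
lemma sum_between {N : ℕ} {ia ib : Fin N} {s₀ : ℕ} (hs₀ : level ia = level ib + s₀) (f : ℕ → ℝ) :
    ∑ i : Fin N, (if ib < i ∧ i < ia then f (level i - level ib) else 0) =
      ∑ m ∈ Finset.Icc 1 (s₀ - 1), f m := by
  rw [← Finset.sum_filter]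
  simp only [level] at *
  have := ia.2
  refine Finset.sum_bij' (fun i _ => (i : ℕ) + 1 - (ib + 1))
    (fun m hm => ⟨ib + m, by rw [Finset.mem_Icc] at hm; omega⟩) ?_ ?_ ?_ ?_ ?_
  · intro i hi
    simp only [Finset.mem_filter, Finset.mem_univ, true_and, Fin.lt_def] at hi
    rw [Finset.mem_Icc]
    omega
  · intro m hm
    rw [Finset.mem_Icc] at hm
    simp only [Finset.mem_filter, Finset.mem_univ, true_and, Fin.lt_def]
    omega
  · intro i hi
    simp only [Finset.mem_filter, Finset.mem_univ, true_and, Fin.lt_def] at hi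
    ext
    simp only
    omega
  · intro m hm
    simp only
    omega
  · intro i hi
    rfl

/-- Reflection m ↦ s₀ - m: asks are counted down from the best ask, factors up from the best bid. -/
lemma insideAskRate_eq {N : ℕ} {𝒳 : Type*} (R : OrderFlow N 𝒳) (s₀ : ℕ) (ξ : ℕ → 𝒳) :
    insideAskRate R s₀ ξ = ∑ m ∈ Finset.Icc 1 (s₀ - 1), R.lam .ask 0 (ξ m) := by
  refine Finset.sum_bij' (fun m _ => s₀ - m) (fun m _ => s₀ - m) ?_ ?_ ?_ ?_ ?_
  all_goals
    intro m hm
    simp only [Finset.mem_Icc] at *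
    try omega

/-! ### The first move of the mid-price -/

section Value

variable {N : ℕ} {𝒳 : Type*} {R : OrderFlow N 𝒳} {x y : Book N} {i ia ib : Fin N} {s₀ : ℕ}
  {ξ : ℕ → 𝒳} {Γ : ℕ → ℕ → ℝ} {u v : ℝ}

open Classical in
/-- The function that is `Γ` of the sizes of the best queues as long as the best quotes are at `ia`
and `ib`, and `u` or `v` after an upward or downward move of the mid-price. -/
def quoteValue (ia ib : Fin N) (Γ : ℕ → ℕ → ℝ) (u v : ℝ) (y : Book N) : ℝ :=
  if y ∈ quoteSet ia ib then Γ (y ia).natAbs (y ib).natAbs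
  else if quoteMid ia ib < midPrice y then u else if midPrice y < quoteMid ia ib then v else 0

lemma quoteValue_of_mem (hy : y ∈ quoteSet ia ib) :
    quoteValue ia ib Γ u v y = Γ (y ia).natAbs (y ib).natAbs := if_pos hy

lemma quoteValue_of_lt (hy : quoteMid ia ib < midPrice y) : quoteValue ia ib Γ u v y = u := by
  rw [quoteValue, if_neg fun h => hy.ne' (midPrice_of_mem h), if_pos hy]

lemma quoteValue_of_gt (hy : midPrice y < quoteMid ia ib) : quoteValue ia ib Γ u v y = v := by
  rw [quoteValue, if_neg fun h => hy.ne (midPrice_of_mem h), if_neg (not_lt.2 hy.le), if_pos hy]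

variable (hlt : ib < ia) (hx : x ∈ quoteSet ia ib)

include hlt hx

lemma quoteValue_add_single_of_ne (hi : ia < i ∨ (i < ib ∧ x i < 0)) :
    quoteValue ia ib Γ u v (x + Pi.single i 1) = quoteValue ia ib Γ u v x := by
  have hmem : (x + Pi.single i 1 : Book N) ∈ quoteSet ia ib := by
    refine add_single_mem hlt hx ?_
    rcases hi with hi | ⟨hi, h⟩
    · exact Or.inl hi.le
    · exact Or.inr ⟨hi.le, h, fun h' => absurd h' hi.ne⟩
  have h1 : ia ≠ i := by
    rintro rfl
    rcases hi with hi | ⟨hi, -⟩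
    · exact lt_irrefl _ hi
    · exact lt_asymm hi hlt
  have h2 : ib ≠ i := by
    rintro rfl
    rcases hi with hi | ⟨hi, -⟩
    · exact lt_asymm hi hlt
    · exact lt_irrefl _ hi
  rw [quoteValue_of_mem hmem, quoteValue_of_mem hx, add_single_apply, add_single_apply, if_neg h1,
    if_neg h2, add_zero, add_zero]

lemma quoteValue_sub_single_of_ne (hi : i < ib ∨ (ia < i ∧ 0 < x i)) :
    quoteValue ia ib Γ u v (x - Pi.single i 1) = quoteValue ia ib Γ u v x := by
  have hmem : (x - Pi.single i 1 : Book N) ∈ quoteSet ia ib := by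
    refine sub_single_mem hlt hx ?_
    rcases hi with hi | ⟨hi, h⟩
    · exact Or.inl hi.le
    · exact Or.inr ⟨hi.le, h, fun h' => absurd h' hi.ne'⟩
  have h1 : ia ≠ i := by
    rintro rfl
    rcases hi with hi | ⟨hi, -⟩
    · exact lt_asymm hi hlt
    · exact lt_irrefl _ hi
  have h2 : ib ≠ i := by
    rintro rfl
    rcases hi with hi | ⟨hi, -⟩
    · exact lt_irrefl _ hi
    · exact lt_asymm hi hlt
  rw [quoteValue_of_mem hmem, quoteValue_of_mem hx, sub_single_apply, sub_single_apply, if_neg h1,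
    if_neg h2, sub_zero, sub_zero]

lemma quoteValue_add_single_ask :
    quoteValue ia ib Γ u v (x + Pi.single ia 1) = Γ ((x ia).natAbs + 1) (x ib).natAbs := by
  have h := (mem_quoteSet_iff.1 hx).1.1
  rw [quoteValue_of_mem (add_single_mem hlt hx (Or.inl le_rfl)), add_single_apply,
    add_single_apply, if_pos rfl, if_neg hlt.ne, add_zero]
  congr 1
  omega

lemma quoteValue_sub_single_bid :
    quoteValue ia ib Γ u v (x - Pi.single ib 1) = Γ (x ia).natAbs ((x ib).natAbs + 1) := by
  have h := (mem_quoteSet_iff.1 hx).2.1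
  rw [quoteValue_of_mem (sub_single_mem hlt hx (Or.inl le_rfl)), sub_single_apply,
    sub_single_apply, if_pos rfl, if_neg hlt.ne', sub_zero]
  congr 1
  omega

/-- When the last ask order disappears the book leaves the quote set upwards and has value u; the
boundary condition on `Γ 0` makes the formula uniform in the queue size. -/
lemma quoteValue_sub_single_ask (hu : ∀ c, Γ 0 (c + 1) = u) :
    quoteValue ia ib Γ u v (x - Pi.single ia 1) = Γ ((x ia).natAbs - 1) (x ib).natAbs := by
  have h := (mem_quoteSet_iff.1 hx).1.1
  have h' := (mem_quoteSet_iff.1 hx).2.1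
  by_cases h1 : x ia = 1
  · rw [quoteValue_of_lt (lt_midPrice_sub_single_of_depleted hlt hx h1)]
    obtain ⟨c, hc⟩ : ∃ c, (x ib).natAbs = c + 1 := ⟨(x ib).natAbs - 1, by omega⟩
    rw [hc, h1]
    exact (hu c).symm
  · rw [quoteValue_of_mem (sub_single_mem hlt hx (Or.inr ⟨le_rfl, h, fun _ => h1⟩)),
      sub_single_apply, sub_single_apply, if_pos rfl, if_neg hlt.ne, sub_zero]
    congr 1
    omega

lemma quoteValue_add_single_bid (hv : ∀ a, Γ (a + 1) 0 = v) :
    quoteValue ia ib Γ u v (x + Pi.single ib 1) = Γ (x ia).natAbs ((x ib).natAbs - 1) := by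
  have h := (mem_quoteSet_iff.1 hx).1.1
  have h' := (mem_quoteSet_iff.1 hx).2.1
  by_cases h1 : x ib = -1
  · rw [quoteValue_of_gt (midPrice_add_single_lt_of_depleted hlt hx h1)]
    obtain ⟨a, ha⟩ : ∃ a, (x ia).natAbs = a + 1 := ⟨(x ia).natAbs - 1, by omega⟩
    rw [ha, h1]
    exact (hv a).symm
  · rw [quoteValue_of_mem (add_single_mem hlt hx (Or.inr ⟨le_rfl, h', fun _ => h1⟩)),
      add_single_apply, add_single_apply, if_pos rfl, if_neg hlt.ne', add_zero]
    congr 1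
    omega

/-- The generator of the book, applied to a function of the best queues. -/
lemma sum_rate_mul_quoteValue_sub (hs₀ : level ia = level ib + s₀) (hξ : FactorsAtSpread R s₀ ξ)
    (hu : ∀ c, Γ 0 (c + 1) = u) (hv : ∀ a, Γ (a + 1) 0 = v) {a c : ℕ}
    (ha : (x ia).natAbs = a + 1) (hc : (x ib).natAbs = c + 1) :
    ∑ i, ((upRate R x i : ℝ) * (quoteValue ia ib Γ u v (x + Pi.single i 1) -
          quoteValue ia ib Γ u v x) +
        (downRate R x i : ℝ) * (quoteValue ia ib Γ u v (x - Pi.single i 1) -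
          quoteValue ia ib Γ u v x)) =
      birth R s₀ ξ .ask (a + 1) * (Γ (a + 2) (c + 1) - Γ (a + 1) (c + 1)) +
      death R s₀ ξ .ask (a + 1) * (Γ a (c + 1) - Γ (a + 1) (c + 1)) +
      (birth R s₀ ξ .bid (c + 1) * (Γ (a + 1) (c + 2) - Γ (a + 1) (c + 1)) +
      death R s₀ ξ .bid (c + 1) * (Γ (a + 1) c - Γ (a + 1) (c + 1))) +
      (insideAskRate R s₀ ξ * (v - Γ (a + 1) (c + 1)) +
      insideBidRate R s₀ ξ * (u - Γ (a + 1) (c + 1))) := by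
  have hval : quoteValue ia ib Γ u v x = Γ (a + 1) (c + 1) := by
    rw [quoteValue_of_mem hx, ha, hc]
  set A : ℝ := birth R s₀ ξ .ask (a + 1) * (Γ (a + 2) (c + 1) - Γ (a + 1) (c + 1)) +
      death R s₀ ξ .ask (a + 1) * (Γ a (c + 1) - Γ (a + 1) (c + 1)) with hA
  set B : ℝ := birth R s₀ ξ .bid (c + 1) * (Γ (a + 1) (c + 2) - Γ (a + 1) (c + 1)) +
      death R s₀ ξ .bid (c + 1) * (Γ (a + 1) c - Γ (a + 1) (c + 1)) with hB
  set f : ℕ → ℝ := fun m => R.lam .ask 0 (ξ m) * (v - Γ (a + 1) (c + 1)) +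
    R.lam .bid 0 (ξ m) * (u - Γ (a + 1) (c + 1)) with hf
  have hinside : (insideAskRate R s₀ ξ * (v - Γ (a + 1) (c + 1)) +
      insideBidRate R s₀ ξ * (u - Γ (a + 1) (c + 1)) : ℝ) =
      ∑ i : Fin N, (if ib < i ∧ i < ia then f (level i - level ib) else 0) := by
    rw [sum_between hs₀ f, hf, Finset.sum_add_distrib, ← Finset.sum_mul, ← Finset.sum_mul,
      insideAskRate_eq, insideBidRate]
    push_cast
    rfl
  -- The generator is matched index by index: A sits at the best ask, B at the best bid, f strictly
  -- between them, and other levels contribute 0 because orders there leave the value unchanged.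
  have hsum : A + B + ∑ i : Fin N, (if ib < i ∧ i < ia then f (level i - level ib) else 0) =
      ∑ i : Fin N, ((if i = ia then A else 0) + (if i = ib then B else 0) +
        (if ib < i ∧ i < ia then f (level i - level ib) else 0)) := by
    simp [Finset.sum_add_distrib]
  rw [hinside, hsum]
  refine Finset.sum_congr rfl fun i _ => ?_
  rcases lt_trichotomy i ib with h | rfl | h
  · rw [if_neg (h.trans hlt).ne, if_neg h.ne, if_neg fun h' => lt_asymm h h'.1,
      quoteValue_sub_single_of_ne hlt hx (Or.inl h)]
    by_cases h0 : x i < 0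
    · rw [quoteValue_add_single_of_ne hlt hx (Or.inr ⟨h, h0⟩)]
      ring
    · rw [upRate_eq_zero hx h h0 hlt]
      simp
  · rw [if_neg hlt.ne, if_pos rfl, if_neg fun h' => lt_irrefl _ h'.1,
      quoteValue_sub_single_bid hlt hx, quoteValue_add_single_bid hlt hx hv,
      upRate_bid hlt hs₀ hξ hx, downRate_bid hlt hs₀ hξ hx, hval, ha, hc, hB,
      Nat.add_sub_cancel]
    ring
  rcases lt_trichotomy i ia with h2 | rfl | h2
  · rw [if_neg h2.ne, if_neg h.ne', if_pos ⟨h, h2⟩,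
      quoteValue_of_gt (midPrice_add_single_lt_of_between hlt hx h h2),
      quoteValue_of_lt (lt_midPrice_sub_single_of_between hlt hx h h2),
      upRate_between hlt hs₀ hξ hx h h2, downRate_between hlt hs₀ hξ hx h h2, hval, hf]
    ring
  · rw [if_pos rfl, if_neg h.ne', if_neg fun h' => lt_irrefl _ h'.2,
      quoteValue_add_single_ask hlt hx, quoteValue_sub_single_ask hlt hx hu,
      upRate_ask hlt hs₀ hξ hx, downRate_ask hlt hs₀ hξ hx, hval, ha, hc, hA,
      Nat.add_sub_cancel]
    ring
  · rw [if_neg h2.ne', if_neg h.ne', if_neg fun h' => lt_asymm h2 h'.2,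
      quoteValue_add_single_of_ne hlt hx (Or.inl h2)]
    by_cases h0 : 0 < x i
    · rw [quoteValue_sub_single_of_ne hlt hx (Or.inr ⟨h2, h0⟩)]
      ring
    · rw [downRate_eq_zero hx h2 h0 hlt]
      simp

/-- The resolvent equation of the book for a function of the best queues. -/
lemma totalRate_add_mul_quoteValue (hs₀ : level ia = level ib + s₀) (hξ : FactorsAtSpread R s₀ ξ)
    {Λ : ℝ≥0} (hΛA : Λ = insideAskRate R s₀ ξ) (hΛB : Λ = insideBidRate R s₀ ξ)
    (huv : u + v = 1) (hu : ∀ c, Γ 0 (c + 1) = u) (hv : ∀ a, Γ (a + 1) 0 = v)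
    (hnonneg : ∀ y, 0 ≤ quoteValue ia ib Γ u v y) {s : ℝ≥0}
    (hΓ : ∀ a c, (s + bdRate (birth R s₀ ξ .ask) (death R s₀ ξ .ask) (a + 1) +
        bdRate (birth R s₀ ξ .bid) (death R s₀ ξ .bid) (c + 1) + 2 * Λ) * Γ (a + 1) (c + 1) =
      birth R s₀ ξ .ask (a + 1) * Γ (a + 2) (c + 1) + death R s₀ ξ .ask (a + 1) * Γ a (c + 1) +
      birth R s₀ ξ .bid (c + 1) * Γ (a + 1) (c + 2) + death R s₀ ξ .bid (c + 1) * Γ (a + 1) c +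
      Λ) :
    ((totalRate (bookRate R) x + s : ℝ≥0) : ℝ≥0∞) * ENNReal.ofReal (quoteValue ia ib Γ u v x) =
      ∑' y, (bookRate R x y : ℝ≥0∞) * ENNReal.ofReal (quoteValue ia ib Γ u v y) := by
  have h := (mem_quoteSet_iff.1 hx).1.1
  have h' := (mem_quoteSet_iff.1 hx).2.1
  obtain ⟨a, ha⟩ : ∃ a, (x ia).natAbs = a + 1 := ⟨(x ia).natAbs - 1, by omega⟩
  obtain ⟨c, hc⟩ : ∃ c, (x ib).natAbs = c + 1 := ⟨(x ib).natAbs - 1, by omega⟩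
  have hgen := sum_rate_mul_quoteValue_sub (R := R) hlt hx hs₀ hξ hu hv ha hc
  rw [← hΛA, ← hΛB] at hgen
  have hval : quoteValue ia ib Γ u v x = Γ (a + 1) (c + 1) := by
    rw [quoteValue_of_mem hx, ha, hc]
  rw [tsum_bookRate_mul]
  have hterm : ∀ i, (upRate R x i : ℝ≥0∞) * ENNReal.ofReal
        (quoteValue ia ib Γ u v (x + Pi.single i 1)) +
      (downRate R x i : ℝ≥0∞) * ENNReal.ofReal (quoteValue ia ib Γ u v (x - Pi.single i 1)) =
      ENNReal.ofReal ((upRate R x i : ℝ) * quoteValue ia ib Γ u v (x + Pi.single i 1) +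
        (downRate R x i : ℝ) * quoteValue ia ib Γ u v (x - Pi.single i 1)) := by
    intro i
    rw [ENNReal.ofReal_add (mul_nonneg (NNReal.coe_nonneg _) (hnonneg _))
      (mul_nonneg (NNReal.coe_nonneg _) (hnonneg _)), ENNReal.ofReal_mul (NNReal.coe_nonneg _),
      ENNReal.ofReal_mul (NNReal.coe_nonneg _), ENNReal.ofReal_coe_nnreal,
      ENNReal.ofReal_coe_nnreal]
  simp_rw [hterm]
  rw [← ENNReal.ofReal_sum_of_nonneg fun i _ => add_nonneg
    (mul_nonneg (NNReal.coe_nonneg _) (hnonneg _)) (mul_nonneg (NNReal.coe_nonneg _) (hnonneg _)),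
    ← ENNReal.ofReal_coe_nnreal, ← ENNReal.ofReal_mul (NNReal.coe_nonneg _)]
  congr 1
  have htot : totalRate (bookRate R) x = ∑ i, (upRate R x i + downRate R x i) :=
    (hasSum_bookRate R x).tsum_eq
  have hsplit : ∑ i, ((upRate R x i : ℝ) * quoteValue ia ib Γ u v (x + Pi.single i 1) +
        (downRate R x i : ℝ) * quoteValue ia ib Γ u v (x - Pi.single i 1)) =
      ∑ i, ((upRate R x i : ℝ) * (quoteValue ia ib Γ u v (x + Pi.single i 1) -
          quoteValue ia ib Γ u v x) +
        (downRate R x i : ℝ) * (quoteValue ia ib Γ u v (x - Pi.single i 1) -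
          quoteValue ia ib Γ u v x)) + (totalRate (bookRate R) x : ℝ) * Γ (a + 1) (c + 1) := by
    rw [htot]
    push_cast
    rw [Finset.sum_mul, ← Finset.sum_add_distrib]
    refine Finset.sum_congr rfl fun i _ => ?_
    rw [hval]
    ring
  rw [hsplit, hgen, hval]
  have hac := hΓ a c
  simp only [bdRate] at hac
  push_cast at hac ⊢
  -- With the common rate Λ and u + v = 1, the in-spread terms collapse to Λ - 2ΛΓ, as in the
  -- equation of the race.
  linear_combination hac - (Λ : ℝ) * huv

end Value

/-! ### Conditional probabilities of the two moves -/

section Move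

variable {N : ℕ} {𝒳 : Type*} {R : OrderFlow N 𝒳} {ia ib : Fin N} {Ω : Type*} [MeasurableSpace Ω]
  {P : Measure Ω} [IsProbabilityMeasure P] {Q : ℝ≥0 → Ω → Book N}

lemma summable_bookRate (R : OrderFlow N 𝒳) (x : Book N) : Summable (bookRate R x) :=
  (hasSum_bookRate R x).summable

/-- Law of the book after the first move of the mid-price, for a fixed initial book. -/
lemma measure_moveTime_inter (hQ : IsMarkovJumpProcess P (bookRate R) Q) (hlt : ib < ia)
    {U : Set (Book N)} (hU : Disjoint U (quoteSet ia ib)) {x₀ : Book N}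
    (hx₀ : x₀ ∈ quoteSet ia ib) {g : ℝ≥0 → Book N → ℝ≥0∞} (hg : ∀ s x, 0 < s → g s x ≤ 1)
    (hgU : ∀ s x, x ∉ quoteSet ia ib → g s x = U.indicator 1 x)
    (heq : ∀ s x, 0 < s → x ∈ quoteSet ia ib →
      ((totalRate (bookRate R) x + s : ℝ≥0) : ℝ≥0∞) * g s x =
        ∑' y, (bookRate R x y : ℝ≥0∞) * g s y)
    {p : ℝ≥0∞} (hp : Tendsto (fun m : ℕ => g (1 / ((m : ℝ≥0) + 1)) x₀) atTop (𝓝 p)) :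
    P ({ω | Q 0 ω = x₀} ∩ {ω | Q (moveTime Q ω) ω ∈ U}) = P {ω | Q 0 ω = x₀} * p := by
  obtain ⟨Y, H, hJ, hpath⟩ := hQ.exists_isJumpChain (summable_bookRate R)
  have hexp : ∀ᵐ ω ∂P, ∑' k, H k ω = ∞ := by
    filter_upwards [hpath] with ω h using h.tsum_eq_top
  have hmain := hJ.measure_exitInto (summable_bookRate R) hexp hx₀ hg hgU heq hp
  have h0 : P {ω | Q 0 ω = x₀} = P {ω | Y 0 ω = x₀} := by
    refine measure_congr ?_
    filter_upwards [hpath] with ω h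
    refine propext ?_
    change Q 0 ω = x₀ ↔ Y 0 ω = x₀
    rw [h.apply_zero]
  rw [h0, ← hmain]
  refine measure_congr ?_
  filter_upwards [hpath, hJ.ae_jumpProb_ne_zero (summable_bookRate R)] with ω h hjump
  refine propext ?_
  change Q 0 ω = x₀ ∧ Q (moveTime Q ω) ω ∈ U ↔ ω ∈ exitInto Y H (quoteSet ia ib) U ∧ Y 0 ω = x₀
  rw [h.apply_zero, and_comm, and_congr_left_iff]
  intro hY0
  have hφ : ∀ x ∈ quoteSet ia ib, midPrice x = quoteMid ia ib := fun x hx => midPrice_of_mem hx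
  -- If the quotes never change in finite time, `moveTime` takes its default value 0. The book then
  -- still lies in the quote set, which is disjoint from U, so both events fail.
  have hstay : (∀ t, Q t ω ∈ quoteSet ia ib) → ω ∉ exitInto Y H (quoteSet ia ib) U →
      (Q (moveTime Q ω) ω ∈ U ↔ ω ∈ exitInto Y H (quoteSet ia ib) U) := fun h1 h2 =>
    ⟨fun h3 => absurd (h1 _) (Set.disjoint_left.1 hU h3), fun h3 => absurd h3 h2⟩
  by_cases hall : ∀ j, Y j ω ∈ quoteSet ia ib
  · refine hstay (h.mem_of_forall hall) ?_
    rintro ⟨n, -, h2, -⟩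
    exact h2 (hall _)
  obtain ⟨n, hn⟩ := exists_mem_exitEvent hx₀ hY0 hall
  have huniq : ω ∈ exitInto Y H (quoteSet ia ib) U ↔
      ∑ k ∈ Finset.range (n + 1), H k ω ≠ ∞ ∧ Y (n + 1) ω ∈ U := by
    constructor
    · rintro ⟨n', h1, h2, h3⟩
      have : n' = n := by
        by_contra hne
        exact Set.disjoint_left.1 (disjoint_exitEvent _ x₀ hne)
          (show ω ∈ exitEvent Y (quoteSet ia ib) x₀ n' from ⟨hY0, h1, h2⟩) hn
      exact this ▸ h3
    · exact fun h1 => ⟨n, hn.2.1, hn.2.2, h1⟩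
  by_cases hfin : ∑ k ∈ Finset.range (n + 1), H k ω = ∞
  · refine hstay (fun t => h.mem_of_lt hn.2.1 ?_) fun h1 => (huniq.1 h1).1 hfin
    rw [hfin]
    exact ENNReal.coe_lt_top
  · have hYn := hn.2.1 n le_rfl
    -- Every jump with positive rate out of the quote set changes the mid-price, so the first
    -- mid-price move is exactly the exit.
    have hne : midPrice (Y (n + 1) ω) ≠ quoteMid ia ib :=
      midPrice_ne_of_bookRate_ne_zero hlt hYn hn.2.2
        (rate_ne_zero_of_jumpProb_ne_zero (hjump n) fun h1 => hn.2.2 (h1 ▸ hYn))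
    have hmove : Q (moveTime Q ω) ω = Y (n + 1) ω := h.apply_sInf_ne hφ hn.2.1 hne hfin
    rw [hmove, huniq]
    exact ⟨fun h1 => ⟨hfin, h1⟩, fun h1 => h1.2⟩

/-- The set M need not be measurable: `P.restrict M` is a measure, and it is evaluated only on the
measurable fibres of X. -/
lemma measure_preimage_inter_eq_mul {S : Type*} [MeasurableSpace S] [Countable S]
    [MeasurableSingletonClass S] {X : Ω → S} (hX : Measurable X) (A : Set S) (M : Set Ω) (p : ℝ≥0∞)
    (h : ∀ x ∈ A, P ({ω | X ω = x} ∩ M) = P {ω | X ω = x} * p) :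
    P (X ⁻¹' A ∩ M) = P (X ⁻¹' A) * p := by
  have hm : ∀ x, MeasurableSet {ω | X ω = x} := fun x => hX (measurableSet_singleton x)
  have hU : X ⁻¹' A = ⋃ x ∈ A, {ω | X ω = x} := by ext ω; simp
  have hd : A.PairwiseDisjoint fun x => {ω | X ω = x} := fun x _ y _ hxy =>
    Set.disjoint_left.2 fun ω h1 h2 => hxy (h1.symm.trans h2)
  have hA : MeasurableSet (X ⁻¹' A) := hX A.to_countable.measurableSet
  rw [← Measure.restrict_apply hA, hU, measure_biUnion A.to_countable hd fun x _ => hm x,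
    measure_biUnion A.to_countable hd fun x _ => hm x, ← ENNReal.tsum_mul_right]
  refine tsum_congr fun x => ?_
  rw [Measure.restrict_apply (hm _), h x x.2]

variable {q : Side → ℕ} {s₀ : ℕ} {ξ : ℕ → 𝒳}

/-- Books with the prescribed best queues and spread. -/
def initialSet (N : ℕ) (q : Side → ℕ) (s₀ : ℕ) : Set (Book N) :=
  {x | queueSize x (bestAsk x) = q .ask ∧ queueSize x (bestBid x) = q .bid ∧ spread x = s₀}

/-- The conventional quotes 0 and N + 1 of an empty side have queue size 0, so positive queue sizes
force both quotes to be actual levels. -/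
lemma exists_quotes (hq : ∀ i, 1 ≤ q i) (hs₀ : 1 ≤ s₀) {x : Book N}
    (hx : x ∈ initialSet N q s₀) : ∃ ia ib : Fin N, x ∈ quoteSet ia ib ∧ ib < ia ∧
      level ia = level ib + s₀ ∧ (x ia).natAbs = q .ask ∧ (x ib).natAbs = q .bid := by
  obtain ⟨h1, h2, h3⟩ := hx
  have hpos : ∀ l, queueSize x l ≠ 0 → ∃ i : Fin N, level i = l := by
    intro l hl
    obtain ⟨i, -, hi⟩ := Finset.exists_ne_zero_of_sum_ne_zero hl
    exact ⟨i, by by_contra hne; simp [hne] at hi⟩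
  obtain ⟨ia, hia⟩ := hpos (bestAsk x) (by have := hq .ask; omega)
  obtain ⟨ib, hib⟩ := hpos (bestBid x) (by have := hq .bid; omega)
  rw [← hia, queueSize_level] at h1
  rw [← hib, queueSize_level] at h2
  rw [spread, ← hia, ← hib] at h3
  have hlev : level ia = level ib + s₀ := by omega
  exact ⟨ia, ib, ⟨hia.symm, hib.symm⟩, level_lt_level.1 (by omega), hlev, h1, h2⟩

/-- The probability of the move is the same p for every book in the initial set, so conditioning on
the event returns p whatever the initial law. -/
lemma cond_initialEvent_real (hQ : IsMarkovJumpProcess P (bookRate R) Q)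
    (hinit : P (initialEvent Q q s₀) ≠ 0) (M : Set Ω) {p : ℝ} (hp : 0 ≤ p)
    (h : ∀ x ∈ initialSet N q s₀, P ({ω | Q 0 ω = x} ∩ M) =
      P {ω | Q 0 ω = x} * ENNReal.ofReal p) :
    (ProbabilityTheory.cond P (initialEvent Q q s₀)).real M = p := by
  have hE : initialEvent Q q s₀ = Q 0 ⁻¹' initialSet N q s₀ := rfl
  have hm : MeasurableSet (initialEvent Q q s₀) := by
    rw [hE]
    exact hQ.1 0 (Set.to_countable _).measurableSet
  rw [measureReal_def, cond_apply hm, hE, measure_preimage_inter_eq_mul (hQ.1 0) _ M _ h, ← hE,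
    ← mul_assoc, ENNReal.inv_mul_cancel hinit (measure_ne_top _ _), one_mul,
    ENNReal.toReal_ofReal hp]

variable (hq : ∀ i, 1 ≤ q i) (hs₀ : 1 ≤ s₀) (hξ : FactorsAtSpread R s₀ ξ)
  (hbirth : ∀ i k, 0 < birth R s₀ ξ i k) {Λ : ℝ≥0} (hΛA : Λ = insideAskRate R s₀ ξ)
  (hΛB : Λ = insideBidRate R s₀ ξ) (hQ : IsMarkovJumpProcess P (bookRate R) Q)
  (hinit : P (initialEvent Q q s₀) ≠ 0)

include hq hs₀ hξ hbirth hΛA hΛB hQ hinit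

/-- Probability of an upward move of the mid-price. -/
theorem cond_moveUp : (ProbabilityTheory.cond P (initialEvent Q q s₀)).real (moveUp Q) =
    ∫ t in Set.Ioi (0 : ℝ), survPdf (birth R s₀ ξ .ask) (death R s₀ ξ .ask) Λ (q .ask) t *
      surv (birth R s₀ ξ .bid) (death R s₀ ξ .bid) Λ (q .bid) t := by
  set ρ : ℝ → ℕ → ℕ → ℝ := fun s a c => raceProb (birth R s₀ ξ .ask) (death R s₀ ξ .ask)
    (birth R s₀ ξ .bid) (death R s₀ ξ .bid) Λ s a c with hρ
  obtain ⟨a, ha⟩ : ∃ a, q .ask = a + 1 := ⟨q .ask - 1, by have := hq .ask; omega⟩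
  have hlim := tendsto_raceProb (d₁ := death R s₀ ξ .ask) (d₂ := death R s₀ ξ .bid) Λ
    (hbirth .ask) (hbirth .bid) a (q .bid)
  rw [← ha] at hlim
  have hρ0 : ∀ s a c, 0 ≤ ρ s a c := fun s a c => raceProb_nonneg Λ (hbirth .ask) (hbirth .bid) s a c
  refine cond_initialEvent_real hQ hinit _ (ge_of_tendsto' hlim fun m => hρ0 _ _ _) fun x₀ hx₀ => ?_
  obtain ⟨ia, ib, hmem, hlt, hlev, hqa, hqb⟩ := exists_quotes hq hs₀ hx₀
  have hset : {ω | Q 0 ω = x₀} ∩ moveUp Q =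
      {ω | Q 0 ω = x₀} ∩ {ω | Q (moveTime Q ω) ω ∈ {y | quoteMid ia ib < midPrice y}} := by
    ext ω
    refine and_congr_right fun h0 => ?_
    change midPrice (Q 0 ω) < _ ↔ quoteMid ia ib < _
    rw [show Q 0 ω = x₀ from h0, midPrice_of_mem hmem]
  have hval0 : ∀ s y, 0 ≤ quoteValue ia ib (ρ s) 1 0 y := by
    intro s y
    unfold quoteValue
    split_ifs
    · exact hρ0 _ _ _
    all_goals norm_num
  rw [hset]
  refine measure_moveTime_inter hQ hlt
    (Set.disjoint_left.2 fun y h1 h2 => (midPrice_of_mem h2).not_gt h1) hmem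
    (U := {y | quoteMid ia ib < midPrice y})
    (g := fun s y => ENNReal.ofReal (quoteValue ia ib (ρ s) 1 0 y)) ?_ ?_ ?_ ?_
  · intro s y hs
    rw [ENNReal.ofReal_le_one]
    unfold quoteValue
    split_ifs
    · exact raceProb_le_one Λ (hbirth .ask) (hbirth .bid) s.coe_nonneg _ _
    all_goals norm_num
  · intro s y hy
    rw [quoteValue, if_neg hy]
    by_cases h : quoteMid ia ib < midPrice y
    · rw [if_pos h, Set.indicator_of_mem (by exact h)]
      simp
    · rw [if_neg h, Set.indicator_of_notMem (by exact h)]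
      simp
  · intro s y hs hy
    refine totalRate_add_mul_quoteValue hlt hy hlev hξ hΛA hΛB (by norm_num)
      (fun c => raceProb_zero_left _ _ _ _ _ _ _) (fun a => raceProb_zero_right _ _ _ _ _ _ _)
      (hval0 s) fun a c => raceProb_succ Λ (hbirth .ask) (hbirth .bid) s.coe_nonneg a c
  · refine (ENNReal.tendsto_ofReal hlim).congr fun m => ?_
    rw [quoteValue_of_mem hmem, hqa, hqb]
    push_cast
    rfl

/-- Probability of a downward move of the mid-price. -/
theorem cond_moveDown : (ProbabilityTheory.cond P (initialEvent Q q s₀)).real (moveDown Q) =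
    ∫ t in Set.Ioi (0 : ℝ), survPdf (birth R s₀ ξ .bid) (death R s₀ ξ .bid) Λ (q .bid) t *
      surv (birth R s₀ ξ .ask) (death R s₀ ξ .ask) Λ (q .ask) t := by
  -- The bid is now the first competitor. The arguments are swapped because the value function takes
  -- the ask size first.
  set ρ : ℝ → ℕ → ℕ → ℝ := fun s a c => raceProb (birth R s₀ ξ .bid) (death R s₀ ξ .bid)
    (birth R s₀ ξ .ask) (death R s₀ ξ .ask) Λ s c a with hρ
  obtain ⟨c, hc⟩ : ∃ c, q .bid = c + 1 := ⟨q .bid - 1, by have := hq .bid; omega⟩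
  have hlim := tendsto_raceProb (d₁ := death R s₀ ξ .bid) (d₂ := death R s₀ ξ .ask) Λ
    (hbirth .bid) (hbirth .ask) c (q .ask)
  rw [← hc] at hlim
  have hρ0 : ∀ s a c, 0 ≤ ρ s a c := fun s a c => raceProb_nonneg Λ (hbirth .bid) (hbirth .ask) s c a
  refine cond_initialEvent_real hQ hinit _ (ge_of_tendsto' hlim fun m => hρ0 _ _ _) fun x₀ hx₀ => ?_
  obtain ⟨ia, ib, hmem, hlt, hlev, hqa, hqb⟩ := exists_quotes hq hs₀ hx₀
  have hset : {ω | Q 0 ω = x₀} ∩ moveDown Q =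
      {ω | Q 0 ω = x₀} ∩ {ω | Q (moveTime Q ω) ω ∈ {y | midPrice y < quoteMid ia ib}} := by
    ext ω
    refine and_congr_right fun h0 => ?_
    change _ < midPrice (Q 0 ω) ↔ _ < quoteMid ia ib
    rw [show Q 0 ω = x₀ from h0, midPrice_of_mem hmem]
  have hval0 : ∀ s y, 0 ≤ quoteValue ia ib (ρ s) 0 1 y := by
    intro s y
    unfold quoteValue
    split_ifs
    · exact hρ0 _ _ _
    all_goals norm_num
  rw [hset]
  refine measure_moveTime_inter hQ hlt
    (Set.disjoint_left.2 fun y h1 h2 => (midPrice_of_mem h2).not_lt h1) hmem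
    (U := {y | midPrice y < quoteMid ia ib})
    (g := fun s y => ENNReal.ofReal (quoteValue ia ib (ρ s) 0 1 y)) ?_ ?_ ?_ ?_
  · intro s y hs
    rw [ENNReal.ofReal_le_one]
    unfold quoteValue
    split_ifs
    · exact raceProb_le_one Λ (hbirth .bid) (hbirth .ask) s.coe_nonneg _ _
    all_goals norm_num
  · intro s y hy
    rw [quoteValue, if_neg hy]
    by_cases h : midPrice y < quoteMid ia ib
    · rw [if_pos h, if_neg (not_lt.2 h.le), Set.indicator_of_mem (by exact h)]
      simp
    · rw [if_neg h, Set.indicator_of_notMem (by exact h)]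
      simp
  · intro s y hs hy
    refine totalRate_add_mul_quoteValue hlt hy hlev hξ hΛA hΛB (by norm_num)
      (fun c => raceProb_zero_right _ _ _ _ _ _ _) (fun a => raceProb_zero_left _ _ _ _ _ _ _)
      (hval0 s) fun a c => ?_
    have h := raceProb_succ (d₁ := death R s₀ ξ .bid) (d₂ := death R s₀ ξ .ask) Λ (hbirth .bid)
      (hbirth .ask) s.coe_nonneg c a
    simp only [hρ]
    linear_combination h
  · refine (ENNReal.tendsto_ofReal hlim).congr fun m => ?_
    rw [quoteValue_of_mem hmem, hqa, hqb]
    push_cast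
    rfl

end Move

end LOB

end

/-! ### Assembly -/

theorem mainTheorem1 {N : ℕ} {𝒳 : Type*} (R : LOB.OrderFlow N 𝒳)
    -- initial best-queue sizes and initial spread
    (q : LOB.Side → ℕ) (hq : ∀ i, 1 ≤ q i) (s₀ : ℕ) (hs₀ : 1 ≤ s₀)
    -- the factors at and between the best quotes at spread `s₀`
    (ξ : ℕ → 𝒳) (hξ : LOB.FactorsAtSpread R s₀ ξ)
    (hbirth : ∀ i k, 0 < LOB.birth R s₀ ξ i k)
    (hdeath : ∀ i k, 1 ≤ k → 0 < LOB.death R s₀ ξ i k)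
    -- `Λ` is the total rate of in-spread arrivals, the same on both sides
    (Λ : ℝ≥0) (hΛA : Λ = LOB.insideAskRate R s₀ ξ) (hΛB : Λ = LOB.insideBidRate R s₀ ξ)
    -- the order book
    {Ω : Type*} [MeasurableSpace Ω] (P : Measure Ω) [IsProbabilityMeasure P]
    (Q : ℝ≥0 → Ω → LOB.Book N) (hQ : LOB.IsMarkovJumpProcess P (LOB.bookRate R) Q)
    (hinit : P (LOB.initialEvent Q q s₀) ≠ 0)
    -- the two best queues as birth-death processes, at the rates of spread `s₀`
    {Ω' : Type*} [MeasurableSpace Ω'] (P' : Measure Ω') [IsProbabilityMeasure P']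
    (Z : LOB.Side → ℝ≥0 → Ω' → ℕ)
    (hZ : ∀ i, LOB.IsMarkovJumpProcess P'
      (LOB.birthDeathRate (LOB.birth R s₀ ξ i) (LOB.death R s₀ ξ i)) (Z i))
    (hZ0 : ∀ i, ∀ᵐ ω ∂P', Z i 0 ω = q i)
    -- their first-passage times to `0`
    (σ : LOB.Side → Ω' → ℝ≥0∞) (hσ : ∀ i, σ i = LOB.firstPassage (Z i) 0)
    -- the products of continued fractions
    (fhat : LOB.Side → ℂ → ℂ)
    (hfhat : ∀ i, fhat i = LOB.cfTransform (LOB.birth R s₀ ξ i) (LOB.death R s₀ ξ i) (q i)) :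
    -- Laplace transforms of the depletion times
    (∀ i, ∃ f : ℝ → ℝ, LOB.IsDensity P' (σ i) f ∧
      (∀ s : ℂ, 0 ≤ s.re →
        IntegrableOn (fun t : ℝ => Complex.exp (-s * t) * (f t : ℂ)) (Set.Ioi 0)) ∧
      ∀ s : ℂ, IntegrableOn (fun t : ℝ => Complex.exp (-s * t) * (f t : ℂ)) (Set.Ioi 0) →
        (∀ j ∈ Finset.Icc 1 (q i), ∃ v : ℂ,
          LOB.HasContFrac (LOB.numer (LOB.birth R s₀ ξ i) (LOB.death R s₀ ξ i))
            (LOB.denom (LOB.birth R s₀ ξ i) (LOB.death R s₀ ξ i) s) j v) ∧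
        ∫ t in Set.Ioi (0 : ℝ), Complex.exp (-s * t) * (f t : ℂ) = fhat i s) ∧
    -- upward move
    (∀ γ : ℝ, LOB.Admissible P' (σ .bid) Λ γ →
      LOB.HasInverseLaplaceAt (LOB.moveTransform (fhat .ask) (fhat .bid) Λ) γ 0
        (((ProbabilityTheory.cond P (LOB.initialEvent Q q s₀)).real (LOB.moveUp Q) : ℝ) : ℂ)) ∧
    -- downward move
    (∀ γ : ℝ, LOB.Admissible P' (σ .ask) Λ γ →
      LOB.HasInverseLaplaceAt (LOB.moveTransform (fhat .bid) (fhat .ask) Λ) γ 0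
        (((ProbabilityTheory.cond P (LOB.initialEvent Q q s₀)).real (LOB.moveDown Q) : ℝ) : ℂ)) ∧
    -- spread of one tick
    (s₀ = 1 → ∀ s : ℂ,
      LOB.moveTransform (fhat .ask) (fhat .bid) Λ s = 1 / s * fhat .ask s * fhat .bid (-s) ∧
      LOB.moveTransform (fhat .bid) (fhat .ask) Λ s = 1 / s * fhat .bid s * fhat .ask (-s)) := by
  have hZ1 := fun i => LOB.isDensity_passPdf (hbirth i) (hZ i) (hq i) (hZ0 i)
  have hind : ∀ (i : LOB.Side) (s : ℂ), Set.EqOn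
      (fun t : ℝ => Complex.exp (-s * t) * (((Set.Ioi (0 : ℝ)).indicator (LOB.passPdf
        (LOB.birth R s₀ ξ i) (LOB.death R s₀ ξ i) (q i)) t : ℝ) : ℂ))
      (fun t : ℝ => Complex.exp (-s * t) * (LOB.passPdf
        (LOB.birth R s₀ ξ i) (LOB.death R s₀ ξ i) (q i) t : ℂ)) (Set.Ioi 0) := by
    intro i s t ht
    simp only [Set.indicator_of_mem ht]
  have hsucc : ∀ i, ∃ a, q i = a + 1 := fun i => ⟨q i - 1, by have := hq i; omega⟩
  refine ⟨fun i => ⟨_, hσ i ▸ hZ1 i, fun s hs => ?_, fun s hs => ?_⟩, fun γ hγ => ?_, fun γ hγ => ?_,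
    fun h1 s => ?_⟩
  · refine IntegrableOn.congr_fun ?_ (hind i s).symm measurableSet_Ioi
    exact LOB.integrableOn_exp_mul_passPdf (hbirth i) (ne_top_of_le_ne_top ENNReal.one_ne_top
      (LOB.lap_le_one (hbirth i) hs _))
  · have hs' := hs.congr_fun (hind i s) measurableSet_Ioi
    rw [LOB.integrableOn_exp_mul_passPdf_iff (hbirth i) (by have := hq i; omega)] at hs'
    obtain ⟨hcf, heq⟩ := LOB.hasContFrac_and_cfTransform_eq (hbirth i) (hdeath i) (hq i) hs'
    refine ⟨fun j hj => hcf j (Finset.mem_Icc.1 hj).1, ?_⟩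
    rw [hfhat, heq]
    exact setIntegral_congr_fun measurableSet_Ioi (hind i s)
  · rw [LOB.cond_moveUp hq hs₀ hξ hbirth hΛA hΛB hQ hinit, hfhat, hfhat]
    rw [hσ] at hγ
    have htilt := LOB.tiltCondition_of_admissible (hbirth .bid) (hZ .bid) (hq .bid) (hZ0 .bid) hγ
    obtain ⟨a, ha⟩ := hsucc .ask
    obtain ⟨c, hc⟩ := hsucc .bid
    rw [hc] at htilt
    rw [ha, hc]
    exact LOB.hasInverseLaplaceAt_moveTransform (hbirth .ask) (hdeath .ask) (hbirth .bid)
      (hdeath .bid) htilt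
  · rw [LOB.cond_moveDown hq hs₀ hξ hbirth hΛA hΛB hQ hinit, hfhat, hfhat]
    rw [hσ] at hγ
    have htilt := LOB.tiltCondition_of_admissible (hbirth .ask) (hZ .ask) (hq .ask) (hZ0 .ask) hγ
    obtain ⟨a, ha⟩ := hsucc .ask
    obtain ⟨c, hc⟩ := hsucc .bid
    rw [ha] at htilt
    rw [ha, hc]
    exact LOB.hasInverseLaplaceAt_moveTransform (hbirth .bid) (hdeath .bid) (hbirth .ask)
      (hdeath .ask) htilt
  · have hΛ : Λ = 0 := by
      rw [hΛB, h1]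
      simp [LOB.insideBidRate]
    simp [LOB.moveTransform, LOB.clockTransform, hΛ]
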